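/- **Setting.** Let $d\in\mathbb N$, $H\in(1/2,1)$, $b:\mathbb R^d\to\mathbb R^d$ and $\sigma:\mathbb R^d\to\mathbb R^{d\times d}$ continuous. Fix $\theta_0\in(1/2,H)$, $\alpha\in(0,1/2)$, $\beta\ge1$, $\varsigma>1$, $\rho_0\in(0,1)$, probability laws $\bar\mu_1,\bar\mu_2$ on $\mathbb R^d$ and a measurable $\Psi:\mathbb R^d\to(0,\infty)$ with $\int\Psi\,d\bar\mu_1+\int\Psi\,d\bar\mu_2<\infty$. For a path $f$ put $\|f\|_\theta^{a,b}=\sup_{a\le s<t\le b}|f(t)-f(s)|/(t-s)^\theta$, and for $T\ge0$, $t>0$, $(\mathcal R_Tg)(t)=\int_{-\infty}^0\frac{t^{1/2-H}(T-s)^{H-1/2}}{t+T-s}g(s)\,ds$. For every $K>0$ let a coupling scheme of the following kind be given (on a probability space with a filtration $(\mathcal F_t)$; the constants $c_2,c_3,C_K$ and those of the first attempt in Step 2 may depend on $K$). $W^1,W^2$ are two-sided $d$-dimensional Brownian motions, $B^j_t=\alpha_H\int_{\mathbb R}\big((t-r)_+^{H-1/2}-(-r)_+^{H-1/2}\big)dW^j_r$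 are the fractional Brownian motions they drive, $X^1,X^2$ solve $dX^j=b(X^j)dt+\sigma(X^j)dB^j$ on $[0,\infty)$, $X^j_0\sim\bar\mu_j$, $W^j$ and $X^j$ are adapted, and $W^2_t-W^1_t=\int_0^tg_w(s)ds$ with $g_w=0$ before $\tau_0:=\inf\{u\in\{1,2,\dots\}:\rho_0^u(\Psi(X_0^1)+\Psi(X_0^2))\le1\}$. Trial $k\ge1$ begins at $\tau_{k-1}$ when $\tau_{k-1}<\infty$. At time $0$ and at the beginning of each trial, of each attempt of Step 2 and of each Step 3 (these are stopping times), the future increments of $W^1$, and those of $W^2$, form a Brownian motion independent of the past. * *Step 1*, on $[\tau_{k-1},\tau_{k-1}+1]$. If the system is not $(K,\alpha)$-admissible at $\tau=\tau_{k-1}$, then $g_w=0$ and the step fails. Admissibility means $\sup_{T\ge0}\int_0^\infty(1+t)^{2\alpha}|(\mathcal R_Tg_w(\tau+\cdot))(t)|^2dt\le1$, $|X^j_\tau|\le K$ and $\varphi_\tau(W^j)\le K$ $(j=1,2)$, where, with $\varepsilon=(H-\theta_0)/2$, $$\varphi_\tau(w)=\sup_{\tau\le s<t\le\tau+1}\Big|\tfrac1{t-s}\int_{-\infty}^{\tau-1}\big((t-r)^{H-1/2}-(s-r)^{H-1/2}\big)dw_r\Big|+\|w\|_{1/2-\varepsilon}^{\tau-1,\tau}.$$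 Otherwise $(W^1,W^2)$ may be coupled in any way compatible with the above. The step may be declared successful only if $X^1=X^2$ at $S=\tau_{k-1}+1$ and the sticking drift $g_S(S+t)=-\frac{\sin(\pi(H-1/2))}{\pi}(\mathcal R_0g_w(S+\cdot))(t)$, $t>0$ (the one that keeps $B^2-B^1$ constant after $S$), satisfies $\int_0^\infty(1+t)^{2\alpha}|g_S(S+t)|^2dt\le C_K$ and $\|g_S\|_{L^2(I_\ell)}\le b_\ell$ for all $\ell\ge1$. Here $C_K\ge1$, $c_2=C_K^{1/(2\alpha)}$, $I_1,I_2,\dots$ are the consecutive intervals of lengths $|I_\ell|=c_22^\ell$ starting at $S$, $b_1=\sqrt{C_K}$ and $b_\ell=2^{-\alpha\ell}$ for $\ell\ge2$. * *Step 2*, if Step 1 succeeds. On $I_1,I_2,\dots$ successively, until a failure, one attempts to realise $g_w=g_S$: with $I_\ell=[s,s+L]$, $a=\|g_S\|_{L^2(I_\ell)}$ and $e=g_S(s+\cdot)/a$ (any unit vector of $L^2([0,L])$ if $a=0$), $W^j_{s+t}-W^j_s=U_j\int_0^te+R_t$ for $t\le L$, where, given $\mathcal F_s$, $(U_1,U_2)$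 is independent of $R$, $U_1,U_2$ are standard Gaussian, $r_1\le\mathbb P(U_2=U_1+a\mid\mathcal F_s)\le r_2$, $|U_2-U_1|\le M$, and $|U_1|,|U_2|\le M/2+b_\ell$ on $\{U_2=U_1+a\}$. For $\ell\ge2$, $r_1=1-b_\ell$, $r_2=1-b_\ell/2$ and $M=\max\{4b_\ell,-2\log(b_\ell/8)\}$; for $\ell=1$, $r_1,r_2\in(0,1)$ and $M>0$ are constants. The attempt succeeds iff $W^2-W^1-\int g_S$ is constant on $I_\ell$. If all attempts succeed, $\tau_k=\infty$. * *Step 3*. If attempt $\ell$ is the first to fail ($\ell=0$: Step 1 fails), then after the end of $I_\ell$ (of Step 1 if $\ell=0$) one waits with $g_w=0$ for a time $c_3a_k2^{\beta\ell}$, with $c_3\ge2c_2$, and $\tau_k$ is the end of this period. Let $\mathcal E_k=\{\tau_k<\infty\}$ and $\Delta\tau_k=\tau_k-\tau_{k-1}$. **Proposition.** Assume that $a_k=\varsigma^k$ for all $k\ge1$ and that there is $\delta_1\in(0,1)$ with $\mathbb P(\mathcal E_m\mid\mathcal E_{m-1})\ge\delta_1$ for all $m\ge1$ and $K>0$. Then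 for every $\theta\in(1/2,H)$ condition $\mathbf{H}_2'(\theta)$ holds: for every $\rho\in(0,1)$ there is $C_\rho>0$ such that for all $k\ge1$, all $K>0$ and $j=1,2$, $$\mathbb E\Big[\sum_{u=1}^{\lfloor\Delta\tau_k\rfloor}\rho^{\Delta\tau_k-u}\,\|B^j\|_\theta^{\tau_{k-1}+u-1,\,\tau_{k-1}+u}\ \Big|\ \mathcal E_k\Big]\le C_\rho.$$ -/

import Mathlib

open MeasureTheory ProbabilityTheory Filter Topology Set
open scoped ENNReal NNReal

noncomputable section

namespace FracCoupling

/-- The state space `ℝ^d` with its Euclidean norm. -/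
abbrev E (d : ℕ) : Type := EuclideanSpace ℝ (Fin d)

/-! ### Pathwise integrals -/

section Paths

variable {V V' : Type*} [NormedAddCommGroup V] [NormedSpace ℝ V]
  [NormedAddCommGroup V'] [NormedSpace ℝ V']

/-- The Riemann-Stieltjes sums `∑ f(ξ_i) (w(x_{i+1}) - w(x_i))` over tagged partitions of `[a, b]`
converge to `I` as the mesh tends to `0`.  For `f` continuous of bounded variation and `w`
continuous this is the classical Riemann-Stieltjes integral; for Hölder functions whose exponents
sum to more than `1` it is the Young integral. -/
def HasRS (f : ℝ → V →L[ℝ] V') (w : ℝ → V) (a b : ℝ) (I : V') : Prop :=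
  ∀ ε > 0, ∃ δ > 0, ∀ (n : ℕ) (x ξ : ℕ → ℝ), Monotone x → x 0 = a → x n = b →
    (∀ i < n, x (i + 1) - x i < δ) → (∀ i < n, ξ i ∈ Icc (x i) (x (i + 1))) →
    ‖(∑ i ∈ Finset.range n, f (ξ i) (w (x (i + 1)) - w (x i))) - I‖ < ε

/-- `I = ∫_{-∞}^b k(r) dw_r`, as the limit of `∫_A^b k(r) dw_r` when `A → -∞`
(scalar integrand). -/
def HasImproperRS (k : ℝ → ℝ) (w : ℝ → V) (b : ℝ) (I : V) : Prop :=
  ∃ J : ℝ → V,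
    (∀ᶠ A in atBot, HasRS (fun r => k r • ContinuousLinearMap.id ℝ V) w A b (J A)) ∧
    Tendsto J atBot (𝓝 I)

open Classical in
/-- The value of `∫_{-∞}^b k(r) dw_r` (and `0` if the integral does not exist). -/
def improperRS (k : ℝ → ℝ) (w : ℝ → V) (b : ℝ) : V :=
  if h : ∃ I, HasImproperRS k w b I then h.choose else 0

/-- The Hölder seminorm `‖f‖_θ^{a,b} = sup_{a ≤ s < t ≤ b} |f(t) - f(s)| / (t - s)^θ`,
with values in `[0, ∞]`. -/
def holder (θ : ℝ) (f : ℝ → V) (a b : ℝ) : ℝ≥0∞ :=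
  ⨆ (s : ℝ) (t : ℝ) (_ : a ≤ s ∧ s < t ∧ t ≤ b), ENNReal.ofReal (‖f t - f s‖ / (t - s) ^ θ)

/-- `(R_T g)(t) = ∫_{-∞}^0 t^{1/2-H} (T-s)^{H-1/2} / (t+T-s) g(s) ds`. -/
def memoryOp (H T : ℝ) (g : ℝ → V) (t : ℝ) : V :=
  ∫ s in Iio (0 : ℝ), (t ^ (1 / 2 - H) * (T - s) ^ (H - 1 / 2) / (t + T - s)) • g s

/-- The path `g^τ(t) = g(t + τ)`. -/
def shiftPath (g : ℝ → V) (τ : ℝ) (t : ℝ) : V := g (t + τ)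

/-- The sticking drift after time `S`, as a function of the time `t > 0` elapsed since `S`:
`-(sin(π(H-1/2))/π) (R_0 g^S)(t)`.  By Abel's inversion formula it is the prolongation of `g`
beyond `S` for which `∫_{-∞}^{S+t} (S+t-r)^{H-3/2} g(r) dr = 0` for `t > 0`, that is, for which
the drift between the two fractional Brownian motions vanishes after `S`. -/
def stickDrift (H : ℝ) (g : ℝ → V) (S t : ℝ) : V :=
  (-(Real.sin (Real.pi * (H - 1 / 2)) / Real.pi)) • memoryOp H 0 (shiftPath g S) t

/-- `φ_{τ,ε}(w) = sup_{τ ≤ s < t ≤ τ+1}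
| (t-s)⁻¹ ∫_{-∞}^{τ-1} ((t-r)^{H-1/2} - (s-r)^{H-1/2}) dw_r | + ‖w‖_{1/2-ε}^{τ-1,τ}`. -/
def pastSize (H ε τ : ℝ) (w : ℝ → V) : ℝ≥0∞ :=
  (⨆ (s : ℝ) (t : ℝ) (_ : τ ≤ s ∧ s < t ∧ t ≤ τ + 1),
    ENNReal.ofReal ((t - s)⁻¹ *
      ‖improperRS (fun r => (t - r) ^ (H - 1 / 2) - (s - r) ^ (H - 1 / 2)) w (τ - 1)‖)) +
  holder (1 / 2 - ε) w (τ - 1) τ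

end Paths

/-! ### Brownian motions and fractional Brownian motions -/

section Processes

variable {d : ℕ} {Ω : Type*} [MeasurableSpace Ω]

/-- A `d`-dimensional standard Brownian motion on `[0, ∞)`. -/
structure IsBrownian (X : ℝ≥0 → Ω → E d) (P : Measure Ω) : Prop where
  coord : ∀ i, IsBrownianReal (fun t ω => X t ω i) P
  indep : iIndepFun (fun (i : Fin d) (ω : Ω) (t : ℝ≥0) => X t ω i) P

/-- A `d`-dimensional two-sided Brownian motion. -/
structure IsTwoSidedBrownian (W : ℝ → Ω → E d) (P : Measure Ω) : Prop where
  right : IsBrownian (fun t : ℝ≥0 => W t) P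
  left : IsBrownian (fun t : ℝ≥0 => W (-(t : ℝ))) P
  indep : IndepFun (fun ω (t : ℝ≥0) => W t ω) (fun ω (t : ℝ≥0) => W (-(t : ℝ)) ω) P

/-- The normalization constant for which `B_1` has unit variance. -/
def alphaH (H : ℝ) : ℝ :=
  (√((∫ r in Ioi (0 : ℝ), ((1 + r) ^ (H - 1 / 2) - r ^ (H - 1 / 2)) ^ 2) + 1 / (2 * H)))⁻¹

/-- `B_t = α_H ∫_ℝ ((t-r)_+^{H-1/2} - (-r)_+^{H-1/2}) dW_r` for all `t`, almost surely: the
Mandelbrot-Van Ness representation of the fractional Brownian motion driven by `W`. -/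
def IsMandelbrotVanNess (H : ℝ) (W B : ℝ → Ω → E d) (P : Measure Ω) : Prop :=
  ∀ᵐ ω ∂P, ∀ t, ∃ I,
    HasImproperRS (fun r => (max (t - r) 0) ^ (H - 1 / 2) - (max (-r) 0) ^ (H - 1 / 2))
      (fun r => W r ω) (max t 0) I ∧ B t ω = alphaH H • I

/-- `X` solves `dX = b(X) dt + σ(X) dB` on `[0, ∞)` (pathwise Young integral). -/
def IsSolution (b : E d → E d) (σ : E d → E d →L[ℝ] E d) (B X : ℝ → Ω → E d) (P : Measure Ω) :
    Prop :=
  ∀ᵐ ω ∂P, ContinuousOn (fun t => X t ω) (Ici 0) ∧ ∀ t, 0 ≤ t → ∃ I,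
    HasRS (fun s => σ (X s ω)) (fun s => B s ω) 0 t I ∧
    X t ω = X 0 ω + (∫ s in (0 : ℝ)..t, b (X s ω)) + I

/-- The increments of `W` after the random time `s` (read as `0` where `s = ∞`). -/
def incr (W : ℝ → Ω → E d) (s : Ω → WithTop ℝ) (u : ℝ≥0) (ω : Ω) : E d :=
  W ((s ω).untopD 0 + u) ω - W ((s ω).untopD 0) ω

/-- `s` is a stopping time and, conditionally on `{s < ∞}`, the increments of `W` after `s` form a
Brownian motion independent of `𝓕_s`. -/
def IsFreshAfter (P : Measure Ω) (𝓕 : Filtration ℝ ‹MeasurableSpace Ω›) (W : ℝ → Ω → E d)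
    (s : Ω → WithTop ℝ) : Prop :=
  ∃ hs : IsStoppingTime 𝓕 s, P {ω | s ω ≠ ⊤} ≠ 0 →
    IsBrownian (incr W s) (P[|{ω | s ω ≠ ⊤}]) ∧
    Indep hs.measurableSpace
      (MeasurableSpace.comap (fun ω (u : ℝ≥0) => incr W s u ω) MeasurableSpace.pi)
      (P[|{ω | s ω ≠ ⊤}])

/-! ### One attempt of the second step -/

/-- `ν` is the law of a pair `(U₁, U₂)` of standard Gaussian variables such that
`r₁ ≤ ℙ(U₂ = U₁ + a) ≤ r₂`, `|U₂ - U₁| ≤ M` a.s., and `|U₁|, |U₂| ≤ M/2 + bd` a.s. on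
`{U₂ = U₁ + a}`. -/
structure IsGaussianPair (ν : Measure (ℝ × ℝ)) (a bd r₁ r₂ M : ℝ) : Prop where
  law_fst : ν.map Prod.fst = gaussianReal 0 1
  law_snd : ν.map Prod.snd = gaussianReal 0 1
  lower : ENNReal.ofReal r₁ ≤ ν {p | p.2 = p.1 + a}
  upper : ν {p | p.2 = p.1 + a} ≤ ENNReal.ofReal r₂
  bounded : ∀ᵐ p ∂ν, |p.2 - p.1| ≤ M
  bounded_success : ∀ᵐ p ∂ν, p.2 = p.1 + a → |p.1| ≤ M / 2 + bd ∧ |p.2| ≤ M / 2 + bd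

/-- The coupling used to try to realise `W² = W¹ + ∫ γ` on an interval of length `L` starting at
the stopping time `s`, where `γ ω t` is the target drift at the time `t` after `s`.  With
`a = ‖γ‖_{L²([0,L])}` and `e` the unit vector `γ / a` of `L²([0,L])` (any unit vector if `a = 0`),
`W^i_{s+t} - W^i_s = U_i ∫_0^t e + R_t`, where, conditionally on `𝓕_s`, the pair `(U₁, U₂)` is
independent of `R` and is a Gaussian pair for the shift `a`. -/
def IsStickingCoupling (P : Measure Ω) (𝓕 : Filtration ℝ ‹MeasurableSpace Ω›)
    (W : Fin 2 → ℝ → Ω → E d) (s : Ω → WithTop ℝ) (L : ℝ) (γ : Ω → ℝ → E d)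
    (bd r₁ r₂ M : ℝ) : Prop :=
  ∃ hs : IsStoppingTime 𝓕 s, P {ω | s ω ≠ ⊤} ≠ 0 →
    ∃ (a : Ω → ℝ) (e : Ω → ℝ → E d) (U : Ω → ℝ × ℝ) (R : Ω → ℝ≥0 → E d)
      (ν : @Kernel Ω (ℝ × ℝ) hs.measurableSpace inferInstance)
      (κ : @Kernel Ω (ℝ≥0 → E d) hs.measurableSpace inferInstance),
      Measurable[hs.measurableSpace] a ∧
      (∀ t, Measurable[hs.measurableSpace] fun ω => ∫ u in (0 : ℝ)..t, e ω u) ∧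
      IsMarkovKernel ν ∧ IsMarkovKernel κ ∧
      (∀ᵐ ω ∂P[|{ω | s ω ≠ ⊤}],
        0 ≤ a ω ∧
        ENNReal.ofReal (a ω ^ 2) = ∫⁻ t in Icc 0 L, ‖γ ω t‖ₑ ^ 2 ∧
        MemLp (e ω) 2 (volume.restrict (Icc 0 L)) ∧
        ∫⁻ t in Icc 0 L, ‖e ω t‖ₑ ^ 2 = 1 ∧
        (∀ᵐ t ∂volume.restrict (Icc 0 L), γ ω t = a ω • e ω t) ∧
        IsGaussianPair (ν ω) (a ω) bd r₁ r₂ M ∧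
        ∀ t : ℝ≥0, (t : ℝ) ≤ L →
          incr (W 0) s t ω = (U ω).1 • (∫ u in (0 : ℝ)..t, e ω u) + R ω t ∧
          incr (W 1) s t ω = (U ω).2 • (∫ u in (0 : ℝ)..t, e ω u) + R ω t) ∧
      HasCondDistrib (m𝓧 := hs.measurableSpace) (fun ω => (U ω, R ω)) (fun ω => ω)
        (ν ×ₖ κ) (P[|{ω | s ω ≠ ⊤}])

/-! ### The coupling scheme -/

/-- The numerical parameters of the scheme (which may depend on `K`, except `α, β, a`):
`c₂, c₃`, the bound `CK` on the sticking cost, and the constants `r₁, r₂, M` of the first attempt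
of Step 2. -/
structure Params where
  (α β : ℝ)
  a : ℕ → ℝ
  (c₂ c₃ CK r₁ r₂ M : ℝ)

/-- The random objects of a coupling.  The indices `0, 1 : Fin 2` stand for the two copies;
`g` is the drift with `dW² = dW¹ + g dt`; `ell k` (`k ≥ 1`) is the failure index of trial `k`:
`0` if Step 1 fails, `ℓ` if the `ℓ`-th attempt of Step 2 is the first to fail, `∞` if trial `k` is
successful. -/
structure Coupling (d : ℕ) (Ω : Type*) [MeasurableSpace Ω] where
  𝓕 : Filtration ℝ ‹MeasurableSpace Ω›
  W : Fin 2 → ℝ → Ω → E d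
  B : Fin 2 → ℝ → Ω → E d
  X : Fin 2 → ℝ → Ω → E d
  g : Ω → ℝ → E d
  τ₀ : Ω → ℕ
  ell : ℕ → Ω → ℕ∞

/-- `τ₀(x₁, x₂) = inf {u ∈ ℕ, u ≥ 1, ρ₀^u (Ψ(x₁) + Ψ(x₂)) ≤ 1}`. -/
def tauZero (Ψ : E d → ℝ) (ρ₀ : ℝ) (x₁ x₂ : E d) : ℕ :=
  sInf {u : ℕ | 1 ≤ u ∧ ρ₀ ^ u * (Ψ x₁ + Ψ x₂) ≤ 1}

namespace Params

variable (p : Params)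

/-- The time from the end of Step 1 to the beginning of the attempt `ℓ` of Step 2; the attempt `u`
lasts `c₂ 2^u`. -/
def offset (ℓ : ℕ) : ℝ := ∑ u ∈ Finset.Ico 1 ℓ, p.c₂ * 2 ^ u

/-- The duration `Δ₃(ℓ, k) = c₃ a_k 2^{βℓ}` of Step 3. -/
def step3 (ℓ k : ℕ) : ℝ := p.c₃ * p.a k * 2 ^ (p.β * (ℓ : ℝ))

/-- The bounds on the norm of the sticking drift on the successive attempts of Step 2. -/
def bd (ℓ : ℕ) : ℝ :=
  if ℓ = 1 then √p.CK else p.c₂ ^ (-p.α) * √p.CK * 2 ^ (-(p.α * (ℓ : ℝ)))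

/-- Lower bound on the success probability of the attempt `ℓ`. -/
def lowerProb (ℓ : ℕ) : ℝ := if ℓ = 1 then p.r₁ else 1 - p.bd ℓ

/-- Upper bound on the success probability of the attempt `ℓ`. -/
def upperProb (ℓ : ℕ) : ℝ := if ℓ = 1 then p.r₂ else 1 - p.bd ℓ / 2

/-- Bound on `|U₂ - U₁|` in the attempt `ℓ`. -/
def gap (ℓ : ℕ) : ℝ :=
  if ℓ = 1 then p.M else max (4 * p.bd ℓ) (-2 * Real.log (p.bd ℓ / 8))

/-- The standing constraints on the parameters. -/
structure Valid : Prop where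
  alpha_pos : 0 < p.α
  alpha_lt : p.α < 1 / 2
  one_le_beta : 1 ≤ p.β
  one_le_CK : 1 ≤ p.CK
  c₂_eq : p.c₂ = p.CK ^ (1 / (2 * p.α))
  c₃_ge : 2 * p.c₂ ≤ p.c₃
  r₁_mem : p.r₁ ∈ Ioo (0 : ℝ) 1
  r₂_mem : p.r₂ ∈ Ioo (0 : ℝ) 1
  M_pos : 0 < p.M

end Params

namespace Coupling

variable (C : Coupling d Ω) (p : Params)

/-- The (real-valued) end of trial `n`, meaningful on `{τ_n < ∞}`: a trial failing with index `ℓ`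
consists of Step 1 (length `1`), the attempts `1, …, ℓ` of Step 2 and Step 3. -/
def time : ℕ → Ω → ℝ
  | 0, ω => C.τ₀ ω
  | n + 1, ω => time n ω + 1 + p.offset ((C.ell (n + 1) ω).toNat + 1)
      + p.step3 (C.ell (n + 1) ω).toNat (n + 1)

/-- The event `{τ_n < ∞}`: the trials `1, …, n` have failed. -/
def fail (n : ℕ) : Set Ω := {ω | ∀ i, 1 ≤ i → i ≤ n → C.ell i ω ≠ ⊤}

open Classical in
/-- The stopping time `τ_n`. -/
def tau (n : ℕ) (ω : Ω) : WithTop ℝ :=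
  if ω ∈ C.fail n then ((C.time p n ω : ℝ) : WithTop ℝ) else ⊤

open Classical in
/-- The beginning `s_{n+1,ℓ}` of the attempt `ℓ ≥ 1` of Step 2 of trial `n + 1`, and `∞` if this
attempt does not take place. -/
def attemptTime (n ℓ : ℕ) (ω : Ω) : WithTop ℝ :=
  if ω ∈ C.fail n ∧ (ℓ : ℕ∞) ≤ C.ell (n + 1) ω then
    ((C.time p n ω + 1 + p.offset ℓ : ℝ) : WithTop ℝ) else ⊤

/-- The real-valued beginning of Step 3 of trial `n + 1`. -/
def step3Start (n : ℕ) (ω : Ω) : ℝ :=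
  C.time p n ω + 1 + p.offset ((C.ell (n + 1) ω).toNat + 1)

open Classical in
/-- The beginning of Step 3 of trial `n + 1`, and `∞` if this step does not take place. -/
def step3Time (n : ℕ) (ω : Ω) : WithTop ℝ :=
  if ω ∈ C.fail (n + 1) then ((C.step3Start p n ω : ℝ) : WithTop ℝ) else ⊤

/-- `(K, α)`-admissibility of the configuration `ω` at time `τ`, relative to `θ₀`. -/
structure Admissible (H θ₀ K α τ : ℝ) (ω : Ω) : Prop where
  drift : ∀ T : ℝ, 0 ≤ T →
    ∫⁻ t in Ioi (0 : ℝ), ENNReal.ofReal ((1 + t) ^ (2 * α)) *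
      ‖memoryOp H T (shiftPath (C.g ω) τ) t‖ₑ ^ 2 ≤ 1
  position : ∀ j, ‖C.X j τ ω‖ ≤ K
  past : ∀ j, pastSize H ((H - θ₀) / 2) τ (fun t => C.W j t ω) ≤ ENNReal.ofReal K

/-- The drift (as a function of the time elapsed after the end of Step 1 of trial `n + 1`) that
keeps the two copies together. -/
def sticking (H : ℝ) (n : ℕ) (ω : Ω) (t : ℝ) : E d :=
  stickDrift H (C.g ω) (C.time p n ω + 1) t

/-- `C` is a coupling of two solutions of `dX = b(X) dt + σ(X) dB`, started from positions with
laws `μ 0` and `μ 1` and the same noise up to `τ₀`, obtained by successive trials made of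
Steps 1, 2 and 3 with admissibility constant `K`. -/
structure IsScheme (P : Measure Ω) (H θ₀ K : ℝ) (b : E d → E d) (σ : E d → E d →L[ℝ] E d)
    (Ψ : E d → ℝ) (ρ₀ : ℝ) (μ : Fin 2 → Measure (E d)) : Prop where
  valid : p.Valid
  -- The two driving noises and the two solutions.
  adapted_W : ∀ j t, Measurable[C.𝓕 t] (C.W j t)
  adapted_X : ∀ j t, 0 ≤ t → Measurable[C.𝓕 t] (C.X j t)
  brownian : ∀ j, IsTwoSidedBrownian (C.W j) P
  fractional : ∀ j, IsMandelbrotVanNess H (C.W j) (C.B j) P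
  solution : ∀ j, IsSolution b σ (C.B j) (C.X j) P
  initial : ∀ j, P.map (C.X j 0) = μ j
  -- `W² - W¹ = ∫ g`, and the noises agree before `τ₀`.
  drift : ∀ᵐ ω ∂P, LocallyIntegrable (C.g ω) ∧
    (∀ t, C.W 1 t ω - C.W 0 t ω = ∫ s in (0 : ℝ)..t, C.g ω s) ∧
    ∀ t, t < C.τ₀ ω → C.g ω t = 0
  tau_zero : ∀ᵐ ω ∂P, C.τ₀ ω = tauZero Ψ ρ₀ (C.X 0 0 ω) (C.X 1 0 ω)
  -- At time `0` and at the beginning of each step or attempt, each of the two noises is, given the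
  -- past, a Brownian motion.
  fresh_zero : ∀ j, IsFreshAfter P C.𝓕 (C.W j) (fun _ => ((0 : ℝ) : WithTop ℝ))
  fresh_tau : ∀ j n, IsFreshAfter P C.𝓕 (C.W j) (C.tau p n)
  fresh_attempt : ∀ j n ℓ, 1 ≤ ℓ → IsFreshAfter P C.𝓕 (C.W j) (C.attemptTime p n ℓ)
  fresh_step3 : ∀ j n, IsFreshAfter P C.𝓕 (C.W j) (C.step3Time p n)
  -- Step 1 of trial `n + 1`, on `[τ_n, τ_n + 1]`.  If the system is not admissible, the same noise
  -- is used and the step fails.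
  step1_not_admissible : ∀ n, ∀ᵐ ω ∂P, ω ∈ C.fail n →
    ¬ C.Admissible H θ₀ K p.α (C.time p n ω) ω →
      C.ell (n + 1) ω = 0 ∧
      ∀ t ∈ Ioo (C.time p n ω) (C.time p n ω + 1), C.g ω t = 0
  -- If it is successful, the positions agree at the end, at a controlled cost: `CK` bounds the
  -- weighted norm of the sticking drift, and `bd ℓ` its norm on the successive attempts of Step 2.
  step1_success : ∀ n, ∀ᵐ ω ∂P, ω ∈ C.fail n → C.ell (n + 1) ω ≠ 0 →
    C.X 0 (C.time p n ω + 1) ω = C.X 1 (C.time p n ω + 1) ω ∧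
    ∫⁻ t in Ioi (0 : ℝ), ENNReal.ofReal ((1 + t) ^ (2 * p.α)) * ‖C.sticking p H n ω t‖ₑ ^ 2
      ≤ ENNReal.ofReal p.CK ∧
    ∀ ℓ, 1 ≤ ℓ → ∫⁻ t in Icc (p.offset ℓ) (p.offset (ℓ + 1)), ‖C.sticking p H n ω t‖ₑ ^ 2
      ≤ ENNReal.ofReal (p.bd ℓ ^ 2)
  -- Step 2 of trial `n + 1`: the attempt `ℓ` tries to realise `g = sticking drift` during a time
  -- `c₂ 2^ℓ`.
  step2_coupling : ∀ n ℓ, 1 ≤ ℓ →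
    IsStickingCoupling P C.𝓕 C.W (C.attemptTime p n ℓ) (p.c₂ * 2 ^ ℓ)
      (fun ω t => C.sticking p H n ω (p.offset ℓ + t))
      (p.bd ℓ) (p.lowerProb ℓ) (p.upperProb ℓ) (p.gap ℓ)
  step2_success : ∀ n (ℓ : ℕ), 1 ≤ ℓ → ∀ᵐ ω ∂P, ω ∈ C.fail n → (ℓ : ℕ∞) ≤ C.ell (n + 1) ω →
    ((ℓ : ℕ∞) < C.ell (n + 1) ω ↔
      ∀ t : ℝ≥0, (t : ℝ) ≤ p.c₂ * 2 ^ ℓ →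
        incr (C.W 1) (C.attemptTime p n ℓ) t ω - incr (C.W 0) (C.attemptTime p n ℓ) t ω =
          ∫ u in (0 : ℝ)..t, C.sticking p H n ω (p.offset ℓ + u))
  -- Step 3 of trial `n + 1`: the same noise is used.
  step3_drift : ∀ n, ∀ᵐ ω ∂P, ω ∈ C.fail (n + 1) →
    ∀ t ∈ Ioo (C.step3Start p n ω) (C.time p (n + 1) ω), C.g ω t = 0

/-- The discounted sum `∑_{u=1}^{Δτ} ρ^{Δτ-u} ‖B^j‖_θ^{τ_n+u-1, τ_n+u}` over trial `n + 1`, where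
`Δτ = τ_{n+1} - τ_n` is the duration of the trial. -/
def discountedNorm (ρ θ : ℝ) (j : Fin 2) (n : ℕ) (ω : Ω) : ℝ≥0∞ :=
  ∑ u ∈ Finset.Icc 1 ⌊C.time p (n + 1) ω - C.time p n ω⌋₊,
    ENNReal.ofReal (ρ ^ (C.time p (n + 1) ω - C.time p n ω - u)) *
      holder θ (fun t => C.B j t ω) (C.time p n ω + u - 1) (C.time p n ω + u)

end Coupling

end Processes

end FracCoupling

end

/-!
The discounted sum is controlled by the growth of the noise `W` seen from the unit intervals
`[τ_n + u - 1, τ_n + u]`, so the question is how the noise behaves in the far past of `τ_n` under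
the law conditioned on `n + 1` failures, an event whose probability may decay like `δ₁ ^ (n + 1)`.
Freshness of the noise gives a bound in `L^q` for its growth over trial `i` under the law
conditioned on the first `i` failures; each later failure on which one conditions costs a factor
`δ₁⁻¹ ^ (1 / q)`.  On the other hand, trial `i < n` lies at a distance at least `ς ^ n` from `τ_n`,
and increments at distance `r` are measured against `r ^ (1 / 2 + 2 e)` although they grow only like
`r ^ (1 / 2 + e)`.  This gains a factor `ς ^ (-e n)`.  For `q` large the gain wins
(`exists_moment`), and all bounds are uniform in `n` and in the admissibility constant `K`: only the
durations of the trials depend on `K`, and their size does not matter once they exceed `ς ^ n`.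

* Pathwise, a summation by parts in the Mandelbrot-Van Ness integral bounds the Hölder norm of `B`
  on an interval by the growth of `W` seen from it, with exponents `γ < 1 / 2` at short and
  `lam > 1 / 2` at long distances (`holder_le_of_modulus`).
* A dyadic chaining functional, the window energy, bounds that growth by a random variable with
  moments (`enorm_sub_le_of_windowEnergy`, `IsBrownian.lintegral_windowEnergy_le`).
* The growth over one trial combines a forward energy at the beginning of the trial with a backward
  energy from the end of Step 3, whose duration is known at its beginning.  Step 3 lasts longer than
  Steps 1 and 2, so that the oscillation during these is absorbed
  (`enorm_sub_le_of_forward_backward`), and only stopping times at which the noise is fresh occur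
  (`lintegral_mixedEnergy_le`).  The trials are then added up with the discount `ς ^ (-e n)`
  (`enorm_sub_le_discounted_sum`, `momentNorm_discounted_sum_le`).
* The number of terms of the discounted sum is random and depends on the noise.  Given the failure
  index `ℓ` it is deterministic, the weights `ρ ^ (Δτ - u)` are summable, and `ℓ` has geometric
  tails because attempt `ℓ ≥ 2` fails with probability at most `2 ^ (-α ℓ)`
  (`Coupling.IsScheme.cond_failAt_le`).  Hölder's inequality on each event `{ell = ℓ}` concludes
  (`Coupling.IsScheme.lintegral_discountedNorm_le`).
-/

noncomputable section

namespace FracCoupling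

/-! ### Fractional integrals of paths of controlled growth -/

/-- The modulus `x ↦ x ^ γ + x ^ lam`.  With `γ < 1/2 < lam` it dominates, up to a random
factor, the increments of a Brownian path at short (`x ^ γ`) and at long (`x ^ lam`) distances. -/
def modulus (γ lam x : ℝ) : ℝ := x ^ γ + x ^ lam

lemma modulus_nonneg {γ lam x : ℝ} (hx : 0 ≤ x) : 0 ≤ modulus γ lam x := by
  unfold modulus; positivity

lemma modulus_mono {γ lam x y : ℝ} (hγ : 0 ≤ γ) (hlam : 0 ≤ lam) (hx : 0 ≤ x) (hxy : x ≤ y) :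
    modulus γ lam x ≤ modulus γ lam y := by
  unfold modulus; gcongr

lemma modulus_le_of_le_one {γ lam x : ℝ} (h : γ ≤ lam) (hx : 0 < x) (hx1 : x ≤ 1) :
    modulus γ lam x ≤ 2 * x ^ γ := by
  have := Real.rpow_le_rpow_of_exponent_ge hx hx1 h
  unfold modulus; linarith

lemma modulus_le_of_one_le {γ lam x : ℝ} (h : γ ≤ lam) (hx1 : 1 ≤ x) :
    modulus γ lam x ≤ 2 * x ^ lam := by
  have := Real.rpow_le_rpow_of_exponent_le hx1 h
  unfold modulus; linarith

lemma rpow_sub_rpow_le {h x v : ℝ} (h0 : 0 ≤ h) (hx : 0 < x) (hv : 0 < v) :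
    x ^ (h - 1) - (x + v) ^ (h - 1) ≤ x ^ (h - 1) * (v / x) := by
  have h1 : (x + v) ^ (h - 1) = x ^ (h - 1) * (1 + v / x) ^ (h - 1) := by
    rw [← Real.mul_rpow hx.le (by positivity)]
    congr 1; field_simp
  have hz : 0 < v / x := by positivity
  have h2 : 1 - v / x ≤ (1 + v / x) ^ (h - 1) := by
    calc 1 - v / x ≤ (1 + v / x) ^ (-1 : ℝ) := by
          rw [Real.rpow_neg_one, ← one_div, le_div_iff₀ (by positivity)]
          nlinarith
      _ ≤ _ := Real.rpow_le_rpow_of_exponent_le (by linarith) (by linarith)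
  have h3 : 0 < x ^ (h - 1) := by positivity
  rw [h1]; nlinarith

lemma kernel_anti {h v X Y : ℝ} (h0 : 0 ≤ h) (h1 : h ≤ 1) (hv : 0 < v) (hX : 0 ≤ X)
    (hXY : X ≤ Y) : (Y + v) ^ h - Y ^ h ≤ (X + v) ^ h - X ^ h := by
  have hc := Real.concaveOn_rpow h0 h1
  set a := v / (Y + v - X) with ha
  have hpos : 0 < Y + v - X := by linarith
  have ha0 : 0 ≤ a := by positivity
  have ha1 : a ≤ 1 := by rw [ha, div_le_one hpos]; linarith
  have hav : a * (Y + v - X) = v := div_mul_cancel₀ _ hpos.ne'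
  have c1 := hc.2 (mem_Ici.2 hX) (mem_Ici.2 (by linarith : 0 ≤ Y + v)) (sub_nonneg.2 ha1) ha0
    (by ring)
  have c2 := hc.2 (mem_Ici.2 hX) (mem_Ici.2 (by linarith : 0 ≤ Y + v)) ha0 (sub_nonneg.2 ha1)
    (by ring)
  simp only [smul_eq_mul] at c1 c2
  rw [show (1 - a) * X + a * (Y + v) = X + v by linear_combination hav] at c1
  rw [show a * X + (1 - a) * (Y + v) = Y by linear_combination -hav] at c2
  linarith

/-- The kernel increment `(x + v) ^ h - x ^ h`, weighted by the modulus, varies no more than a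
multiple of the bounded function `arctan (x ^ e)`.  The weight `v ^ θ` comes from
`x ^ (h - 1) - (x + v) ^ (h - 1) ≤ x ^ (h - 1) * min 1 (v / x)`. -/
lemma modulus_mul_kernel_sub_le {h γ lam θ e v : ℝ} (h0 : 0 < h) (h1 : h < 1) (hγ : 0 < γ)
    (hγlam : γ ≤ lam) (he : 0 < e) (heγ : e ≤ γ + h - θ) (helam : e ≤ 1 - lam - h)
    (hθ0 : 0 ≤ θ) (hθ1 : θ ≤ 1) (hv : 0 < v) (hv1 : v ≤ 1) {X Y : ℝ} (hX : 0 ≤ X) (hXY : X ≤ Y) :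
    modulus γ lam X * (((X + v) ^ h - X ^ h) - ((Y + v) ^ h - Y ^ h)) ≤
      4 / e * v ^ θ * (Real.arctan (Y ^ e) - Real.arctan (X ^ e)) := by
  set k : ℝ → ℝ := fun x => (x + v) ^ h - x ^ h with hk
  set G : ℝ → ℝ := fun x => 4 / e * v ^ θ * Real.arctan (x ^ e) + modulus γ lam X * k x with hG
  have hcont : ContinuousOn G (Ici X) := by
    apply Continuous.continuousOn
    have hx1 : Continuous fun x : ℝ => x ^ e := Real.continuous_rpow_const he.le
    have hx2 : Continuous fun x : ℝ => x ^ h := Real.continuous_rpow_const h0.le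
    have hx3 : Continuous fun x : ℝ => (x + v) ^ h := hx2.comp (by fun_prop)
    have := Real.continuous_arctan.comp hx1
    simp only [hG, hk]
    fun_prop
  have hmono : MonotoneOn G (Ici X) := by
    have hd : ∀ x, X < x → HasDerivAt G (4 / e * v ^ θ * (1 / (1 + (x ^ e) ^ 2) *
        (e * x ^ (e - 1))) + modulus γ lam X * (h * (x + v) ^ (h - 1) - h * x ^ (h - 1))) x := by
      intro x hx
      have hx0 : 0 < x := hX.trans_lt hx
      have d1 : HasDerivAt (fun x : ℝ => x ^ e) (e * x ^ (e - 1)) x :=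
        Real.hasDerivAt_rpow_const (Or.inl hx0.ne')
      have d2 : HasDerivAt (fun x : ℝ => x ^ h) (h * x ^ (h - 1)) x :=
        Real.hasDerivAt_rpow_const (Or.inl hx0.ne')
      have d3 : HasDerivAt (fun x : ℝ => (x + v) ^ h) (h * (x + v) ^ (h - 1)) x := by
        have := (Real.hasDerivAt_rpow_const (x := x + v) (p := h)
          (Or.inl (by linarith))).comp_add_const x v
        simpa using this
      exact (d1.arctan.const_mul _).add ((d3.sub d2).const_mul _)
    apply monotoneOn_of_deriv_nonneg (convex_Ici X) hcont
    · intro x hx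
      rw [interior_Ici] at hx
      exact (hd x hx).differentiableAt.differentiableWithinAt
    · intro x hx
      rw [interior_Ici] at hx
      rw [(hd x hx).deriv]
      have hx0 : 0 < x := hX.trans_lt hx
      have hphi := modulus_mono hγ.le (hγ.le.trans hγlam) hX (le_of_lt hx) (γ := γ) (lam := lam)
      have hphi0 : 0 ≤ modulus γ lam X := modulus_nonneg hX
      set D := x ^ (h - 1) - (x + v) ^ (h - 1) with hD
      have hD0 : 0 ≤ D := sub_nonneg.2
        (Real.rpow_le_rpow_of_nonpos hx0 (by linarith) (by linarith))
      have hDle : D ≤ x ^ (h - 1) * (v / x) := rpow_sub_rpow_le h0.le hx0 hv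
      have hDle' : D ≤ x ^ (h - 1) := by
        have : 0 ≤ (x + v) ^ (h - 1) := by positivity
        linarith
      have hvθ : v ≤ v ^ θ := by
        simpa using Real.rpow_le_rpow_of_exponent_ge hv hv1 hθ1
      have hvθ0 : 0 < v ^ θ := by positivity
      have hxe : 0 < x ^ e := by positivity
      have hxe1 : 0 < x ^ (e - 1) := by positivity
      have key : modulus γ lam x * D ≤ 4 * v ^ θ * (1 / (1 + (x ^ e) ^ 2) * x ^ (e - 1)) := by
        rcases le_total x 1 with hx1 | hx1
        · have a1 : D ≤ x ^ (h - 1) * (v / x) ^ θ := by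
            rcases le_total (v / x) 1 with hz | hz
            · refine hDle.trans ?_
              gcongr
              simpa using Real.rpow_le_rpow_of_exponent_ge (by positivity) hz hθ1
            · refine hDle'.trans ?_
              exact le_mul_of_one_le_right (by positivity) (Real.one_le_rpow hz hθ0)
          have a2 : modulus γ lam x * D ≤ (2 * x ^ γ) * (x ^ (h - 1) * (v / x) ^ θ) := by
            gcongr
            exact modulus_le_of_le_one hγlam hx0 hx1
          have a3 : (2 * x ^ γ) * (x ^ (h - 1) * (v / x) ^ θ) =
              2 * v ^ θ * x ^ (γ + h - θ - 1) := by
            rw [Real.div_rpow hv.le hx0.le, show γ + h - θ - 1 = γ + (h - 1) - θ by ring,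
              Real.rpow_sub hx0 _ θ, Real.rpow_add hx0]
            ring
          have a4 : x ^ (γ + h - θ - 1) ≤ x ^ (e - 1) :=
            Real.rpow_le_rpow_of_exponent_ge hx0 hx1 (by linarith)
          have a5 : (1 / 2 : ℝ) ≤ 1 / (1 + (x ^ e) ^ 2) := by
            have : x ^ e ≤ 1 := Real.rpow_le_one hx0.le hx1 he.le
            apply one_div_le_one_div_of_le (by positivity)
            nlinarith
          calc _ ≤ _ := a2
            _ = _ := a3
            _ ≤ 2 * v ^ θ * x ^ (e - 1) := by gcongr
            _ = 4 * v ^ θ * (1 / 2 * x ^ (e - 1)) := by ring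
            _ ≤ _ := by gcongr
        · have a2 : modulus γ lam x * D ≤ (2 * x ^ lam) * (x ^ (h - 1) * (v ^ θ / x)) := by
            gcongr
            · exact modulus_le_of_one_le hγlam hx1
            · exact hDle.trans (by gcongr)
          have a3 : (2 * x ^ lam) * (x ^ (h - 1) * (v ^ θ / x)) =
              2 * v ^ θ * x ^ (lam + h - 2) := by
            rw [show lam + h - 2 = lam + (h - 1) - 1 by ring,
              Real.rpow_sub_one hx0.ne' (lam + (h - 1)), Real.rpow_add hx0]
            ring
          have a4 : x ^ (lam + h - 2) ≤ x ^ (-e - 1) :=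
            Real.rpow_le_rpow_of_exponent_le hx1 (by linarith)
          have a5 : x ^ (-e - 1) ≤ 2 * (1 / (1 + (x ^ e) ^ 2) * x ^ (e - 1)) := by
            have : 1 ≤ x ^ e := Real.one_le_rpow hx1 he.le
            have e1 : x ^ (-e - 1) = (x ^ e)⁻¹ ^ 2 * x ^ (e - 1) := by
              rw [Real.rpow_sub_one hx0.ne', Real.rpow_sub_one hx0.ne', Real.rpow_neg hx0.le]
              field_simp
            rw [e1, ← mul_assoc]
            gcongr
            rw [inv_pow, ← one_div, mul_one_div, div_le_div_iff₀ (by positivity) (by positivity)]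
            nlinarith
          calc _ ≤ _ := a2
            _ = _ := a3
            _ ≤ 2 * v ^ θ * (2 * (1 / (1 + (x ^ e) ^ 2) * x ^ (e - 1))) := by
              gcongr; exact a4.trans a5
            _ = _ := by ring
      have e1 : 4 / e * v ^ θ * (1 / (1 + (x ^ e) ^ 2) * (e * x ^ (e - 1))) =
          4 * v ^ θ * (1 / (1 + (x ^ e) ^ 2) * x ^ (e - 1)) := by
        field_simp
      rw [e1]
      have : modulus γ lam X * (h * D) ≤ modulus γ lam x * D := by
        apply mul_le_mul hphi _ (by positivity) (modulus_nonneg hx0.le)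
        nlinarith
      have e2 : modulus γ lam X * (h * (x + v) ^ (h - 1) - h * x ^ (h - 1)) =
        - (modulus γ lam X * (h * D)) := by rw [hD]; ring
      rw [e2]; linarith
  have := hmono (mem_Ici.2 le_rfl) (mem_Ici.2 hXY) hXY
  simp only [hG, hk] at this
  linarith

lemma exists_partition {A s t δ : ℝ} (hAs : A ≤ s) (hst : s ≤ t) (hδ : 0 < δ) :
    ∃ (M : ℕ) (x : ℕ → ℝ), Monotone x ∧ x 0 = A ∧ x M = s ∧ x (M + M) = t ∧
      ∀ i, x (i + 1) - x i < δ := by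
  obtain ⟨M, hM⟩ := exists_nat_gt (max 1 (((s - A) + (t - s)) / δ))
  have hM1 : (1 : ℝ) < M := (le_max_left _ _).trans_lt hM
  have hM2 : ((s - A) + (t - s)) / δ < M := (le_max_right _ _).trans_lt hM
  have hM0 : (0 : ℝ) < M := by linarith
  rw [div_lt_iff₀ hδ] at hM2
  have a1 : ∀ i : ℕ, ((min (i + 1) M : ℕ) : ℝ) - (min i M : ℕ) ∈ Icc (0 : ℝ) 1 := by
    intro i
    have h1 : min i M ≤ min (i + 1) M := by omega
    have h2 : min (i + 1) M ≤ min i M + 1 := by omega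
    have h1' : ((min i M : ℕ) : ℝ) ≤ ((min (i + 1) M : ℕ) : ℝ) := by exact_mod_cast h1
    have h2' : ((min (i + 1) M : ℕ) : ℝ) ≤ ((min i M : ℕ) : ℝ) + 1 := by exact_mod_cast h2
    constructor <;> linarith
  have a2 : ∀ i : ℕ, ((i + 1 - M : ℕ) : ℝ) - (i - M : ℕ) ∈ Icc (0 : ℝ) 1 := by
    intro i
    have h1 : i - M ≤ i + 1 - M := by omega
    have h2 : i + 1 - M ≤ (i - M) + 1 := by omega
    have h1' : ((i - M : ℕ) : ℝ) ≤ ((i + 1 - M : ℕ) : ℝ) := by exact_mod_cast h1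
    have h2' : ((i + 1 - M : ℕ) : ℝ) ≤ ((i - M : ℕ) : ℝ) + 1 := by exact_mod_cast h2
    constructor <;> linarith
  have step : ∀ i : ℕ, (A + (s - A) * (min (i + 1) M : ℕ) / M + (t - s) * (i + 1 - M : ℕ) / M) -
      (A + (s - A) * (min i M : ℕ) / M + (t - s) * (i - M : ℕ) / M) =
      ((s - A) * (((min (i + 1) M : ℕ) : ℝ) - (min i M : ℕ)) +
        (t - s) * (((i + 1 - M : ℕ) : ℝ) - (i - M : ℕ))) / M := by
    intro i; ring
  refine ⟨M, fun i => A + (s - A) * (min i M : ℕ) / M + (t - s) * (i - M : ℕ) / M,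
    monotone_nat_of_le_succ ?_, by simp, ?_, ?_, ?_⟩
  · intro i
    rw [← sub_nonneg, step]
    have := (a1 i).1; have := (a2 i).1
    have : 0 ≤ s - A := by linarith
    have : 0 ≤ t - s := by linarith
    positivity
  · simp only [min_self, Nat.sub_self]
    field_simp; push_cast; ring
  · have : M + M - M = M := by omega
    simp only [this, show min (M + M) M = M by omega]
    field_simp; ring
  · intro i
    rw [step, div_lt_iff₀ hM0]
    have b1 := (a1 i).2; have b2 := (a2 i).2
    have : 0 ≤ s - A := by linarith
    have : 0 ≤ t - s := by linarith
    nlinarith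

section Fractional

variable {V : Type*} [NormedAddCommGroup V] [NormedSpace ℝ V]

lemma sum_smul_sub_eq (K : ℕ → ℝ) (u : ℕ → V) (n : ℕ) :
    ∑ i ∈ Finset.range n, K i • (u (i + 1) - u i) =
      K n • u n - K 0 • u 0 - ∑ i ∈ Finset.range n, (K (i + 1) - K i) • u (i + 1) := by
  induction n with
  | zero => simp
  | succ n ih =>
    rw [Finset.sum_range_succ, ih, Finset.sum_range_succ]
    module

/-- Pathwise bound on the increments of the Mandelbrot-Van Ness integral.  The Riemann-Stieltjes
sums over a partition through `s` are summed by parts, with the path recentred at `w s`; what is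
left is a sum of `modulus * (variation of the kernel)`, on which
`modulus_mul_kernel_sub_le` telescopes. -/
theorem norm_sub_le_of_hasImproperRS {h γ lam θ e : ℝ} (h0 : 0 < h) (h1 : h < 1) (hγ : 0 < γ)
    (hγlam : γ ≤ lam) (he : 0 < e) (heγ : e ≤ γ + h - θ) (helam : e ≤ 1 - lam - h)
    (hθ0 : 0 ≤ θ) (hθ1 : θ ≤ 1) {w : ℝ → V} {s t N : ℝ} (hs : 0 ≤ s) (hst : s < t)
    (hst1 : t - s ≤ 1) (hN : 0 ≤ N)
    (hleft : ∀ r ≤ s, ‖w r - w s‖ ≤ N * modulus γ lam (s - r))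
    (hright : ∀ r, s ≤ r → r ≤ t → ‖w r - w s‖ ≤ N * modulus γ lam (r - s)) {It Is : V}
    (ht : HasImproperRS (fun r => (max (t - r) 0) ^ h - (max (-r) 0) ^ h) w t It)
    (hs' : HasImproperRS (fun r => (max (s - r) 0) ^ h - (max (-r) 0) ^ h) w s Is) :
    ‖It - Is‖ ≤ (4 / e * (Real.pi / 2) + 2) * N * (t - s) ^ θ := by
  obtain ⟨Jt, hJt, hJtlim⟩ := ht
  obtain ⟨Js, hJs, hJslim⟩ := hs'
  set v := t - s with hv
  have hv0 : 0 < v := by linarith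
  have hlam0 : 0 < lam := hγ.trans_le hγlam
  -- The contribution of the lower end point `A` of the integrals; it vanishes as `A → -∞`.
  set bdry : ℝ → ℝ := fun A => N * (2 * (s - A) ^ lam) * (v * (s - A) ^ (h - 1)) with hbdry
  have hbdry_lim : Tendsto bdry atBot (𝓝 0) := by
    have l1 : Tendsto (fun A : ℝ => s - A) atBot atTop :=
      tendsto_atTop_add_const_left _ s tendsto_neg_atBot_atTop
    have l2 : Tendsto (fun x : ℝ => x ^ (-(1 - lam - h))) atTop (𝓝 0) :=
      tendsto_rpow_neg_atTop (by linarith)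
    have l3 := ((l2.comp l1).const_mul (N * 2 * v))
    rw [mul_zero] at l3
    refine l3.congr' ?_
    filter_upwards [eventually_lt_atBot s] with A hA
    have : 0 < s - A := by linarith
    simp only [hbdry, Function.comp, show -(1 - lam - h) = lam + (h - 1) by ring,
      Real.rpow_add this]
    ring
  have main : ∀ᶠ A in atBot, ‖Jt A - Js A‖ ≤
      bdry A + (4 / e * (Real.pi / 2) + 2) * N * v ^ θ := by
    filter_upwards [hJt, hJs, eventually_le_atBot (s - 1)] with A hAt hAs hA1
    refine le_of_forall_pos_le_add fun ε hε => ?_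
    obtain ⟨δ₁, hδ₁, h₁⟩ := hAt (ε / 2) (by positivity)
    obtain ⟨δ₂, hδ₂, h₂⟩ := hAs (ε / 2) (by positivity)
    obtain ⟨M, x, hx, hx0, hxM, hxMM, hmesh⟩ :=
      exists_partition (A := A) (s := s) (t := t) (by linarith) hst.le (lt_min hδ₁ hδ₂)
    have e₁ := h₁ (M + M) x x hx hx0 hxMM (fun i _ => (hmesh i).trans_le (min_le_left _ _))
      (fun i _ => ⟨le_rfl, hx (Nat.le_succ i)⟩)
    have e₂ := h₂ M x x hx hx0 hxM (fun i _ => (hmesh i).trans_le (min_le_right _ _))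
      (fun i _ => ⟨le_rfl, hx (Nat.le_succ i)⟩)
    set S₁ := ∑ i ∈ Finset.range (M + M), (((max (t - x i) 0) ^ h - (max (-x i) 0) ^ h) •
      ContinuousLinearMap.id ℝ V) (w (x (i + 1)) - w (x i)) with hS₁
    set S₂ := ∑ i ∈ Finset.range M, (((max (s - x i) 0) ^ h - (max (-x i) 0) ^ h) •
      ContinuousLinearMap.id ℝ V) (w (x (i + 1)) - w (x i)) with hS₂
    set u : ℕ → V := fun i => w (x i) - w s with hu
    have hle : ∀ i ≤ M, x i ≤ s := fun i hi => hxM ▸ hx hi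
    have hge : ∀ i, M ≤ i → s ≤ x i := fun i hi => hxM ▸ hx hi
    have huM : u M = 0 := by simp [hu, hxM]
    have hdiff : S₁ - S₂ =
        (∑ i ∈ Finset.range M, ((t - x i) ^ h - (s - x i) ^ h) • (u (i + 1) - u i)) +
        ∑ i ∈ Finset.range M, ((t - x (M + i)) ^ h) • (u (M + (i + 1)) - u (M + i)) := by
      rw [hS₁, Finset.sum_range_add, hS₂, add_sub_right_comm, ← Finset.sum_sub_distrib]
      congr 1
      · refine Finset.sum_congr rfl fun i hi => ?_
        have := hle i (Finset.mem_range.1 hi).le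
        rw [max_eq_left (by linarith : 0 ≤ t - x i), max_eq_left (by linarith : 0 ≤ s - x i)]
        simp only [hu, smul_apply, ContinuousLinearMap.id_apply]
        module
      · refine Finset.sum_congr rfl fun i hi => ?_
        have h1 := hge (M + i) (Nat.le_add_right _ _)
        have h2 : x (M + i) ≤ t := by
          rw [← hxMM]; exact hx (by have := Finset.mem_range.1 hi; omega)
        rw [max_eq_left (by linarith : 0 ≤ t - x (M + i)),
          max_eq_right (by linarith : -x (M + i) ≤ 0), Real.zero_rpow h0.ne']
        simp [hu, add_assoc]
    have b1 : ‖∑ i ∈ Finset.range M, ((t - x i) ^ h - (s - x i) ^ h) • (u (i + 1) - u i)‖ ≤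
        bdry A + 4 / e * (Real.pi / 2) * N * v ^ θ := by
      rw [sum_smul_sub_eq (fun i => (t - x i) ^ h - (s - x i) ^ h), huM, smul_zero, zero_sub]
      have c1 : ‖((t - x 0) ^ h - (s - x 0) ^ h) • u 0‖ ≤ bdry A := by
        have hsA : 0 < s - A := by linarith
        have hk : ‖(t - A) ^ h - (s - A) ^ h‖ ≤ v * (s - A) ^ (h - 1) := by
          have hmono : (s - A) ^ h ≤ (t - A) ^ h :=
            Real.rpow_le_rpow hsA.le (by linarith) h0.le
          rw [Real.norm_of_nonneg (by linarith)]
          have e1 : (t - A) ^ h = (s - A) ^ h * (1 + v / (s - A)) ^ h := by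
            rw [← Real.mul_rpow hsA.le (by positivity)]
            congr 1; field_simp; simp only [hv]; ring
          have e2 : (1 + v / (s - A)) ^ h ≤ 1 + v / (s - A) := by
            have hz : 0 ≤ v / (s - A) := by positivity
            simpa using Real.rpow_le_rpow_of_exponent_le (x := 1 + v / (s - A)) (by linarith) h1.le
          rw [e1, Real.rpow_sub_one hsA.ne']
          have : (s - A) ^ h * (1 + v / (s - A)) ^ h ≤ (s - A) ^ h * (1 + v / (s - A)) := by
            gcongr
          calc _ ≤ (s - A) ^ h * (1 + v / (s - A)) - (s - A) ^ h := by linarith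
            _ = _ := by ring
        rw [norm_smul, hx0, mul_comm]
        simp only [hbdry]
        refine mul_le_mul ?_ hk (norm_nonneg _) (by positivity)
        simp only [hu, hx0]
        refine (hleft A (by linarith)).trans ?_
        gcongr
        exact modulus_le_of_one_le hγlam (by linarith)
      have c2 : ‖∑ i ∈ Finset.range M, (((t - x (i + 1)) ^ h - (s - x (i + 1)) ^ h) -
          ((t - x i) ^ h - (s - x i) ^ h)) • u (i + 1)‖ ≤ 4 / e * (Real.pi / 2) * N * v ^ θ := by
        calc _ ≤ ∑ i ∈ Finset.range M, N * (4 / e * v ^ θ *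
              (Real.arctan ((s - x i) ^ e) - Real.arctan ((s - x (i + 1)) ^ e))) := by
              refine norm_sum_le_of_le _ fun i hi => ?_
              have hi1 := hle (i + 1) (Finset.mem_range.1 hi)
              have hii : x i ≤ x (i + 1) := hx (Nat.le_succ i)
              have key := modulus_mul_kernel_sub_le h0 h1 hγ hγlam he heγ helam hθ0 hθ1 hv0 hst1
                (X := s - x (i + 1)) (Y := s - x i) (by linarith) (by linarith)
              have hd := kernel_anti h0.le h1.le hv0 (X := s - x (i + 1)) (Y := s - x i)
                (by linarith) (by linarith)
              rw [show s - x (i + 1) + v = t - x (i + 1) by rw [hv]; ring,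
                show s - x i + v = t - x i by rw [hv]; ring] at key hd
              rw [← sub_nonneg] at hd
              rw [norm_smul, Real.norm_of_nonneg hd]
              have hui := hleft _ hi1
              calc _ ≤ (((t - x (i + 1)) ^ h - (s - x (i + 1)) ^ h) -
                  ((t - x i) ^ h - (s - x i) ^ h)) * (N * modulus γ lam (s - x (i + 1))) := by
                    gcongr
                _ = N * (modulus γ lam (s - x (i + 1)) *
                  (((t - x (i + 1)) ^ h - (s - x (i + 1)) ^ h) -
                  ((t - x i) ^ h - (s - x i) ^ h))) := by ring
                _ ≤ _ := by gcongr
          _ = N * (4 / e * v ^ θ) * (Real.arctan ((s - x 0) ^ e) -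
                Real.arctan ((s - x M) ^ e)) := by
              rw [← Finset.sum_range_sub' (fun i => Real.arctan ((s - x i) ^ e)), Finset.mul_sum]
              exact Finset.sum_congr rfl fun i _ => by ring
          _ ≤ N * (4 / e * v ^ θ) * (Real.pi / 2) := by
              gcongr
              rw [hxM, sub_self, Real.zero_rpow he.ne', Real.arctan_zero, sub_zero]
              exact (Real.arctan_lt_pi_div_two _).le
          _ = _ := by ring
      calc _ ≤ ‖-(((t - x 0) ^ h - (s - x 0) ^ h) • u 0)‖ + _ := norm_sub_le _ _
        _ ≤ _ := by rw [norm_neg]; exact add_le_add c1 c2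
    have b2 : ‖∑ i ∈ Finset.range M, ((t - x (M + i)) ^ h) • (u (M + (i + 1)) - u (M + i))‖ ≤
        2 * N * v ^ θ := by
      rw [sum_smul_sub_eq (fun i => (t - x (M + i)) ^ h) (fun i => u (M + i)), hxMM, sub_self,
        Real.zero_rpow h0.ne', zero_smul, add_zero, huM, smul_zero, sub_zero, zero_sub, norm_neg]
      calc _ ≤ ∑ i ∈ Finset.range M, (N * (2 * v ^ γ)) *
              ((t - x (M + i)) ^ h - (t - x (M + (i + 1))) ^ h) := by
            refine norm_sum_le_of_le _ fun i hi => ?_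
            have hi1 : s ≤ x (M + (i + 1)) := hge _ (Nat.le_add_right _ _)
            have hi2 : x (M + (i + 1)) ≤ t := by
              rw [← hxMM]; exact hx (by have := Finset.mem_range.1 hi; omega)
            have hii : x (M + i) ≤ x (M + (i + 1)) := hx (by omega)
            have hm : (t - x (M + (i + 1))) ^ h ≤ (t - x (M + i)) ^ h :=
              Real.rpow_le_rpow (by linarith) (by linarith) h0.le
            rw [norm_smul, Real.norm_of_nonpos (by linarith), mul_comm, neg_sub]
            refine mul_le_mul_of_nonneg_right ?_ (by linarith)
            refine (hright _ hi1 hi2).trans ?_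
            gcongr
            refine (modulus_mono hγ.le hlam0.le (by linarith) (by linarith :
              x (M + (i + 1)) - s ≤ v)).trans (modulus_le_of_le_one hγlam hv0 hst1)
        _ = (N * (2 * v ^ γ)) * v ^ h := by
            rw [← Finset.mul_sum, Finset.sum_range_sub' (fun i => (t - x (M + i)) ^ h), hxMM,
              add_zero, hxM, sub_self, Real.zero_rpow h0.ne', sub_zero]
        _ = 2 * N * v ^ (γ + h) := by rw [Real.rpow_add hv0]; ring
        _ ≤ _ := by
            gcongr 2 * N * ?_
            exact Real.rpow_le_rpow_of_exponent_ge hv0 hst1 (by linarith)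
    calc ‖Jt A - Js A‖ = ‖(S₁ - S₂) - (S₁ - Jt A) + (S₂ - Js A)‖ := by congr 1; abel
      _ ≤ ‖S₁ - S₂‖ + ‖S₁ - Jt A‖ + ‖S₂ - Js A‖ :=
        (norm_add_le _ _).trans (add_le_add_left (norm_sub_le _ _) _)
      _ ≤ _ := by
        have := norm_add_le_of_le b1 b2
        rw [← hdiff] at this
        linarith
  have lim := le_of_tendsto_of_tendsto (hJtlim.sub hJslim).norm
    (hbdry_lim.add_const ((4 / e * (Real.pi / 2) + 2) * N * v ^ θ)) main
  simpa using lim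

/-- If the increments of `w` into the interval `[a, a + 1]` are controlled by `N` times the
modulus, the fractional path driven by `w` has `θ`-Hölder seminorm of order `N` on `[a, a + 1]`. -/
theorem holder_le_of_modulus {H γ lam θ e : ℝ} (hH : H ∈ Ioo (1 / 2 : ℝ) 1) (hγ : 0 < γ)
    (hγlam : γ ≤ lam) (he : 0 < e) (heγ : e ≤ γ + (H - 1 / 2) - θ)
    (helam : e ≤ 1 - lam - (H - 1 / 2)) (hθ0 : 0 ≤ θ) (hθ1 : θ ≤ 1) {w B : ℝ → V} {a : ℝ}
    {N : ℝ≥0∞} (ha : 0 ≤ a)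
    (hw : ∀ s ∈ Icc a (a + 1), ∀ r ≤ s, ‖w s - w r‖ₑ ≤ N * ENNReal.ofReal (modulus γ lam (s - r)))
    (hB : ∀ t, ∃ I, HasImproperRS
      (fun r => (max (t - r) 0) ^ (H - 1 / 2) - (max (-r) 0) ^ (H - 1 / 2)) w (max t 0) I ∧
      B t = alphaH H • I) :
    holder θ B a (a + 1) ≤ ENNReal.ofReal (|alphaH H| * (4 / e * (Real.pi / 2) + 2) + 1) * N := by
  have hc : 0 < |alphaH H| * (4 / e * (Real.pi / 2) + 2) + 1 := by positivity
  rcases eq_or_ne N ⊤ with rfl | hN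
  · rw [ENNReal.mul_top (by simpa using hc)]
    exact le_top
  have hnorm : ∀ s ∈ Icc a (a + 1), ∀ r ≤ s, ‖w s - w r‖ ≤ N.toReal * modulus γ lam (s - r) := by
    intro s hs r hr
    have := ENNReal.toReal_mono (ENNReal.mul_ne_top hN ENNReal.ofReal_ne_top) (hw s hs r hr)
    rwa [toReal_enorm, ENNReal.toReal_mul,
      ENNReal.toReal_ofReal (modulus_nonneg (by linarith))] at this
  rw [holder]
  refine iSup₂_le fun s t => iSup_le fun ⟨has, hst, hta⟩ => ?_
  obtain ⟨It, hIt, hBt⟩ := hB t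
  obtain ⟨Is, hIs, hBs⟩ := hB s
  rw [max_eq_left (by linarith)] at hIt hIs
  have key := norm_sub_le_of_hasImproperRS (by linarith [hH.1]) (by linarith [hH.2]) hγ hγlam he
    heγ helam hθ0 hθ1 (ha.trans has) hst (by linarith) ENNReal.toReal_nonneg
    (fun r hr => by rw [norm_sub_rev]; exact hnorm s ⟨has, by linarith⟩ r hr)
    (fun r hr hrt => hnorm r ⟨by linarith, by linarith⟩ s hr) hIt hIs
  have hv : 0 < (t - s) ^ θ := Real.rpow_pos_of_pos (by linarith) _
  rw [← ENNReal.ofReal_toReal hN, ← ENNReal.ofReal_mul hc.le]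
  apply ENNReal.ofReal_le_ofReal
  rw [div_le_iff₀ hv, hBt, hBs, ← smul_sub, norm_smul, Real.norm_eq_abs]
  have hN0 : 0 ≤ N.toReal := ENNReal.toReal_nonneg
  calc |alphaH H| * ‖It - Is‖ ≤
        |alphaH H| * ((4 / e * (Real.pi / 2) + 2) * N.toReal * (t - s) ^ θ) := by gcongr
    _ = |alphaH H| * (4 / e * (Real.pi / 2) + 2) * (N.toReal * (t - s) ^ θ) := by ring
    _ ≤ (|alphaH H| * (4 / e * (Real.pi / 2) + 2) + 1) * (N.toReal * (t - s) ^ θ) := by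
        gcongr; linarith
    _ = _ := by ring

end Fractional

/-! ### Hölder bounds from dyadic increments -/

section Chaining

variable {V : Type*} [NormedAddCommGroup V]

/-- Chaining on `[0, 1]`: geometric control of the dyadic increments of a continuous path gives a
Hölder bound of exponent `γ`. -/
lemma norm_sub_le_of_dyadic {γ b : ℝ} (hγ : 0 < γ) (hb : 0 ≤ b) {f : ℝ → V} (hf : Continuous f)
    (hd : ∀ m j : ℕ, j < 2 ^ m →
      ‖f (((j : ℝ) + 1) / 2 ^ m) - f ((j : ℝ) / 2 ^ m)‖ ≤ b * ((1 / 2 : ℝ) ^ γ) ^ m)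
    {s t : ℝ} (hs : 0 ≤ s) (hst : s ≤ t) (ht : t ≤ 1) :
    ‖f t - f s‖ ≤ 2 ^ γ * (1 + 2 / (1 - (1 / 2 : ℝ) ^ γ)) * b * (t - s) ^ γ := by
  set q : ℝ := (1 / 2 : ℝ) ^ γ with hq
  have hq0 : 0 < q := by positivity
  have hq1 : q < 1 := Real.rpow_lt_one (by norm_num) (by norm_num) hγ
  have h1q : 0 < 1 - q := by linarith
  set D : ℝ → ℕ → V := fun x m => f ((⌊x * 2 ^ m⌋₊ : ℝ) / 2 ^ m) with hD
  have hstep : ∀ x, 0 ≤ x → x ≤ 1 → ∀ m, dist (D x m) (D x (m + 1)) ≤ b * q ^ m := by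
    intro x hx hx1 m
    set k := ⌊x * 2 ^ m⌋₊ with hk
    have k1 : (k : ℝ) ≤ x * 2 ^ m := Nat.floor_le (by positivity)
    have k2 : x * 2 ^ m < k + 1 := Nat.lt_floor_add_one _
    have hle : b * q ^ (m + 1) ≤ b * q ^ m := by
      gcongr b * ?_
      exact pow_le_pow_of_le_one hq0.le hq1.le (Nat.le_succ m)
    have hcase : ⌊x * 2 ^ (m + 1)⌋₊ = 2 * k ∨
        (⌊x * 2 ^ (m + 1)⌋₊ = 2 * k + 1 ∧ ((2 * k + 1 : ℕ) : ℝ) ≤ x * 2 ^ (m + 1)) := by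
      rcases lt_or_ge (x * 2 ^ (m + 1)) (2 * k + 1) with hlt | hge
      · left
        rw [Nat.floor_eq_iff (by positivity)]
        push_cast
        constructor
        · rw [pow_succ]; linarith
        · linarith
      · right
        refine ⟨?_, by push_cast; linarith⟩
        rw [Nat.floor_eq_iff (by positivity)]
        push_cast
        constructor
        · linarith
        · rw [pow_succ]; linarith
    have heq : ((2 * k : ℕ) : ℝ) / 2 ^ (m + 1) = (k : ℝ) / 2 ^ m := by
      push_cast; rw [pow_succ]; field_simp
    rcases hcase with h | ⟨h, h'⟩
    · simp only [hD, h, heq, ← hk, dist_self]; positivity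
    · refine le_trans ?_ hle
      have hj : 2 * k < 2 ^ (m + 1) := by
        have : ((2 * k + 1 : ℕ) : ℝ) ≤ ((2 ^ (m + 1) : ℕ) : ℝ) := by
          push_cast at h' ⊢
          have : (0 : ℝ) < 2 ^ (m + 1) := by positivity
          nlinarith
        have := Nat.cast_le.1 this
        omega
      have := hd (m + 1) (2 * k) hj
      rw [heq] at this
      rw [dist_eq_norm, norm_sub_rev]
      simp only [hD, h, ← hk]
      push_cast at this ⊢
      exact this
  have hlim : ∀ x, 0 ≤ x → Tendsto (D x) atTop (𝓝 (f x)) := by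
    intro x hx
    have h2 : Tendsto (fun m : ℕ => (2 : ℝ) ^ m) atTop atTop :=
      tendsto_pow_atTop_atTop_of_one_lt (by norm_num)
    exact (hf.tendsto x).comp ((tendsto_nat_floor_mul_div_atTop hx).comp h2)
  have happrox : ∀ x, 0 ≤ x → x ≤ 1 → ∀ m, ‖D x m - f x‖ ≤ b * q ^ m / (1 - q) := by
    intro x hx hx1 m
    rw [← dist_eq_norm]
    exact dist_le_of_le_geometric_of_tendsto q b hq1 (hstep x hx hx1) (hlim x hx) m
  rcases hst.eq_or_lt with rfl | hlt
  · simp [Real.zero_rpow hγ.ne']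
  obtain ⟨m, hm1, hm2⟩ := exists_nat_pow_near_of_lt_one (x := t - s) (y := (1 / 2 : ℝ))
    (by linarith) (by linarith) (by norm_num) (by norm_num)
  have hadj : ‖D t m - D s m‖ ≤ b * q ^ m := by
    set k := ⌊s * 2 ^ m⌋₊ with hk
    have p0 : (0 : ℝ) < 2 ^ m := by positivity
    have hts : t * 2 ^ m - s * 2 ^ m ≤ 1 := by
      have : (t - s) * 2 ^ m ≤ (1 / 2 : ℝ) ^ m * 2 ^ m := by gcongr
      rw [← mul_pow] at this
      norm_num at this
      linarith
    have k2 : s * 2 ^ m < k + 1 := Nat.lt_floor_add_one _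
    have k3 : k ≤ ⌊t * 2 ^ m⌋₊ := Nat.floor_mono (by gcongr)
    have k4 : ⌊t * 2 ^ m⌋₊ < k + 2 := by
      rw [Nat.floor_lt (by have := hs.trans hst; positivity)]
      push_cast; linarith
    rcases (by omega : ⌊t * 2 ^ m⌋₊ = k ∨ ⌊t * 2 ^ m⌋₊ = k + 1) with h | h
    · simp only [hD, h, ← hk, sub_self, norm_zero]; positivity
    · have h5 : ((k + 1 : ℕ) : ℝ) ≤ t * 2 ^ m := 
          h ▸ Nat.floor_le (by have := hs.trans hst; positivity)
      have hj : k < 2 ^ m := by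
        have : ((k + 1 : ℕ) : ℝ) ≤ ((2 ^ m : ℕ) : ℝ) := by
          push_cast at h5 ⊢
          nlinarith
        have := Nat.cast_le.1 this
        omega
      have := hd m k hj
      simp only [hD, h, ← hk]
      push_cast
      exact this
  have hqm : q ^ m ≤ 2 ^ γ * (t - s) ^ γ := by
    rw [← Real.mul_rpow (by norm_num) (by linarith), hq, ← Real.rpow_natCast,
      ← Real.rpow_mul (by norm_num), mul_comm γ, Real.rpow_mul (by norm_num), Real.rpow_natCast]
    refine Real.rpow_le_rpow (by positivity) ?_ hγ.le
    rw [pow_succ] at hm1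
    linarith
  calc ‖f t - f s‖ = ‖(D t m - D s m) - (D t m - f t) + (D s m - f s)‖ := by congr 1; abel
    _ ≤ b * q ^ m + b * q ^ m / (1 - q) + b * q ^ m / (1 - q) :=
      norm_add_le_of_le ((norm_sub_le _ _).trans
        (add_le_add hadj (happrox t (hs.trans hst) ht m))) (happrox s hs (hst.trans ht) m)
    _ = (1 + 2 / (1 - q)) * b * q ^ m := by ring
    _ ≤ (1 + 2 / (1 - q)) * b * (2 ^ γ * (t - s) ^ γ) := by gcongr
    _ = _ := by ring

/-- The sum over all dyadic levels `m` of the `p`-th powers of the increments of `v` over the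
dyadic subintervals of `[a, a + T]`, weighted by `2 ^ (γ p m)`: a measurable functional whose
`p`-th root bounds the `γ`-Hölder norm. -/
def dyadicEnergy (p : ℕ) (γ : ℝ) (v : ℝ → V) (a T : ℝ) : ℝ≥0∞ :=
  ∑' m : ℕ, ENNReal.ofReal (2 ^ (γ * p * m)) * ∑ j ∈ Finset.range (2 ^ m),
    ‖v (a + T * (((j : ℝ) + 1) / 2 ^ m)) - v (a + T * ((j : ℝ) / 2 ^ m))‖ₑ ^ p

/-- The dyadic energies of `v` on the windows `[a n, a n + 2 ^ n]`, weighted by `2 ^ (-lam p n)`.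
It controls the growth of `v` with exponent `lam` at large scales. -/
def windowEnergy (p : ℕ) (γ lam : ℝ) (v : ℝ → V) (a : ℕ → ℝ) : ℝ≥0∞ :=
  ∑' n : ℕ, ENNReal.ofReal (2 ^ (-(lam * p * n))) * dyadicEnergy p γ v (a n) (2 ^ n)

lemma norm_sub_le_of_dyadicEnergy {p : ℕ} (hp : p ≠ 0) {γ b : ℝ} (hγ : 0 < γ) (hb : 0 ≤ b)
    {v : ℝ → V} (hv : Continuous v) {a T : ℝ} (hT : 0 < T)
    (hE : dyadicEnergy p γ v a T ≤ ENNReal.ofReal (b ^ p)) {s t : ℝ} (hs : a ≤ s) (hst : s ≤ t)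
    (ht : t ≤ a + T) :
    ‖v t - v s‖ ≤ 2 ^ γ * (1 + 2 / (1 - (1 / 2 : ℝ) ^ γ)) * b * ((t - s) / T) ^ γ := by
  have key := norm_sub_le_of_dyadic hγ hb (f := fun x => v (a + T * x)) (by fun_prop) ?_
    (s := (s - a) / T) (t := (t - a) / T) (div_nonneg (by linarith) hT.le) (by gcongr)
    (by rw [div_le_one hT]; linarith)
  · simp only [mul_div_cancel₀ _ hT.ne'] at key
    rw [← sub_div, show t - a - (s - a) = t - s by ring] at key
    simpa using key
  · intro m j hj
    have h1 : ENNReal.ofReal (2 ^ (γ * p * m)) *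
        ‖v (a + T * (((j : ℝ) + 1) / 2 ^ m)) - v (a + T * ((j : ℝ) / 2 ^ m))‖ₑ ^ p ≤
        ENNReal.ofReal (b ^ p) := by
      refine le_trans ?_ ((ENNReal.le_tsum m).trans hE)
      gcongr
      exact Finset.single_le_sum (f := fun j : ℕ =>
        ‖v (a + T * (((j : ℝ) + 1) / 2 ^ m)) - v (a + T * ((j : ℝ) / 2 ^ m))‖ₑ ^ p)
        (fun _ _ => zero_le) (Finset.mem_range.2 hj)
    set x := ‖v (a + T * (((j : ℝ) + 1) / 2 ^ m)) - v (a + T * ((j : ℝ) / 2 ^ m))‖ with hx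
    rw [← ofReal_norm, ← hx, ← ENNReal.ofReal_pow (norm_nonneg _),
      ← ENNReal.ofReal_mul (by positivity), ENNReal.ofReal_le_ofReal_iff (by positivity)] at h1
    have h2 : (2 : ℝ) ^ (γ * p * m) = ((2 ^ γ) ^ m) ^ p := by
      rw [show γ * p * m = γ * m * p by ring, Real.rpow_mul (by norm_num), Real.rpow_natCast,
        Real.rpow_mul (by norm_num), Real.rpow_natCast]
    rw [h2, ← mul_pow] at h1
    have h3 := le_of_pow_le_pow_left₀ hp hb h1
    rw [Real.div_rpow (by norm_num) (by norm_num), Real.one_rpow, one_div, inv_pow,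
      ← div_eq_mul_inv, le_div_iff₀ (by positivity), mul_comm]
    exact h3

/-- The constant of the chaining argument. -/
def chainConst (γ lam : ℝ) : ℝ := 2 ^ γ * (1 + 2 / (1 - (1 / 2 : ℝ) ^ γ)) * 2 ^ (lam - γ)

lemma chainConst_pos {γ : ℝ} (hγ : 0 < γ) (lam : ℝ) : 0 < chainConst γ lam := by
  have : (1 / 2 : ℝ) ^ γ < 1 := Real.rpow_lt_one (by norm_num) (by norm_num) hγ
  have : 0 < 1 - (1 / 2 : ℝ) ^ γ := by linarith
  unfold chainConst; positivity

/-- If every window of length at least `1 + (s - r)` contains `r` and `s`, the window energy bounds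
the increment between them: the smallest such window has length comparable to `1 + (s - r)`. -/
lemma enorm_sub_le_of_windowEnergy {p : ℕ} (hp : p ≠ 0) {γ lam : ℝ} (hγ : 0 < γ)
    (hγlam : γ ≤ lam) (hlam : lam ≤ 1) {v : ℝ → V} (hv : Continuous v) {a : ℕ → ℝ} {r s : ℝ}
    (hrs : r ≤ s) (ha : ∀ n : ℕ, 1 + (s - r) ≤ 2 ^ n → a n ≤ r ∧ s ≤ a n + 2 ^ n) :
    ‖v s - v r‖ₑ ≤ ENNReal.ofReal (chainConst γ lam) * windowEnergy p γ lam v a ^ (1 / p : ℝ) *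
      ENNReal.ofReal (modulus γ lam (s - r)) := by
  have hC := chainConst_pos hγ lam
  rcases hrs.eq_or_lt with rfl | hlt
  · simp
  have hx : 0 < s - r := by linarith
  have hp0 : (0 : ℝ) < p := by positivity
  rcases eq_or_ne (windowEnergy p γ lam v a) ⊤ with htop | htop
  · have hm : 0 < modulus γ lam (s - r) := by unfold modulus; positivity
    rw [htop, ENNReal.top_rpow_of_pos (by positivity), ENNReal.mul_top (by simpa using hC),
      ENNReal.top_mul (by simpa using hm)]
    exact le_top
  obtain ⟨n, hn1, hn2⟩ : ∃ n : ℕ, 1 + (s - r) ≤ 2 ^ n ∧ (2 : ℝ) ^ n ≤ 2 * (1 + (s - r)) := by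
    obtain ⟨n, h1, h2⟩ := exists_nat_pow_near (x := 1 + (s - r)) (y := (2 : ℝ)) (by linarith)
      (by norm_num)
    exact ⟨n + 1, h2.le, by rw [pow_succ]; linarith⟩
  obtain ⟨har, has⟩ := ha n hn1
  set S := (windowEnergy p γ lam v a).toReal with hS
  have hS0 : 0 ≤ S := ENNReal.toReal_nonneg
  have hSeq : windowEnergy p γ lam v a = ENNReal.ofReal S := (ENNReal.ofReal_toReal htop).symm
  set b := 2 ^ (lam * n) * S ^ (1 / p : ℝ) with hb
  have hE : dyadicEnergy p γ v (a n) (2 ^ n) ≤ ENNReal.ofReal (b ^ p) := by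
    have h1 : ENNReal.ofReal (2 ^ (-(lam * p * n))) * dyadicEnergy p γ v (a n) (2 ^ n) ≤
        ENNReal.ofReal S := hSeq ▸ ENNReal.le_tsum n
    have h2 : b ^ p = 2 ^ (lam * p * n) * S := by
      rw [hb, mul_pow, ← Real.rpow_natCast, ← Real.rpow_natCast, ← Real.rpow_mul (by norm_num),
        ← Real.rpow_mul hS0, one_div, inv_mul_cancel₀ hp0.ne', Real.rpow_one]
      congr 2; ring
    calc dyadicEnergy p γ v (a n) (2 ^ n) = ENNReal.ofReal (2 ^ (lam * p * n)) *
          (ENNReal.ofReal (2 ^ (-(lam * p * n))) * dyadicEnergy p γ v (a n) (2 ^ n)) := by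
          rw [← mul_assoc, ← ENNReal.ofReal_mul (by positivity), ← Real.rpow_add (by norm_num)]
          simp
      _ ≤ ENNReal.ofReal (2 ^ (lam * p * n)) * ENNReal.ofReal S := by gcongr
      _ = _ := by rw [← ENNReal.ofReal_mul (by positivity), h2]
  have key := norm_sub_le_of_dyadicEnergy hp hγ (by positivity) hv (by positivity) hE har hrs has
  rw [hSeq, ENNReal.ofReal_rpow_of_nonneg hS0 (by positivity), ← ENNReal.ofReal_mul hC.le,
    ← ENNReal.ofReal_mul (by positivity), ← ofReal_norm]
  apply ENNReal.ofReal_le_ofReal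
  refine key.trans ?_
  have e1 : (2 : ℝ) ^ (lam * n) * ((s - r) / 2 ^ n) ^ γ =
      ((2 : ℝ) ^ n) ^ (lam - γ) * (s - r) ^ γ := by
    rw [Real.div_rpow hx.le (by positivity), Real.rpow_sub (by positivity), mul_comm lam,
      Real.rpow_mul (by norm_num), Real.rpow_natCast]
    ring
  have e2 : ((2 : ℝ) ^ n) ^ (lam - γ) ≤ 2 ^ (lam - γ) * (1 + (s - r) ^ (lam - γ)) := by
    calc ((2 : ℝ) ^ n) ^ (lam - γ) ≤ (2 * (1 + (s - r))) ^ (lam - γ) :=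
          Real.rpow_le_rpow (by positivity) hn2 (by linarith)
      _ = 2 ^ (lam - γ) * (1 + (s - r)) ^ (lam - γ) := Real.mul_rpow (by norm_num) (by linarith)
      _ ≤ _ := by
        gcongr
        simpa using Real.rpow_add_le_add_rpow (zero_le_one) hx.le (by linarith)
          (by linarith : lam - γ ≤ 1)
  have e3 : (1 + (s - r) ^ (lam - γ)) * (s - r) ^ γ = modulus γ lam (s - r) := by
    rw [modulus, add_mul, ← Real.rpow_add hx]; simp
  have hA : 0 ≤ 2 ^ γ * (1 + 2 / (1 - (1 / 2 : ℝ) ^ γ)) := by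
    have : (1 / 2 : ℝ) ^ γ < 1 := Real.rpow_lt_one (by norm_num) (by norm_num) hγ
    have : 0 < 1 - (1 / 2 : ℝ) ^ γ := by linarith
    positivity
  calc _ = 2 ^ γ * (1 + 2 / (1 - (1 / 2 : ℝ) ^ γ)) * S ^ (1 / p : ℝ) *
        (2 ^ (lam * n) * ((s - r) / 2 ^ n) ^ γ) := by rw [hb]; ring
    _ = 2 ^ γ * (1 + 2 / (1 - (1 / 2 : ℝ) ^ γ)) * S ^ (1 / p : ℝ) *
        (((2 : ℝ) ^ n) ^ (lam - γ) * (s - r) ^ γ) := by rw [e1]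
    _ ≤ 2 ^ γ * (1 + 2 / (1 - (1 / 2 : ℝ) ^ γ)) * S ^ (1 / p : ℝ) *
        (2 ^ (lam - γ) * (1 + (s - r) ^ (lam - γ)) * (s - r) ^ γ) := by gcongr
    _ = _ := by rw [chainConst, ← e3]; ring

end Chaining

/-! ### Moments of Brownian window energies -/

section BrownianMoments

variable {d : ℕ} {Ω : Type*} [MeasurableSpace Ω]

lemma enorm_pow_le_sum {p : ℕ} (hp : p ≠ 0) (x : E d) :
    ‖x‖ₑ ^ p ≤ (d : ℝ≥0∞) ^ (p - 1) * ∑ i, ‖x i‖ₑ ^ p := by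
  have h1 : ‖x‖ₑ ≤ ∑ i, ‖x i‖ₑ := by
    conv_lhs => rw [← (EuclideanSpace.basisFun (Fin d) ℝ).sum_repr x]
    refine (enorm_sum_le _ _).trans (le_of_eq ?_)
    refine Finset.sum_congr rfl fun i _ => ?_
    simp [← ofReal_norm, norm_smul]
  have hp1 : (1 : ℝ) ≤ p := by exact_mod_cast Nat.one_le_iff_ne_zero.2 hp
  have h2 := ENNReal.rpow_sum_le_const_mul_sum_rpow (s := Finset.univ) (fun i => ‖x i‖ₑ) hp1
  simp only [ENNReal.rpow_natCast, Finset.card_univ, Fintype.card_fin] at h2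
  rw [show (p : ℝ) - 1 = ((p - 1 : ℕ) : ℝ) by
    rw [Nat.cast_sub (Nat.one_le_iff_ne_zero.2 hp)]; simp, ENNReal.rpow_natCast] at h2
  exact (pow_le_pow_left' h1 p).trans h2

lemma lintegral_enorm_pow_gaussianReal (v : ℝ≥0) (p : ℕ) :
    ∫⁻ x, ‖x‖ₑ ^ p ∂gaussianReal 0 v =
      ENNReal.ofReal (√v ^ p) * ∫⁻ x, ‖x‖ₑ ^ p ∂gaussianReal 0 1 := by
  have h := gaussianReal_map_const_mul (μ := 0) (v := 1) (√(v : ℝ))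
  rw [mul_zero, mul_one] at h
  have hv : (NNReal.mk (√(v : ℝ) ^ 2) (sq_nonneg _)) = v := by
    ext; exact Real.sq_sqrt v.2
  rw [hv] at h
  rw [← h, lintegral_map (by fun_prop) (by fun_prop), ← lintegral_const_mul _ (by fun_prop)]
  refine lintegral_congr fun x => ?_
  rw [enorm_mul, mul_pow, ENNReal.ofReal_pow (Real.sqrt_nonneg _),
    Real.enorm_of_nonneg (Real.sqrt_nonneg _)]

/-- Bound on the `p`-th moment of a `d`-dimensional Brownian increment over a unit time. -/
def incrConst (d p : ℕ) : ℝ≥0∞ := (d : ℝ≥0∞) ^ p * ∫⁻ x, ‖x‖ₑ ^ p ∂gaussianReal 0 1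

lemma incrConst_ne_top (d p : ℕ) : incrConst d p ≠ ⊤ := by
  refine ENNReal.mul_ne_top (ENNReal.pow_ne_top (by simp)) ?_
  rcases eq_or_ne p 0 with rfl | hp
  · simp
  have h := (memLp_id_gaussianReal' (μ := 0) (v := 1) (p : ℝ≥0∞) (by simp)).2
  rw [eLpNorm_lt_top_iff_lintegral_rpow_enorm_lt_top (by simpa using hp) (by simp)] at h
  simpa using h.ne

variable {X : ℝ≥0 → Ω → E d} {P : Measure Ω}

lemma IsBrownian.aemeasurable (hX : IsBrownian X P) (t : ℝ≥0) : AEMeasurable (X t) P := by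
  have h : AEMeasurable (fun ω => WithLp.toLp 2 fun i => X t ω i) P :=
    (WithLp.measurable_toLp 2 _).comp_aemeasurable
      (aemeasurable_pi_lambda _ fun i => (hX.coord i).aemeasurable t)
  exact h

lemma IsBrownian.continuous (hX : IsBrownian X P) : ∀ᵐ ω ∂P, Continuous fun t => X t ω := by
  filter_upwards [ae_all_iff.2 fun i => (hX.coord i).cont] with ω h
  have : Continuous fun t => WithLp.toLp 2 fun i => X t ω i :=
    (PiLp.continuous_toLp 2 _).comp (continuous_pi h)
  exact this

lemma IsBrownian.lintegral_enorm_sub_pow_le (hX : IsBrownian X P) {p : ℕ} (hp : p ≠ 0)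
    {s t : ℝ≥0} {r : ℝ} (hr : |(s : ℝ) - t| ≤ r) :
    ∫⁻ ω, ‖X s ω - X t ω‖ₑ ^ p ∂P ≤ incrConst d p * ENNReal.ofReal (√r ^ p) := by
  have hcoord : ∀ i, ∫⁻ ω, ‖(X s ω - X t ω) i‖ₑ ^ p ∂P ≤
      ENNReal.ofReal (√r ^ p) * ∫⁻ x, ‖x‖ₑ ^ p ∂gaussianReal 0 1 := by
    intro i
    obtain ⟨v, hv, h⟩ : ∃ v : ℝ≥0, (v : ℝ) = |(s : ℝ) - t| ∧
        HasLaw (fun ω => X s ω i - X t ω i) (gaussianReal 0 v) P :=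
      ⟨_, rfl, (hX.coord i).hasLaw_sub s t⟩
    have e : ∫⁻ ω, ‖(X s ω - X t ω) i‖ₑ ^ p ∂P = ∫⁻ x, ‖x‖ₑ ^ p ∂gaussianReal 0 v := by
      rw [← h.map_eq, lintegral_map' (by fun_prop) h.aemeasurable]
      rfl
    rw [e, lintegral_enorm_pow_gaussianReal]
    gcongr
    rwa [hv]
  calc _ ≤ ∫⁻ ω, (d : ℝ≥0∞) ^ (p - 1) * ∑ i, ‖(X s ω - X t ω) i‖ₑ ^ p ∂P :=
        lintegral_mono fun ω => enorm_pow_le_sum hp _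
    _ = (d : ℝ≥0∞) ^ (p - 1) * ∑ i, ∫⁻ ω, ‖(X s ω - X t ω) i‖ₑ ^ p ∂P := by
        rw [lintegral_const_mul' _ _ (ENNReal.pow_ne_top (by simp)), lintegral_finsetSum']
        intro i _
        have h1 := (hX.coord i).aemeasurable s
        have h2 := (hX.coord i).aemeasurable t
        have : AEMeasurable (fun ω => X s ω i - X t ω i) P := h1.sub h2
        exact this.enorm.pow_const p
    _ ≤ (d : ℝ≥0∞) ^ (p - 1) * ∑ _i : Fin d,
          (ENNReal.ofReal (√r ^ p) * ∫⁻ x, ‖x‖ₑ ^ p ∂gaussianReal 0 1) := by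
        gcongr with i; exact hcoord i
    _ = _ := by
        rw [Finset.sum_const, Finset.card_univ, Fintype.card_fin, nsmul_eq_mul, incrConst]
        obtain ⟨q, rfl⟩ := Nat.exists_eq_succ_of_ne_zero hp
        simp only [Nat.succ_eq_add_one, Nat.add_sub_cancel, pow_succ (d : ℝ≥0∞)]
        ring

/-- The extension of a path on `[0, ∞)` to `ℝ`, constant on `(-∞, 0]`. -/
def extendPath (V : ℝ≥0 → E d) (x : ℝ) : E d := V x.toNNReal

lemma continuous_extendPath {V : ℝ≥0 → E d} (hV : Continuous V) : Continuous (extendPath V) :=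
  hV.comp continuous_real_toNNReal

/-- The geometric series `∑ 2 ^ (x m)`. -/
def geomSeries (x : ℝ) : ℝ≥0∞ := ∑' m : ℕ, ENNReal.ofReal (2 ^ (x * m))

lemma geomSeries_ne_top {x : ℝ} (hx : x < 0) : geomSeries x ≠ ⊤ := by
  have h1 : (2 : ℝ) ^ x < 1 := Real.rpow_lt_one_of_one_lt_of_neg (by norm_num) hx
  have : geomSeries x = ∑' m : ℕ, ENNReal.ofReal (2 ^ x) ^ m := by
    refine tsum_congr fun m => ?_
    rw [Real.rpow_mul (by norm_num), Real.rpow_natCast, ENNReal.ofReal_pow (by positivity)]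
  rw [this, ENNReal.tsum_geometric]
  refine ENNReal.inv_ne_top.2 (tsub_pos_of_lt ?_).ne'
  rw [← ENNReal.ofReal_one]
  exact (ENNReal.ofReal_lt_ofReal_iff zero_lt_one).2 h1

/-- Bound on the mean window energy of a `d`-dimensional Brownian motion. -/
def energyConst (d p : ℕ) (γ lam : ℝ) : ℝ≥0∞ :=
  incrConst d p * geomSeries (γ * p + 1 - p / 2) * geomSeries (p / 2 - lam * p)

lemma energyConst_ne_top {d p : ℕ} (hp : p ≠ 0) {γ lam : ℝ} (hγ : γ * p + 1 < p / 2)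
    (hlam : 1 / 2 < lam) : energyConst d p γ lam ≠ ⊤ := by
  have hp0 : (0 : ℝ) < p := by positivity
  exact ENNReal.mul_ne_top (ENNReal.mul_ne_top (incrConst_ne_top d p)
    (geomSeries_ne_top (by linarith))) (geomSeries_ne_top (by nlinarith))

lemma sqrt_pow_eq {x : ℝ} (p : ℕ) (hx : 0 ≤ x) : √x ^ p = x ^ (p / 2 : ℝ) := by
  rw [Real.sqrt_eq_rpow, ← Real.rpow_natCast, ← Real.rpow_mul hx]
  congr 1; ring

lemma IsBrownian.aemeasurable_incr (hX : IsBrownian X P) (p : ℕ) (x y : ℝ) :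
    AEMeasurable (fun ω => ‖extendPath (X · ω) x - extendPath (X · ω) y‖ₑ ^ p) P :=
  ((hX.aemeasurable _).sub (hX.aemeasurable _)).enorm.pow_const p

lemma IsBrownian.aemeasurable_dyadicEnergy (hX : IsBrownian X P) (p : ℕ) (γ a T : ℝ) :
    AEMeasurable (fun ω => dyadicEnergy p γ (extendPath (X · ω)) a T) P :=
  AEMeasurable.tsum fun _ => (Finset.aemeasurable_fun_sum _ fun _ _ =>
    hX.aemeasurable_incr p _ _).const_mul _

lemma IsBrownian.aemeasurable_windowEnergy (hX : IsBrownian X P) (p : ℕ) (γ lam : ℝ)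
    (a : ℕ → ℝ) : AEMeasurable (fun ω => windowEnergy p γ lam (extendPath (X · ω)) a) P :=
  AEMeasurable.tsum fun _ => (hX.aemeasurable_dyadicEnergy p γ _ _).const_mul _

lemma measurable_windowEnergy (p : ℕ) (γ lam : ℝ) (a : ℕ → ℝ) :
    Measurable fun V : ℝ≥0 → E d => windowEnergy p γ lam (extendPath V) a := by
  unfold windowEnergy dyadicEnergy extendPath
  fun_prop

lemma IsBrownian.lintegral_dyadicEnergy_le (hX : IsBrownian X P) {p : ℕ} (hp : p ≠ 0)
    (γ a : ℝ) {T : ℝ} (hT : 0 < T) :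
    ∫⁻ ω, dyadicEnergy p γ (extendPath (X · ω)) a T ∂P ≤
      incrConst d p * geomSeries (γ * p + 1 - p / 2) * ENNReal.ofReal (T ^ (p / 2 : ℝ)) := by
  unfold dyadicEnergy
  rw [lintegral_tsum fun _ => (Finset.aemeasurable_fun_sum _ fun _ _ =>
    hX.aemeasurable_incr p _ _).const_mul _, geomSeries, ← ENNReal.tsum_mul_left,
    ← ENNReal.tsum_mul_right]
  refine ENNReal.tsum_le_tsum fun m => ?_
  rw [lintegral_const_mul' _ _ ENNReal.ofReal_ne_top,
    lintegral_finsetSum' _ fun _ _ => hX.aemeasurable_incr p _ _]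
  have hj : ∀ j ∈ Finset.range (2 ^ m),
      ∫⁻ ω, ‖extendPath (X · ω) (a + T * (((j : ℝ) + 1) / 2 ^ m)) -
      extendPath (X · ω) (a + T * ((j : ℝ) / 2 ^ m))‖ₑ ^ p ∂P ≤
      incrConst d p * ENNReal.ofReal (√(T / 2 ^ m) ^ p) := by
    intro j _
    refine hX.lintegral_enorm_sub_pow_le hp ?_
    rw [Real.coe_toNNReal', Real.coe_toNNReal']
    refine (abs_max_sub_max_le_abs _ _ _).trans (le_of_eq ?_)
    rw [show a + T * (((j : ℝ) + 1) / 2 ^ m) - (a + T * ((j : ℝ) / 2 ^ m)) = T / 2 ^ m by ring]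
    exact abs_of_pos (by positivity)
  calc _ ≤ ENNReal.ofReal (2 ^ (γ * p * m)) * ∑ _j ∈ Finset.range (2 ^ m),
          incrConst d p * ENNReal.ofReal (√(T / 2 ^ m) ^ p) := by
        gcongr with j hj'; exact hj j hj'
    _ = incrConst d p * (ENNReal.ofReal (2 ^ (γ * p * m)) * ENNReal.ofReal (2 ^ m) *
          ENNReal.ofReal (√(T / 2 ^ m) ^ p)) := by
        have h2 : ENNReal.ofReal (2 ^ m) = 2 ^ m := by
          rw [ENNReal.ofReal_pow (by norm_num), ENNReal.ofReal_ofNat]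
        rw [Finset.sum_const, Finset.card_range, nsmul_eq_mul, h2]
        push_cast
        ring
    _ = incrConst d p * (ENNReal.ofReal (2 ^ ((γ * p + 1 - p / 2) * m)) *
          ENNReal.ofReal (T ^ (p / 2 : ℝ))) := by
        rw [← ENNReal.ofReal_mul (by positivity), ← ENNReal.ofReal_mul (by positivity),
          ← ENNReal.ofReal_mul (by positivity), sqrt_pow_eq p (by positivity),
          Real.div_rpow hT.le (by positivity)]
        congr 2
        rw [show (γ * p + 1 - p / 2) * m = γ * p * m + m - m * (p / 2) by ring,
          Real.rpow_sub (by norm_num), Real.rpow_add (by norm_num), Real.rpow_natCast,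
          Real.rpow_mul (by norm_num) (m : ℝ), Real.rpow_natCast]
        ring
    _ = _ := by ring

theorem IsBrownian.lintegral_windowEnergy_le (hX : IsBrownian X P) {p : ℕ} (hp : p ≠ 0)
    (γ lam : ℝ) (a : ℕ → ℝ) :
    ∫⁻ ω, windowEnergy p γ lam (extendPath (X · ω)) a ∂P ≤ energyConst d p γ lam := by
  unfold windowEnergy
  rw [lintegral_tsum fun _ => (hX.aemeasurable_dyadicEnergy p γ _ _).const_mul _]
  have hsum : energyConst d p γ lam = ∑' n : ℕ, incrConst d p *
      geomSeries (γ * p + 1 - p / 2) * ENNReal.ofReal (2 ^ ((p / 2 - lam * p) * n)) :=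
    ENNReal.tsum_mul_left.symm
  rw [hsum]
  refine ENNReal.tsum_le_tsum fun n => ?_
  rw [lintegral_const_mul' _ _ ENNReal.ofReal_ne_top]
  calc _ ≤ ENNReal.ofReal (2 ^ (-(lam * p * n))) * (incrConst d p *
        geomSeries (γ * p + 1 - p / 2) * ENNReal.ofReal (((2 : ℝ) ^ n) ^ (p / 2 : ℝ))) := by
        gcongr; exact hX.lintegral_dyadicEnergy_le hp γ _ (by positivity)
    _ = incrConst d p * geomSeries (γ * p + 1 - p / 2) * (ENNReal.ofReal (2 ^ (-(lam * p * n))) *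
        ENNReal.ofReal (((2 : ℝ) ^ n) ^ (p / 2 : ℝ))) := by ring
    _ = _ := by
        rw [← ENNReal.ofReal_mul (by positivity), ← Real.rpow_natCast,
          ← Real.rpow_mul (by norm_num), ← Real.rpow_add (by norm_num)]
        congr 3
        ring

end BrownianMoments

/-! ### Independence and moments -/

section Moments

variable {Ω : Type*} {mΩ : MeasurableSpace Ω} {Q : Measure Ω}

/-- The factorization `∫_A f = Q A ∫ f` for `f` independent of `A`, when the `σ`-algebra that makes
`f` measurable need not be contained in the ambient one. -/
lemma setLIntegral_eq_of_indep {m₁ m₂ mΩ : MeasurableSpace Ω} {Q : Measure Ω}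
    (hind : Indep m₁ m₂ Q) {A : Set Ω} (hA₁ : MeasurableSet[m₁] A) (hA : MeasurableSet A)
    {f : Ω → ℝ≥0∞} (hf₂ : Measurable[m₂] f) (hf : AEMeasurable f Q) :
    ∫⁻ ω in A, f ω ∂Q = Q A * ∫⁻ ω, f ω ∂Q := by
  have hmap : (Q.restrict A).map f = Q A • Q.map f := by
    ext s hs
    rw [Measure.map_apply_of_aemeasurable hf.restrict hs,
      Measure.restrict_apply₀' hA.nullMeasurableSet, Measure.smul_apply,
      Measure.map_apply_of_aemeasurable hf hs, inter_comm, smul_eq_mul]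
    exact (Indep_iff m₁ m₂ Q).1 hind A (f ⁻¹' s) hA₁ (hf₂ hs)
  have h1 := lintegral_map' (μ := Q.restrict A) (g := f) (f := id) aemeasurable_id hf.restrict
  have h2 := lintegral_map' (μ := Q) (g := f) (f := id) aemeasurable_id hf
  simp only [id] at h1 h2
  rw [← h1, hmap, lintegral_smul_measure, h2, smul_eq_mul]

/-- The `L^p` norm of a random variable with values in `[0, ∞]`. -/
def momentNorm (p : ℝ) (Q : Measure Ω) (f : Ω → ℝ≥0∞) : ℝ≥0∞ := (∫⁻ ω, f ω ^ p ∂Q) ^ (1 / p)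

lemma momentNorm_add_le {p : ℝ} (hp : 1 ≤ p) {f g : Ω → ℝ≥0∞} (hf : AEMeasurable f Q)
    (hg : AEMeasurable g Q) :
    momentNorm p Q (fun ω => f ω + g ω) ≤ momentNorm p Q f + momentNorm p Q g :=
  ENNReal.lintegral_Lp_add_le hf hg hp

lemma momentNorm_const_mul {p : ℝ} (hp : 0 < p) {c : ℝ≥0∞} (hc : c ≠ ⊤) (f : Ω → ℝ≥0∞) :
    momentNorm p Q (fun ω => c * f ω) = c * momentNorm p Q f := by
  unfold momentNorm
  simp_rw [ENNReal.mul_rpow_of_nonneg _ _ hp.le]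
  rw [lintegral_const_mul' _ _ (ENNReal.rpow_ne_top_of_nonneg hp.le hc),
    ENNReal.mul_rpow_of_nonneg _ _ (by positivity), ← ENNReal.rpow_mul, mul_one_div_cancel hp.ne',
    ENNReal.rpow_one]

lemma momentNorm_rpow_inv {p : ℝ} (hp : 0 < p) (f : Ω → ℝ≥0∞) :
    momentNorm p Q (fun ω => f ω ^ (1 / p)) = (∫⁻ ω, f ω ∂Q) ^ (1 / p) := by
  unfold momentNorm
  simp_rw [← ENNReal.rpow_mul, one_div_mul_cancel hp.ne', ENNReal.rpow_one]

lemma momentNorm_le_of_le_smul {p : ℝ} (hp : 0 < p) {Q' : Measure Ω} {c : ℝ≥0∞}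
    (h : Q' ≤ c • Q) (f : Ω → ℝ≥0∞) : momentNorm p Q' f ≤ c ^ (1 / p) * momentNorm p Q f := by
  unfold momentNorm
  rw [← ENNReal.mul_rpow_of_nonneg _ _ (by positivity)]
  refine ENNReal.rpow_le_rpow ?_ (by positivity)
  refine (lintegral_mono' h le_rfl).trans (le_of_eq ?_)
  rw [lintegral_smul_measure, smul_eq_mul]

/-- Hölder's inequality on an event, with a non-sharp power of its probability. -/
lemma setLIntegral_le_momentNorm [IsProbabilityMeasure Q] {p : ℝ} (hp : 2 ≤ p) {f : Ω → ℝ≥0∞}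
    (hf : AEMeasurable f Q) {A : Set Ω} (hA : MeasurableSet A) :
    ∫⁻ ω in A, f ω ∂Q ≤ momentNorm p Q f * Q A ^ (1 / 2 : ℝ) := by
  have hpq : p.HolderConjugate (p / (p - 1)) := Real.HolderConjugate.conjExponent (by linarith)
  have h := ENNReal.lintegral_mul_le_Lp_mul_Lq Q hpq hf (g := A.indicator 1)
    (measurable_one.indicator hA).aemeasurable
  have e1 : ∫⁻ ω, (f * A.indicator 1 : Ω → ℝ≥0∞) ω ∂Q = ∫⁻ ω in A, f ω ∂Q := by
    rw [← lintegral_indicator hA]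
    refine lintegral_congr fun ω => ?_
    by_cases hω : ω ∈ A <;> simp [hω]
  have e2 : ∫⁻ ω, (A.indicator 1 ω : ℝ≥0∞) ^ (p / (p - 1)) ∂Q = Q A := by
    rw [← lintegral_indicator_one hA]
    refine lintegral_congr fun ω => ?_
    have : 0 < p / (p - 1) := div_pos (by linarith) (by linarith)
    by_cases hω : ω ∈ A <;> simp [hω, this]
  rw [e1, e2] at h
  refine h.trans ?_
  gcongr ?_ * ?_
  · exact le_rfl
  · refine ENNReal.rpow_le_rpow_of_exponent_ge prob_le_one ?_
    rw [one_div_div, div_le_div_iff₀ (by norm_num) (by linarith)]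
    linarith

end Moments

/-! ### Backward growth of a path along successive trials -/

section PathwiseGrowth

variable {V : Type*} [NormedAddCommGroup V] {γ lam : ℝ}

/-- Concatenation of a stretch of length `D`, controlled forward from its start, and a stretch of
length `L ≥ D`, controlled backward from its end: the first one lies at distance at least `L` from
the end, so that its oscillation is absorbed by the modulus there. -/
lemma enorm_sub_le_of_forward_backward (hγ : 0 ≤ γ) (hlam : 0 ≤ lam) {w : ℝ → V} {τ D L : ℝ}
    {G Z : ℝ≥0∞} (hD : 0 ≤ D) (hDL : D ≤ L)
    (hG : ∀ x, 0 ≤ x → ‖w (τ + x) - w τ‖ₑ ≤ G * ENNReal.ofReal (modulus γ lam x))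
    (hZ : ∀ r, 0 ≤ r → r ≤ L →
      ‖w (τ + D + L) - w (τ + D + L - r)‖ₑ ≤ Z * ENNReal.ofReal (modulus γ lam r))
    {r : ℝ} (hr : 0 ≤ r) (hrT : r ≤ D + L) :
    ‖w (τ + D + L) - w (τ + D + L - r)‖ₑ ≤ (Z + 2 * G) * ENNReal.ofReal (modulus γ lam r) := by
  have mono : ∀ {x y : ℝ}, 0 ≤ x → x ≤ y →
      ENNReal.ofReal (modulus γ lam x) ≤ ENNReal.ofReal (modulus γ lam y) := fun hx hxy =>
    ENNReal.ofReal_le_ofReal (modulus_mono hγ hlam hx hxy)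
  rcases le_or_gt r L with hrL | hrL
  · refine (hZ r hr hrL).trans ?_
    gcongr
    exact le_self_add
  · have h1 := hZ L (by linarith) le_rfl
    rw [show τ + D + L - L = τ + D by ring] at h1
    have h2 := hG D hD
    have h3 := hG (D + L - r) (by linarith)
    rw [show τ + (D + L - r) = τ + D + L - r by ring] at h3
    have m1 := mono (by linarith : 0 ≤ L) hrL.le
    have m2 := mono hD (by linarith : D ≤ r)
    have m3 := mono (by linarith : 0 ≤ D + L - r) (by linarith : D + L - r ≤ r)
    calc ‖w (τ + D + L) - w (τ + D + L - r)‖ₑ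
        = ‖(w (τ + D + L) - w (τ + D)) + (w (τ + D) - w τ) - (w (τ + D + L - r) - w τ)‖ₑ := by
          congr 1; abel
      _ ≤ ‖w (τ + D + L) - w (τ + D)‖ₑ + ‖w (τ + D) - w τ‖ₑ + ‖w (τ + D + L - r) - w τ‖ₑ :=
          (enorm_sub_le).trans (add_le_add_left (enorm_add_le _ _) _)
      _ ≤ Z * ENNReal.ofReal (modulus γ lam r) + G * ENNReal.ofReal (modulus γ lam r) +
          G * ENNReal.ofReal (modulus γ lam r) := by
          gcongr
          · exact h1.trans (by gcongr)
          · exact h2.trans (by gcongr)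
          · exact h3.trans (by gcongr)
      _ = _ := by ring

/-- If each `y i` controls the path backward from `t i` over the `i`-th stretch, the sum of the
`y i` controls the whole past of `t k`. -/
lemma enorm_sub_le_sum (hγ : 0 ≤ γ) (hlam : 0 ≤ lam) {w : ℝ → V} {t : ℕ → ℝ} {y : ℕ → ℝ≥0∞}
    (h0 : ∀ r, 0 ≤ r → ‖w (t 0) - w (t 0 - r)‖ₑ ≤ y 0 * ENNReal.ofReal (modulus γ lam r))
    (k : ℕ) (ht : ∀ i < k, t i ≤ t (i + 1))
    (hy : ∀ i < k, ∀ r, 0 ≤ r → r ≤ t (i + 1) - t i →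
      ‖w (t (i + 1)) - w (t (i + 1) - r)‖ₑ ≤ y (i + 1) * ENNReal.ofReal (modulus γ lam r))
    {r : ℝ} (hr : 0 ≤ r) :
    ‖w (t k) - w (t k - r)‖ₑ ≤
      (∑ i ∈ Finset.range (k + 1), y i) * ENNReal.ofReal (modulus γ lam r) := by
  induction k generalizing r with
  | zero => simpa using h0 r hr
  | succ k ih =>
    rw [Finset.sum_range_succ]
    rcases le_or_gt r (t (k + 1) - t k) with hle | hgt
    · refine (hy k (Nat.lt_succ_self k) r hr hle).trans ?_
      gcongr
      exact le_add_self
    · have h1 := hy k (Nat.lt_succ_self k) _ (sub_nonneg.2 (ht k (Nat.lt_succ_self k))) le_rfl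
      have h2 := ih (fun i hi => ht i (by omega)) (fun i hi => hy i (by omega))
        (r := r - (t (k + 1) - t k)) (by linarith)
      rw [show t k - (r - (t (k + 1) - t k)) = t (k + 1) - r by ring] at h2
      rw [show t (k + 1) - (t (k + 1) - t k) = t k by ring] at h1
      have hk := ht k (Nat.lt_succ_self k)
      have m1 : modulus γ lam (t (k + 1) - t k) ≤ modulus γ lam r :=
        modulus_mono hγ hlam (by linarith) hgt.le
      have m2 : modulus γ lam (r - (t (k + 1) - t k)) ≤ modulus γ lam r :=
        modulus_mono hγ hlam (by linarith) (by linarith)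
      calc _ = ‖(w (t (k + 1)) - w (t k)) + (w (t k) - w (t (k + 1) - r))‖ₑ := by congr 1; abel
        _ ≤ _ := enorm_add_le _ _
        _ ≤ y (k + 1) * ENNReal.ofReal (modulus γ lam r) +
            (∑ i ∈ Finset.range (k + 1), y i) * ENNReal.ofReal (modulus γ lam r) := by
            gcongr
            · exact h1.trans (by gcongr)
            · exact h2.trans (by gcongr)
        _ = _ := by ring

lemma modulus_le_two_mul {lam' : ℝ} (hγ : 0 < γ) (hγlam : γ ≤ lam) (hlam : lam ≤ lam') {r : ℝ}
    (hr : 0 ≤ r) : modulus γ lam r ≤ 2 * modulus γ lam' r := by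
  have hg : 0 ≤ r ^ γ := by positivity
  have hl : 0 ≤ r ^ lam' := by positivity
  rcases hr.eq_or_lt with rfl | h0
  · simp [modulus, Real.zero_rpow hγ.ne', Real.zero_rpow (hγ.trans_le hγlam).ne',
      Real.zero_rpow (hγ.trans_le (hγlam.trans hlam)).ne']
  rcases le_total r 1 with h | h
  · refine (modulus_le_of_le_one hγlam h0 h).trans ?_
    unfold modulus; linarith
  · refine (modulus_le_of_one_le hγlam h).trans ?_
    have := Real.rpow_le_rpow_of_exponent_le h hlam
    unfold modulus; linarith

/-- Raising the growth exponent from `lam` to `lam + e` turns the geometric growth `ς ^ k` of the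
trial lengths into a factor `ς ^ (-e k)` in front of the contributions of the earlier trials. -/
lemma enorm_sub_le_discounted_sum {e ς : ℝ} (hγ : 0 < γ) (hγlam : γ ≤ lam) (he : 0 ≤ e)
    (hς : 1 < ς) {w : ℝ → V} {t : ℕ → ℝ} {y : ℕ → ℝ≥0∞}
    (h0 : ∀ r, 0 ≤ r → ‖w (t 0) - w (t 0 - r)‖ₑ ≤ y 0 * ENNReal.ofReal (modulus γ lam r))
    (k : ℕ) (ht : ∀ i < k, ς ^ (i + 1) ≤ t (i + 1) - t i)
    (hy : ∀ i < k, ∀ r, 0 ≤ r → r ≤ t (i + 1) - t i →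
      ‖w (t (i + 1)) - w (t (i + 1) - r)‖ₑ ≤ y (i + 1) * ENNReal.ofReal (modulus γ lam r))
    {r : ℝ} (hr : 0 ≤ r) :
    ‖w (t k) - w (t k - r)‖ₑ ≤
      2 * (y k + ENNReal.ofReal (ς ^ (-e)) ^ k * ∑ i ∈ Finset.range (k + 1), y i) *
        ENNReal.ofReal (modulus γ (lam + e) r) := by
  have hς0 : 0 < ς := by linarith
  have short : ENNReal.ofReal (modulus γ lam r) ≤ 2 * ENNReal.ofReal (modulus γ (lam + e) r) := by
    have := ENNReal.ofReal_le_ofReal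
      (modulus_le_two_mul (lam' := lam + e) hγ hγlam (by linarith) hr)
    rwa [ENNReal.ofReal_mul (by norm_num), ENNReal.ofReal_ofNat] at this
  have near : ∀ {b : ℝ≥0∞}, b ≤ y k → b * ENNReal.ofReal (modulus γ lam r) ≤
      2 * (y k + ENNReal.ofReal (ς ^ (-e)) ^ k * ∑ i ∈ Finset.range (k + 1), y i) *
        ENNReal.ofReal (modulus γ (lam + e) r) := by
    intro b hb
    calc _ ≤ y k * (2 * ENNReal.ofReal (modulus γ (lam + e) r)) := by gcongr
      _ = 2 * y k * ENNReal.ofReal (modulus γ (lam + e) r) := by ring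
      _ ≤ _ := by gcongr; exact le_self_add
  rcases Nat.eq_zero_or_pos k with rfl | hk
  · exact (h0 r hr).trans (near le_rfl)
  obtain ⟨k, rfl⟩ := Nat.exists_eq_succ_of_ne_zero hk.ne'
  simp only [Nat.succ_eq_add_one] at *
  rcases le_or_gt r (t (k + 1) - t k) with hle | hgt
  · exact (hy k (Nat.lt_succ_self k) r hr hle).trans (near le_rfl)
  · have hlow : ς ^ (k + 1) < r := (ht k (Nat.lt_succ_self k)).trans_lt hgt
    have h1 : 1 ≤ ς ^ (k + 1) := one_le_pow₀ hς.le
    have h1r : 1 ≤ r := h1.trans hlow.le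
    have hr0 : 0 < r := by linarith
    have far : modulus γ lam r ≤ 2 * ((ς ^ (-e)) ^ (k + 1) * modulus γ (lam + e) r) := by
      refine (modulus_le_of_one_le hγlam h1r).trans ?_
      have e1 : r ^ lam = r ^ (-e) * r ^ (lam + e) := by
        rw [← Real.rpow_add hr0]; congr 1; ring
      have e2 : r ^ (-e) ≤ (ς ^ (-e)) ^ (k + 1) := by
        calc r ^ (-e) ≤ (ς ^ (k + 1)) ^ (-e) :=
              Real.rpow_le_rpow_of_nonpos (by positivity) hlow.le (by linarith)
          _ = _ := by
              rw [← Real.rpow_natCast, ← Real.rpow_natCast, ← Real.rpow_mul hς0.le,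
                ← Real.rpow_mul hς0.le, mul_comm]
      have e3 : r ^ (lam + e) ≤ modulus γ (lam + e) r := by
        have : 0 ≤ r ^ γ := by positivity
        unfold modulus; linarith
      rw [e1]
      gcongr
    have far' := ENNReal.ofReal_le_ofReal far
    rw [ENNReal.ofReal_mul (by norm_num), ENNReal.ofReal_mul (by positivity),
      ENNReal.ofReal_pow (by positivity), ENNReal.ofReal_ofNat] at far'
    refine (enorm_sub_le_sum hγ.le (hγ.le.trans hγlam) h0 (k + 1)
      (fun i hi => ?_) hy hr).trans ?_
    · have := ht i hi
      have : 0 < ς ^ (i + 1) := by positivity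
      linarith
    · calc _ ≤ (∑ i ∈ Finset.range (k + 1 + 1), y i) * (2 * (ENNReal.ofReal (ς ^ (-e)) ^ (k + 1) *
            ENNReal.ofReal (modulus γ (lam + e) r))) := by gcongr
        _ = 2 * (ENNReal.ofReal (ς ^ (-e)) ^ (k + 1) * ∑ i ∈ Finset.range (k + 1 + 1), y i) *
            ENNReal.ofReal (modulus γ (lam + e) r) := by ring
        _ ≤ _ := by gcongr; exact le_add_self

end PathwiseGrowth

/-! ### Energies of the noise after a stopping time -/

section Energies

variable {d : ℕ} {Ω : Type*}

lemma IsTwoSidedBrownian.continuous [MeasurableSpace Ω] {W : ℝ → Ω → E d} {P : Measure Ω}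
    (hW : IsTwoSidedBrownian W P) : ∀ᵐ ω ∂P, Continuous fun t => W t ω := by
  filter_upwards [hW.right.continuous, hW.left.continuous] with ω hr hl
  have : (fun t => W t ω) = fun t : ℝ =>
      W (t.toNNReal : ℝ) ω + W (-((-t).toNNReal : ℝ)) ω - W 0 ω := by
    ext1 t
    rcases le_total 0 t with h | h
    · simp [Real.coe_toNNReal t h, Real.toNNReal_of_nonpos (neg_nonpos.2 h)]
    · simp [Real.coe_toNNReal (-t) (neg_nonneg.2 h), Real.toNNReal_of_nonpos h]
  rw [this]
  exact ((hr.comp continuous_real_toNNReal).add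
    (hl.comp (continuous_real_toNNReal.comp continuous_neg))).sub continuous_const

/-- Window energy of the noise after the random time `s`, seen forward from `s`. -/
def forwardEnergy (q : ℕ) (γ lam : ℝ) (W : ℝ → Ω → E d) (s : Ω → WithTop ℝ) (ω : Ω) : ℝ≥0∞ :=
  windowEnergy q γ lam (extendPath fun u => incr W s u ω) fun _ => 0

/-- Window energy of the noise after the random time `s`, seen backward from the time `s + u`. -/
def backwardEnergy (q : ℕ) (γ lam : ℝ) (W : ℝ → Ω → E d) (s : Ω → WithTop ℝ) (u : ℝ) (ω : Ω) :
    ℝ≥0∞ :=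
  windowEnergy q γ lam (extendPath fun u => incr W s u ω) fun n => u - 2 ^ n

variable {q : ℕ} {γ lam : ℝ} {W : ℝ → Ω → E d} {s : Ω → WithTop ℝ} {ω : Ω}

lemma extendPath_incr {τ : ℝ} (hs : s ω = (τ : WithTop ℝ)) {x : ℝ} (hx : 0 ≤ x) :
    extendPath (fun u => incr W s u ω) x = W (τ + x) ω - W τ ω := by
  simp [extendPath, incr, hs, Real.coe_toNNReal x hx]

lemma continuous_extendPath_incr (hW : Continuous fun t => W t ω) :
    Continuous (extendPath fun u => incr W s u ω) := by
  apply continuous_extendPath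
  unfold incr
  exact (hW.comp (by fun_prop)).sub continuous_const

lemma enorm_sub_le_forwardEnergy (hq : q ≠ 0) (hγ : 0 < γ) (hγlam : γ ≤ lam) (hlam : lam ≤ 1)
    (hW : Continuous fun t => W t ω) {τ : ℝ} (hs : s ω = (τ : WithTop ℝ)) {x : ℝ} (hx : 0 ≤ x) :
    ‖W (τ + x) ω - W τ ω‖ₑ ≤ ENNReal.ofReal (chainConst γ lam) *
      forwardEnergy q γ lam W s ω ^ (1 / q : ℝ) * ENNReal.ofReal (modulus γ lam x) := by
  have h := enorm_sub_le_of_windowEnergy hq hγ hγlam hlam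
    (continuous_extendPath_incr (s := s) hW) (a := fun _ => 0) hx
    (fun n hn => ⟨le_rfl, by linarith⟩)
  rw [extendPath_incr hs hx, extendPath_incr hs le_rfl] at h
  simpa [forwardEnergy] using h

lemma enorm_sub_le_backwardEnergy (hq : q ≠ 0) (hγ : 0 < γ) (hγlam : γ ≤ lam) (hlam : lam ≤ 1)
    (hW : Continuous fun t => W t ω) {τ : ℝ} (hs : s ω = (τ : WithTop ℝ)) {u x r : ℝ}
    (hr : 0 ≤ r) (hrx : r ≤ x) (hxu : x ≤ u) (hux : u ≤ x + 1) :
    ‖W (τ + x) ω - W (τ + r) ω‖ₑ ≤ ENNReal.ofReal (chainConst γ lam) *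
      backwardEnergy q γ lam W s u ω ^ (1 / q : ℝ) * ENNReal.ofReal (modulus γ lam (x - r)) := by
  have h := enorm_sub_le_of_windowEnergy hq hγ hγlam hlam
    (continuous_extendPath_incr (s := s) hW) (a := fun n => u - 2 ^ n) hrx
    (fun n hn => ⟨by linarith, by linarith⟩)
  rw [extendPath_incr hs hr, extendPath_incr hs (hr.trans hrx)] at h
  simpa [backwardEnergy] using h

/-- The backward energy from the time `s + u ℓ` on the event `A ℓ`. -/
def mixedEnergy (q : ℕ) (γ lam : ℝ) (W : ℝ → Ω → E d) (s : Ω → WithTop ℝ) (A : ℕ → Set Ω)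
    (u : ℕ → ℝ) (ω : Ω) : ℝ≥0∞ :=
  ∑' ℓ, (A ℓ).indicator (backwardEnergy q γ lam W s (u ℓ)) ω

lemma backwardEnergy_le_mixedEnergy {A : ℕ → Set Ω} {u : ℕ → ℝ} {ℓ : ℕ} (h : ω ∈ A ℓ) :
    backwardEnergy q γ lam W s (u ℓ) ω ≤ mixedEnergy q γ lam W s A u ω := by
  refine le_trans ?_ (ENNReal.le_tsum ℓ)
  rw [indicator_of_mem h]

variable [MeasurableSpace Ω] {P : Measure Ω} {𝓕 : Filtration ℝ ‹MeasurableSpace Ω›}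

lemma lintegral_forwardEnergy_le (h : IsFreshAfter P 𝓕 W s) (hP : P {ω | s ω ≠ ⊤} ≠ 0)
    (hq : q ≠ 0) : AEMeasurable (forwardEnergy q γ lam W s) (P[|{ω | s ω ≠ ⊤}]) ∧
    ∫⁻ ω, forwardEnergy q γ lam W s ω ∂(P[|{ω | s ω ≠ ⊤}]) ≤ energyConst d q γ lam := by
  obtain ⟨hs, h⟩ := h
  exact ⟨(h hP).1.aemeasurable_windowEnergy _ _ _ _, (h hP).1.lintegral_windowEnergy_le hq _ _ _⟩

lemma lintegral_backwardEnergy_le (h : IsFreshAfter P 𝓕 W s) (hP : P {ω | s ω ≠ ⊤} ≠ 0)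
    (hq : q ≠ 0) (u : ℝ) : AEMeasurable (backwardEnergy q γ lam W s u) (P[|{ω | s ω ≠ ⊤}]) ∧
    ∫⁻ ω, backwardEnergy q γ lam W s u ω ∂(P[|{ω | s ω ≠ ⊤}]) ≤ energyConst d q γ lam := by
  obtain ⟨hs, h⟩ := h
  exact ⟨(h hP).1.aemeasurable_windowEnergy _ _ _ _, (h hP).1.lintegral_windowEnergy_le hq _ _ _⟩

/-- A backward energy over a random duration known at the stopping time has the same mean bound
as over a deterministic one, by independence of the noise after `s` and of `𝓕_s`. -/
lemma lintegral_mixedEnergy_le [IsProbabilityMeasure P] (h : IsFreshAfter P 𝓕 W s)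
    (hP : P {ω | s ω ≠ ⊤} ≠ 0) (hq : q ≠ 0) {A : ℕ → Set Ω}
    (hdisj : Pairwise (Function.onFun Disjoint A))
    (hA : ∀ hs : IsStoppingTime 𝓕 s, ∀ ℓ, MeasurableSet[hs.measurableSpace] (A ℓ)) (u : ℕ → ℝ) :
    AEMeasurable (mixedEnergy q γ lam W s A u) (P[|{ω | s ω ≠ ⊤}]) ∧
    ∫⁻ ω, mixedEnergy q γ lam W s A u ω ∂(P[|{ω | s ω ≠ ⊤}]) ≤ energyConst d q γ lam := by
  have hb := lintegral_backwardEnergy_le (γ := γ) (lam := lam) h hP hq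
  obtain ⟨hs, h⟩ := h
  have hAm : ∀ ℓ, MeasurableSet (A ℓ) := fun ℓ => hs.measurableSpace_le _ (hA hs ℓ)
  have := cond_isProbabilityMeasure hP
  refine ⟨AEMeasurable.tsum fun ℓ => (hb (u ℓ)).1.indicator (hAm ℓ), ?_⟩
  unfold mixedEnergy
  rw [lintegral_tsum fun ℓ => (hb (u ℓ)).1.indicator (hAm ℓ)]
  calc _ ≤ ∑' ℓ, P[A ℓ|{ω | s ω ≠ ⊤}] * energyConst d q γ lam := by
        refine ENNReal.tsum_le_tsum fun ℓ => ?_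
        rw [lintegral_indicator (hAm ℓ)]
        have hmeas : @Measurable _ _ (MeasurableSpace.comap
            (fun ω (u : ℝ≥0) => incr W s u ω) MeasurableSpace.pi) _
            (backwardEnergy q γ lam W s (u ℓ)) :=
          (measurable_windowEnergy q γ lam fun n => u ℓ - 2 ^ n).comp (comap_measurable _)
        rw [setLIntegral_eq_of_indep (h hP).2 (hA hs ℓ) (hAm ℓ) hmeas (hb (u ℓ)).1]
        gcongr
        exact (hb (u ℓ)).2
    _ = P[⋃ ℓ, A ℓ|{ω | s ω ≠ ⊤}] * energyConst d q γ lam := by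
        rw [ENNReal.tsum_mul_right, measure_iUnion hdisj hAm]
    _ ≤ _ := mul_le_of_le_one_left (zero_le) prob_le_one

end Energies

/-! ### Durations and failure events of the scheme -/

namespace Params

variable {p : Params}

lemma Valid.one_le_c₂ (h : p.Valid) : 1 ≤ p.c₂ := by
  rw [h.c₂_eq]
  have := h.alpha_pos
  exact Real.one_le_rpow h.one_le_CK (by positivity)

lemma offset_succ {ℓ : ℕ} (hℓ : 1 ≤ ℓ) : p.offset (ℓ + 1) = p.offset ℓ + p.c₂ * 2 ^ ℓ := by
  rw [offset, offset, Finset.sum_Ico_succ_top hℓ]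

lemma offset_succ_eq (ℓ : ℕ) : p.offset (ℓ + 1) = p.c₂ * (2 ^ (ℓ + 1) - 2) := by
  induction ℓ with
  | zero => simp [offset]
  | succ ℓ ih => rw [offset_succ (by omega), ih]; ring

lemma Valid.offset_mono (h : p.Valid) : Monotone p.offset := by
  intro i j hij
  have := h.one_le_c₂
  exact Finset.sum_le_sum_of_subset_of_nonneg (Finset.Ico_subset_Ico_right hij)
    fun _ _ _ => by positivity

lemma Valid.offset_nonneg (h : p.Valid) (ℓ : ℕ) : 0 ≤ p.offset ℓ := by
  simpa [offset] using h.offset_mono (Nat.zero_le ℓ)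

variable {ς : ℝ}

/-- Step 3 lasts at least as long as Steps 1 and 2 of the same trial; this is what
`c₃ ≥ 2 c₂` and `β ≥ 1` are for. -/
lemma Valid.one_add_offset_le_step3 (h : p.Valid) (hς : 1 < ς) (ha : ∀ k, 1 ≤ k → p.a k = ς ^ k)
    (ℓ n : ℕ) : 1 + p.offset (ℓ + 1) ≤ p.step3 ℓ (n + 1) := by
  have hc₂ := h.one_le_c₂
  have hβ := h.one_le_beta
  have h1 : (1 : ℝ) ≤ ς ^ (n + 1) := one_le_pow₀ hς.le
  have h2 : (2 : ℝ) ^ ℓ ≤ 2 ^ (p.β * ℓ) := by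
    rw [← Real.rpow_natCast]
    refine Real.rpow_le_rpow_of_exponent_le (by norm_num) ?_
    exact le_mul_of_one_le_left (by positivity) hβ
  have h3 : (0 : ℝ) < 2 ^ ℓ := by positivity
  have hc₃ := h.c₃_ge
  have hc₃0 : 0 ≤ p.c₃ := by linarith
  rw [offset_succ_eq, step3, ha _ (by omega)]
  calc 1 + p.c₂ * (2 ^ (ℓ + 1) - 2) ≤ 2 * p.c₂ * 1 * 2 ^ ℓ := by rw [pow_succ]; linarith
    _ ≤ p.c₃ * ς ^ (n + 1) * 2 ^ (p.β * ℓ) := by gcongr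

lemma Valid.pow_le_step3 (h : p.Valid) (hς : 1 < ς) (ha : ∀ k, 1 ≤ k → p.a k = ς ^ k)
    (ℓ n : ℕ) : ς ^ (n + 1) ≤ p.step3 ℓ (n + 1) := by
  have hβ := h.one_le_beta
  have h2 : (1 : ℝ) ≤ 2 ^ (p.β * ℓ) := Real.one_le_rpow (by norm_num) (by positivity)
  have hc₃ : 1 ≤ p.c₃ := by linarith [h.c₃_ge, h.one_le_c₂]
  rw [step3, ha _ (by omega)]
  have h1 : (0 : ℝ) < ς ^ (n + 1) := by positivity
  calc ς ^ (n + 1) = 1 * ς ^ (n + 1) * 1 := by ring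
    _ ≤ _ := by gcongr

lemma Valid.bd_eq (h : p.Valid) {ℓ : ℕ} (hℓ : ℓ ≠ 1) : p.bd ℓ = 2 ^ (-(p.α * (ℓ : ℝ))) := by
  have hCK : 0 < p.CK := by linarith [h.one_le_CK]
  have hα := h.alpha_pos
  rw [bd, if_neg hℓ, h.c₂_eq, ← Real.rpow_mul hCK.le, Real.sqrt_eq_rpow, ← Real.rpow_add hCK,
    show 1 / (2 * p.α) * -p.α + 1 / 2 = 0 by field_simp; ring, Real.rpow_zero, one_mul]

end Params

namespace Coupling

section Events

variable {d : ℕ} {Ω : Type*} [MeasurableSpace Ω] {C : Coupling d Ω} {p : Params}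

/-- The event that the trials `1, …, n` fail and that trial `n + 1` fails with index `ℓ`. -/
def failAt (C : Coupling d Ω) (n ℓ : ℕ) : Set Ω := {ω | ω ∈ C.fail n ∧ C.ell (n + 1) ω = ℓ}

lemma fail_zero : C.fail 0 = univ := by
  ext ω
  simp only [fail, mem_ofPred_eq, mem_univ, iff_true]
  intro i h1 h2; omega

lemma fail_anti : Antitone C.fail := fun _ _ hmn _ hω i h1 h2 => hω i h1 (h2.trans hmn)

lemma mem_fail_succ {n : ℕ} {ω : Ω} :
    ω ∈ C.fail (n + 1) ↔ ω ∈ C.fail n ∧ C.ell (n + 1) ω ≠ ⊤ := by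
  constructor
  · exact fun h => ⟨fail_anti (Nat.le_succ n) h, h (n + 1) (by omega) le_rfl⟩
  · rintro ⟨h1, h2⟩ i hi hin
    rcases Nat.le_or_eq_of_le_succ hin with h | rfl
    · exact h1 i hi h
    · exact h2

lemma fail_succ_eq_iUnion (n : ℕ) : C.fail (n + 1) = ⋃ ℓ, C.failAt n ℓ := by
  ext ω
  simp only [mem_iUnion, failAt, mem_ofPred_eq, mem_fail_succ, exists_and_left]
  refine and_congr_right fun _ => ?_
  rw [ENat.ne_top_iff_exists]
  exact exists_congr fun _ => eq_comm

lemma pairwise_disjoint_failAt (n : ℕ) : Pairwise (Function.onFun Disjoint (C.failAt n)) := by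
  intro i j hij
  refine disjoint_left.2 fun ω hi hj => hij ?_
  have := hi.2.symm.trans hj.2
  exact_mod_cast this

lemma tau_of_mem {n : ℕ} {ω : Ω} (h : ω ∈ C.fail n) : C.tau p n ω = (C.time p n ω : ℝ) := by
  simp [tau, h]

lemma step3Time_of_mem {n : ℕ} {ω : Ω} (h : ω ∈ C.fail (n + 1)) :
    C.step3Time p n ω = (C.step3Start p n ω : ℝ) := by simp [step3Time, h]

lemma setOf_tau_ne_top (n : ℕ) : {ω | C.tau p n ω ≠ ⊤} = C.fail n := by
  ext ω; by_cases h : ω ∈ C.fail n <;> simp [tau, h]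

lemma setOf_step3Time_ne_top (n : ℕ) : {ω | C.step3Time p n ω ≠ ⊤} = C.fail (n + 1) := by
  ext ω; by_cases h : ω ∈ C.fail (n + 1) <;> simp [step3Time, h]

lemma attemptTime_ne_top {n ℓ : ℕ} {ω : Ω} :
    C.attemptTime p n ℓ ω ≠ ⊤ ↔ ω ∈ C.fail n ∧ (ℓ : ℕ∞) ≤ C.ell (n + 1) ω := by
  by_cases h : ω ∈ C.fail n ∧ (ℓ : ℕ∞) ≤ C.ell (n + 1) ω <;> simp [attemptTime, h]

lemma measurableSet_ne_top {𝓕 : Filtration ℝ ‹MeasurableSpace Ω›} {s : Ω → WithTop ℝ}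
    (hs : IsStoppingTime 𝓕 s) : MeasurableSet[⨆ t, 𝓕 t] {ω | s ω ≠ ⊤} := by
  have : {ω | s ω ≠ ⊤} = ⋃ k : ℕ, {ω | s ω ≤ ((k : ℝ) : WithTop ℝ)} := by
    ext ω
    simp only [mem_ofPred_eq, mem_iUnion]
    constructor
    · intro h
      obtain ⟨x, hx⟩ := WithTop.ne_top_iff_exists.1 h
      obtain ⟨k, hk⟩ := exists_nat_ge x
      exact ⟨k, by rw [← hx]; exact_mod_cast hk⟩
    · rintro ⟨k, hk⟩ h
      rw [h] at hk
      simp at hk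
  rw [this]
  exact MeasurableSet.iUnion fun k => le_iSup (fun t => 𝓕 t) (k : ℝ) _ (hs k)

variable {P : Measure Ω} {H θ₀ K : ℝ} {b : E d → E d} {σ : E d → E d →L[ℝ] E d} {Ψ : E d → ℝ}
  {ρ₀ : ℝ} {μ : Fin 2 → Measure (E d)}

namespace IsScheme

lemma measurableSet_fail (hC : C.IsScheme p P H θ₀ K b σ Ψ ρ₀ μ) (n : ℕ) :
    MeasurableSet (C.fail n) := by
  obtain ⟨hs, -⟩ := hC.fresh_tau 0 n
  rw [← setOf_tau_ne_top (p := p)]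
  exact (iSup_le C.𝓕.le) _ (measurableSet_ne_top hs)

/-- The failure index of trial `n + 1` is known at the beginning of Step 3. -/
lemma measurableSet_failAt (hC : C.IsScheme p P H θ₀ K b σ Ψ ρ₀ μ) (n ℓ : ℕ)
    (hs : IsStoppingTime C.𝓕 (C.step3Time p n)) :
    MeasurableSet[hs.measurableSpace] (C.failAt n ℓ) := by
  set D : ℕ → Set Ω := fun ℓ => {ω | ω ∈ C.fail n ∧ (ℓ : ℕ∞) ≤ C.ell (n + 1) ω} with hD
  have hDm : ∀ ℓ, MeasurableSet[hs.measurableSpace] (D ℓ) := by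
    intro ℓ
    rcases Nat.eq_zero_or_pos ℓ with rfl | hℓ
    · obtain ⟨ht, -⟩ := hC.fresh_tau 0 n
      have hD0 : D 0 = {ω | C.tau p n ω ≠ ⊤} := by
        rw [setOf_tau_ne_top]; simp [hD]
      refine (hs.measurableSet _).2 ⟨hD0 ▸ measurableSet_ne_top ht, fun t => ?_⟩
      convert hs t using 1
      refine inter_eq_right.2 fun ω hω => ?_
      have : C.step3Time p n ω ≠ ⊤ := fun h => by
        rw [mem_ofPred_eq, h] at hω; simp at hω
      have hmem : ω ∈ C.fail (n + 1) := by rw [← setOf_step3Time_ne_top (p := p)]; exact this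
      exact ⟨(mem_fail_succ.1 hmem).1, by simp⟩
    · obtain ⟨ht, -⟩ := hC.fresh_attempt 0 n ℓ hℓ
      have hDℓ : D ℓ = {ω | C.attemptTime p n ℓ ω ≠ ⊤} := by
        ext ω; exact attemptTime_ne_top.symm
      refine (hs.measurableSet _).2 ⟨hDℓ ▸ measurableSet_ne_top ht, fun t => ?_⟩
      have : D ℓ ∩ {ω | C.step3Time p n ω ≤ (t : WithTop ℝ)} =
          {ω | C.attemptTime p n ℓ ω ≤ (t : WithTop ℝ)} ∩
            {ω | C.step3Time p n ω ≤ (t : WithTop ℝ)} := by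
        ext ω
        simp only [mem_inter_iff, mem_ofPred_eq]
        refine and_congr_left fun hω => ⟨fun h => ?_, fun h => ?_⟩
        · have hne : C.step3Time p n ω ≠ ⊤ := fun h => by rw [h] at hω; simp at hω
          have hmem : ω ∈ C.fail (n + 1) := by rw [← setOf_step3Time_ne_top (p := p)]; exact hne
          rw [step3Time_of_mem hmem] at hω
          have h' : C.attemptTime p n ℓ ω = ((C.time p n ω + 1 + p.offset ℓ : ℝ) : WithTop ℝ) :=
            if_pos h
          rw [h']
          refine le_trans ?_ hω
          rw [WithTop.coe_le_coe, step3Start]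
          have hle : ℓ ≤ (C.ell (n + 1) ω).toNat + 1 := by
            have := ENat.toNat_le_toNat h.2 (mem_fail_succ.1 hmem).2
            simp at this
            omega
          have := hC.valid.offset_mono hle
          linarith
        · exact attemptTime_ne_top.1 fun h' => by rw [h'] at h; simp at h
      rw [this]
      exact (ht t).inter (hs t)
  have : C.failAt n ℓ = D ℓ \ D (ℓ + 1) := by
    ext ω
    simp only [failAt, hD, Set.mem_sdiff, mem_ofPred_eq, not_and]
    constructor
    · rintro ⟨h1, h2⟩
      refine ⟨⟨h1, h2.ge⟩, fun _ h => ?_⟩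
      rw [h2] at h
      have : ℓ + 1 ≤ ℓ := by exact_mod_cast h
      omega
    · rintro ⟨⟨h1, h2⟩, h3⟩
      refine ⟨h1, le_antisymm ?_ h2⟩
      have := h3 h1
      rw [not_le] at this
      push_cast at this
      exact Order.le_of_lt_add_one this
  rw [this]
  exact (hDm ℓ).diff (hDm (ℓ + 1))

end IsScheme

end Events

end Coupling

/-! ### Failure probabilities of the attempts -/

section Attempts

lemma le_measure_of_hasCondDistrib {Ω 𝓧 : Type*} {m𝓧 : MeasurableSpace 𝓧}
    {mΩ : MeasurableSpace Ω} {Q : Measure Ω}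
    [IsProbabilityMeasure Q] {X : Ω → 𝓧} {U : Ω → ℝ × ℝ} {ν : Kernel 𝓧 (ℝ × ℝ)}
    [IsMarkovKernel ν] {a : 𝓧 → ℝ} (ha : Measurable a) (h : HasCondDistrib U X ν Q) {c : ℝ≥0∞}
    (hc : ∀ᵐ ω ∂Q, c ≤ ν (X ω) {u | u.2 = u.1 + a (X ω)}) :
    c ≤ Q {ω | (U ω).2 = (U ω).1 + a (X ω)} := by
  set S : Set (𝓧 × (ℝ × ℝ)) := {z | z.2.2 = z.2.1 + a z.1} with hS
  have hSm : MeasurableSet S := measurableSet_eq_fun (by fun_prop) (by fun_prop)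
  have e1 : Q {ω | (U ω).2 = (U ω).1 + a (X ω)} = (Q.map X ⊗ₘ ν) S :=
    HasLaw.measure_eq (p := fun z => z.2.2 = z.2.1 + a z.1) h hSm
  rw [e1, Measure.compProd_apply hSm,
    lintegral_map' (Kernel.measurable_kernel_prodMk_left hSm).aemeasurable h.aemeasurable_fst]
  calc c = ∫⁻ _, c ∂Q := by simp
    _ ≤ _ := lintegral_mono_ae hc

variable {d : ℕ} {Ω : Type*} [MeasurableSpace Ω] {C : Coupling d Ω} {p : Params}
  {P : Measure Ω} [IsProbabilityMeasure P] {H θ₀ K : ℝ} {b : E d → E d} {σ : E d → E d →L[ℝ] E d}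
  {Ψ : E d → ℝ} {ρ₀ : ℝ} {μ : Fin 2 → Measure (E d)}

/-- An attempt whose Gaussian pair satisfies `U₂ = U₁ + a` is successful. -/
lemma Coupling.IsScheme.cond_attempt_failAt_le (hC : C.IsScheme p P H θ₀ K b σ Ψ ρ₀ μ)
    (n : ℕ) {ℓ : ℕ} (hℓ : 2 ≤ ℓ) (hP : P {ω | C.attemptTime p n ℓ ω ≠ ⊤} ≠ 0) :
    P[C.failAt n ℓ|{ω | C.attemptTime p n ℓ ω ≠ ⊤}] ≤ ENNReal.ofReal (p.bd ℓ) := by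
  have hbd : p.bd ℓ ∈ Icc (0 : ℝ) 1 := by
    rw [hC.valid.bd_eq (by omega)]
    have := hC.valid.alpha_pos
    exact ⟨by positivity, Real.rpow_le_one_of_one_le_of_nonpos (by norm_num)
      (neg_nonpos.2 (by positivity))⟩
  have hQ := cond_isProbabilityMeasure hP
  obtain ⟨hs, hstick⟩ := hC.step2_coupling n ℓ (by omega)
  obtain ⟨a, e, U, R, ν, κ, ha, -, hν, hκ, hae, hlaw⟩ := hstick hP
  have hU := HasCondDistrib.fst (m𝓧 := hs.measurableSpace) hlaw
  rw [Kernel.fst_prod] at hU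
  have hprob := le_measure_of_hasCondDistrib (m𝓧 := hs.measurableSpace) ha hU
    (c := ENNReal.ofReal (1 - p.bd ℓ)) (by
      filter_upwards [hae] with ω hω
      have := hω.2.2.2.2.2.1.lower
      rwa [Params.lowerProb, if_neg (by omega)] at this)
  simp only at hprob
  have hsucc := (cond_absolutelyContinuous (μ := P)
    (s := {ω | C.attemptTime p n ℓ ω ≠ ⊤})).ae_le (hC.step2_success n ℓ (by omega))
  set G := {ω | (U ω).2 = (U ω).1 + a ω} with hG
  have hGm : NullMeasurableSet G (P[|{ω | C.attemptTime p n ℓ ω ≠ ⊤}]) := by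
    have hU' : AEMeasurable U (P[|{ω | C.attemptTime p n ℓ ω ≠ ⊤}]) := hU.aemeasurable_snd
    have ha' : Measurable a := ha.mono hs.measurableSpace_le le_rfl
    exact nullMeasurableSet_eq_fun hU'.snd (hU'.fst.add ha'.aemeasurable)
  have hsub : C.failAt n ℓ ≤ᵐ[P[|{ω | C.attemptTime p n ℓ ω ≠ ⊤}]] Gᶜ := by
    filter_upwards [hae, hsucc] with ω hω hωs hfail hωG
    obtain ⟨h1, h2⟩ : ω ∈ C.failAt n ℓ := hfail
    have hωG' : (U ω).2 = (U ω).1 + a ω := hωG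
    have := (hωs h1 h2.ge).2 fun t ht => by
      obtain ⟨g1, g2⟩ := hω.2.2.2.2.2.2 t ht
      rw [g1, g2, hωG']
      have hint : ∫ u in (0 : ℝ)..t, C.sticking p H n ω (p.offset ℓ + u) =
          ∫ u in (0 : ℝ)..t, a ω • e ω u := by
        refine intervalIntegral.integral_congr_ae ?_
        have hr := (ae_restrict_iff' measurableSet_Icc).1 hω.2.2.2.2.1
        filter_upwards [hr] with u hu hut
        rw [uIoc_of_le (NNReal.coe_nonneg t)] at hut
        exact hu ⟨hut.1.le, hut.2.trans ht⟩
      rw [hint, intervalIntegral.integral_smul]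
      module
    rw [h2] at this
    exact lt_irrefl _ this
  calc _ ≤ P[Gᶜ|{ω | C.attemptTime p n ℓ ω ≠ ⊤}] := measure_mono_ae hsub
    _ = 1 - P[G|{ω | C.attemptTime p n ℓ ω ≠ ⊤}] := prob_compl_eq_one_sub₀ hGm
    _ ≤ 1 - ENNReal.ofReal (1 - p.bd ℓ) := tsub_le_tsub_left hprob _
    _ = ENNReal.ofReal (p.bd ℓ) := by
        rw [← ENNReal.ofReal_one, ← ENNReal.ofReal_sub _ (by linarith [hbd.2])]
        congr 1; ring

lemma Coupling.IsScheme.cond_failAt_le (hC : C.IsScheme p P H θ₀ K b σ Ψ ρ₀ μ) (n ℓ : ℕ)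
    (hpos : P (C.fail n) ≠ 0) :
    P[C.failAt n ℓ|C.fail n] ≤ ENNReal.ofReal (2 * 2 ^ (-(p.α * (ℓ : ℝ)))) := by
  have hα := hC.valid.alpha_pos
  rcases lt_or_ge ℓ 2 with hℓ | hℓ
  · have := cond_isProbabilityMeasure hpos
    refine prob_le_one.trans ?_
    rw [← ENNReal.ofReal_one]
    apply ENNReal.ofReal_le_ofReal
    have h1 : (2 : ℝ) ^ (-1 : ℝ) ≤ 2 ^ (-(p.α * (ℓ : ℝ))) := by
      refine Real.rpow_le_rpow_of_exponent_le (by norm_num) ?_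
      have : (ℓ : ℝ) ≤ 1 := by exact_mod_cast (by omega : ℓ ≤ 1)
      nlinarith [hC.valid.alpha_lt]
    rw [Real.rpow_neg_one] at h1
    linarith
  · have hm := hC.measurableSet_fail n
    obtain ⟨hs, -⟩ := hC.fresh_attempt 0 n ℓ (by omega)
    have hT : MeasurableSet {ω | C.attemptTime p n ℓ ω ≠ ⊤} :=
      (iSup_le C.𝓕.le) _ (measurableSet_ne_top hs)
    have hsub : C.failAt n ℓ ⊆ {ω | C.attemptTime p n ℓ ω ≠ ⊤} := fun ω hω =>
      attemptTime_ne_top.2 ⟨hω.1, hω.2.ge⟩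
    have hsub' : {ω | C.attemptTime p n ℓ ω ≠ ⊤} ⊆ C.fail n := fun ω hω =>
      (attemptTime_ne_top.1 hω).1
    have key : P (C.failAt n ℓ) ≤ P (C.fail n) * ENNReal.ofReal (p.bd ℓ) := by
      by_cases hP : P {ω | C.attemptTime p n ℓ ω ≠ ⊤} = 0
      · rw [measure_mono_null hsub hP]; exact zero_le
      · have h1 := cond_mul_eq_inter hT (C.failAt n ℓ) P
        rw [inter_eq_right.2 hsub] at h1
        rw [← h1, mul_comm]
        exact mul_le_mul' (measure_mono hsub') (hC.cond_attempt_failAt_le n hℓ hP)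
    rw [cond_apply hm, inter_eq_right.2 fun ω hω => hω.1]
    calc _ ≤ (P (C.fail n))⁻¹ * (P (C.fail n) * ENNReal.ofReal (p.bd ℓ)) := by gcongr
      _ = ENNReal.ofReal (p.bd ℓ) := by
          rw [← mul_assoc, ENNReal.inv_mul_cancel hpos (measure_ne_top _ _), one_mul]
      _ ≤ _ := by
          apply ENNReal.ofReal_le_ofReal
          rw [hC.valid.bd_eq (by omega)]
          have : (0 : ℝ) < 2 ^ (-(p.α * (ℓ : ℝ))) := by positivity
          linarith

end Attempts

/-! ### Conditioning on successive failures -/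

section Conditioning

lemma cond_le_smul_cond {Ω : Type*} [MeasurableSpace Ω] {P : Measure Ω} [IsProbabilityMeasure P]
    {A A' : Set Ω} (hA : MeasurableSet A) (hA' : MeasurableSet A') (hsub : A' ⊆ A)
    {δ : ℝ≥0∞} (hδ0 : δ ≠ 0) (hδ : δ ≠ ⊤) (h : δ ≤ P[A'|A]) :
    P[|A'] ≤ δ⁻¹ • P[|A] := by
  rw [cond_apply hA, inter_eq_right.2 hsub] at h
  have h1 : δ * P A ≤ P A' := by
    calc δ * P A ≤ (P A)⁻¹ * P A' * P A := by gcongr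
      _ = ((P A)⁻¹ * P A) * P A' := by ring
      _ ≤ 1 * P A' := by gcongr; exact ENNReal.inv_mul_le_one _
      _ = P A' := one_mul _
  have h2 : (P A')⁻¹ ≤ δ⁻¹ * (P A)⁻¹ := by
    rw [← ENNReal.mul_inv (Or.inl hδ0) (Or.inl hδ)]
    exact ENNReal.inv_le_inv.2 h1
  refine Measure.le_iff'.2 fun s => ?_
  rw [cond_apply hA', Measure.smul_apply, cond_apply hA, smul_eq_mul, ← mul_assoc]
  exact mul_le_mul' h2 (measure_mono (inter_subset_inter_left _ hsub))

/-- Let the measures `Q n` lose at most a factor `c` at each step.  The discounted sums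
`m ^ n * ∑_{i ≤ n} y i` then stay bounded in `L^q (Q n)` as soon as `m * c ^ (1/q) < 1`. -/
lemma momentNorm_discounted_sum_le {Ω : Type*} [MeasurableSpace Ω] {Q : ℕ → Measure Ω}
    {c m η Y Y' : ℝ≥0∞} {q : ℝ} (hq : 1 ≤ q) (hQ : ∀ n, Q (n + 1) ≤ c • Q n)
    (hm : m ≤ 1) (hη : c ^ (1 / q) * m ≤ η) (hY : Y ≤ Y') (hY' : η * Y' + Y ≤ Y')
    {y : ℕ → Ω → ℝ≥0∞} (hy : ∀ n, AEMeasurable (y n) (Q n))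
    (hyY : ∀ n, momentNorm q (Q n) (y n) ≤ Y) (n : ℕ) :
    AEMeasurable (fun ω => m ^ n * ∑ i ∈ Finset.range (n + 1), y i ω) (Q n) ∧
    momentNorm q (Q n) (fun ω => m ^ n * ∑ i ∈ Finset.range (n + 1), y i ω) ≤ Y' := by
  have hmtop : m ≠ ⊤ := (hm.trans_lt ENNReal.one_lt_top).ne
  induction n with
  | zero => simpa using ⟨hy 0, (hyY 0).trans hY⟩
  | succ n ih =>
    obtain ⟨ih1, ih2⟩ := ih
    have hac : Q (n + 1) ≪ Q n :=
      (Measure.absolutelyContinuous_of_le (hQ n)).trans Measure.smul_absolutelyContinuous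
    have e : ∀ ω, m ^ (n + 1) * ∑ i ∈ Finset.range (n + 1 + 1), y i ω =
        m * (m ^ n * ∑ i ∈ Finset.range (n + 1), y i ω) + m ^ (n + 1) * y (n + 1) ω := by
      intro ω; rw [Finset.sum_range_succ, pow_succ]; ring
    have a1 := (ih1.mono_ac hac).const_mul m
    have a2 := (hy (n + 1)).const_mul (m ^ (n + 1))
    simp_rw [e]
    refine ⟨a1.add a2, (momentNorm_add_le hq a1 a2).trans ?_⟩
    have b1 := momentNorm_le_of_le_smul (by linarith) (hQ n)
      (f := fun ω => m ^ n * ∑ i ∈ Finset.range (n + 1), y i ω) (p := q)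
    rw [momentNorm_const_mul (by linarith) hmtop
        (fun ω => m ^ n * ∑ i ∈ Finset.range (n + 1), y i ω),
      momentNorm_const_mul (by linarith) (ENNReal.pow_ne_top hmtop) (y (n + 1))]
    calc _ ≤ m * (c ^ (1 / q) * Y') + 1 * Y :=
          add_le_add (mul_le_mul_right (b1.trans (mul_le_mul_right ih2 _)) _)
            (mul_le_mul' (pow_le_one₀ zero_le hm) (hyY (n + 1)))
      _ = (c ^ (1 / q) * m) * Y' + Y := by ring
      _ ≤ η * Y' + Y := by gcongr
      _ ≤ Y' := hY'

end Conditioning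

/-! ### Growth of the noise seen from the ends of the trials -/

lemma measurable_tauZero {d : ℕ} {Ω : Type*} {m : MeasurableSpace Ω} {Ψ : E d → ℝ}
    (hΨ : Measurable Ψ) {ρ₀ : ℝ} (hρ₀ : ρ₀ ∈ Ioo (0 : ℝ) 1) {x₁ x₂ : Ω → E d}
    (h₁ : Measurable x₁) (h₂ : Measurable x₂) :
    Measurable fun ω => tauZero Ψ ρ₀ (x₁ ω) (x₂ ω) := by
  have hmono : Monotone fun r : ℝ => sInf {u : ℕ | 1 ≤ u ∧ ρ₀ ^ u * r ≤ 1} := by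
    intro r r' hr
    refine Nat.sInf_le ?_
    have hne : {u : ℕ | 1 ≤ u ∧ ρ₀ ^ u * r' ≤ 1}.Nonempty := by
      have h := (tendsto_pow_atTop_nhds_zero_of_lt_one hρ₀.1.le hρ₀.2).mul_const r'
      rw [zero_mul] at h
      obtain ⟨u, hu⟩ := ((h.eventually (ge_mem_nhds zero_lt_one)).and
        (eventually_ge_atTop 1)).exists
      exact ⟨u, hu.2, hu.1⟩
    have hmem := Nat.sInf_mem hne
    refine ⟨hmem.1, le_trans ?_ hmem.2⟩
    have : 0 < ρ₀ := hρ₀.1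
    gcongr
  exact hmono.measurable.comp ((hΨ.comp h₁).add (hΨ.comp h₂))

namespace Coupling

section Growth

variable {d : ℕ} {Ω : Type*} [MeasurableSpace Ω]

/-- A variable controlling the growth of the noise `W j` backward from `τ_n`, over trial `n` if
`n ≥ 1`, and over the whole past if `n = 0`.  Each trial is cut at the beginning of Step 3: the
noise is Brownian after that time, and also after the beginning of the trial, under the law
conditioned on these times being finite. -/
def trialGrowth (C : Coupling d Ω) (p : Params) (q : ℕ) (γ lam : ℝ) (Ψ : E d → ℝ) (ρ₀ : ℝ)
    (j : Fin 2) : ℕ → Ω → ℝ≥0∞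
  | 0, ω => ENNReal.ofReal (chainConst γ lam) *
      (mixedEnergy q γ lam (C.W j) (fun _ => ((0 : ℝ) : WithTop ℝ))
        (fun u => {ω | tauZero Ψ ρ₀ (C.X 0 0 ω) (C.X 1 0 ω) = u}) (fun u => u) ω ^ (1 / q : ℝ) +
      windowEnergy q γ lam (extendPath fun u : ℝ≥0 => C.W j (-(u : ℝ)) ω) (fun _ => 0) ^
        (1 / q : ℝ))
  | n + 1, ω => ENNReal.ofReal (chainConst γ lam) *
      (mixedEnergy q γ lam (C.W j) (C.step3Time p n) (C.failAt n) (fun ℓ => p.step3 ℓ (n + 1)) ω ^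
        (1 / q : ℝ) + 2 * forwardEnergy q γ lam (C.W j) (C.tau p n) ω ^ (1 / q : ℝ))

/-- A variable controlling the growth of the noise backward from `τ_n`, over its whole past. -/
def pastGrowth (C : Coupling d Ω) (p : Params) (q : ℕ) (γ lam e ς : ℝ) (Ψ : E d → ℝ) (ρ₀ : ℝ)
    (j : Fin 2) (n : ℕ) (ω : Ω) : ℝ≥0∞ :=
  2 * (C.trialGrowth p q γ lam Ψ ρ₀ j n ω + ENNReal.ofReal (ς ^ (-e)) ^ n *
    ∑ i ∈ Finset.range (n + 1), C.trialGrowth p q γ lam Ψ ρ₀ j i ω)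

/-- A variable controlling the increments of the noise into the `u`-th unit interval after
`τ_n`. -/
def unitGrowth (C : Coupling d Ω) (p : Params) (q : ℕ) (γ lam e ς : ℝ) (Ψ : E d → ℝ) (ρ₀ : ℝ)
    (j : Fin 2) (n u : ℕ) (ω : Ω) : ℝ≥0∞ :=
  2 * ENNReal.ofReal (chainConst γ lam) *
    backwardEnergy q γ lam (C.W j) (C.tau p n) u ω ^ (1 / q : ℝ) +
    C.pastGrowth p q γ lam e ς Ψ ρ₀ j n ω

variable {C : Coupling d Ω} {p : Params} {P : Measure Ω} {H θ₀ K : ℝ} {b : E d → E d}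
  {σ : E d → E d →L[ℝ] E d} {Ψ : E d → ℝ} {ρ₀ : ℝ} {μ : Fin 2 → Measure (E d)}
  {q : ℕ} {γ lam e ς : ℝ} {j : Fin 2}

lemma time_succ_sub (n : ℕ) (ω : Ω) : C.time p (n + 1) ω - C.time p n ω =
    (1 + p.offset ((C.ell (n + 1) ω).toNat + 1)) + p.step3 (C.ell (n + 1) ω).toNat (n + 1) := by
  rw [time]; ring

lemma step3Start_eq (n : ℕ) (ω : Ω) : C.step3Start p n ω =
    C.time p n ω + (1 + p.offset ((C.ell (n + 1) ω).toNat + 1)) := by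
  rw [step3Start]; ring

lemma pow_le_time_succ_sub (hp : p.Valid) (hς : 1 < ς) (ha : ∀ k, 1 ≤ k → p.a k = ς ^ k)
    (n : ℕ) (ω : Ω) : ς ^ (n + 1) ≤ C.time p (n + 1) ω - C.time p n ω := by
  rw [time_succ_sub]
  have h1 := hp.pow_le_step3 hς ha (C.ell (n + 1) ω).toNat n
  have h2 := hp.offset_nonneg ((C.ell (n + 1) ω).toNat + 1)
  linarith

lemma time_nonneg (hp : p.Valid) (hς : 1 < ς) (ha : ∀ k, 1 ≤ k → p.a k = ς ^ k)
    (n : ℕ) (ω : Ω) : 0 ≤ C.time p n ω := by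
  induction n with
  | zero => simp [time]
  | succ n ih =>
    have := pow_le_time_succ_sub (C := C) hp hς ha n ω
    have : 0 < ς ^ (n + 1) := by positivity
    linarith

lemma enorm_sub_le_trialGrowth_zero (hq : q ≠ 0) (hγ : 0 < γ) (hγlam : γ ≤ lam) (hlam : lam ≤ 1)
    {ω : Ω} (hW : Continuous fun t => C.W j t ω)
    (hτ : C.τ₀ ω = tauZero Ψ ρ₀ (C.X 0 0 ω) (C.X 1 0 ω)) {r : ℝ} (hr : 0 ≤ r) :
    ‖C.W j (C.time p 0 ω) ω - C.W j (C.time p 0 ω - r) ω‖ₑ ≤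
      C.trialGrowth p q γ lam Ψ ρ₀ j 0 ω * ENNReal.ofReal (modulus γ lam r) := by
  set κ := ENNReal.ofReal (chainConst γ lam) with hκ
  set u : ℝ := (C.τ₀ ω : ℝ) with hu
  have hu0 : 0 ≤ u := Nat.cast_nonneg _
  set Z := mixedEnergy q γ lam (C.W j) (fun _ => ((0 : ℝ) : WithTop ℝ))
    (fun u => {ω | tauZero Ψ ρ₀ (C.X 0 0 ω) (C.X 1 0 ω) = u}) (fun u => u) ω ^ (1 / q : ℝ) with hZ
  set G := windowEnergy q γ lam (extendPath fun u : ℝ≥0 => C.W j (-(u : ℝ)) ω) (fun _ => 0) ^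
    (1 / q : ℝ) with hG
  have hmem : ω ∈ {ω | tauZero Ψ ρ₀ (C.X 0 0 ω) (C.X 1 0 ω) = C.τ₀ ω} := hτ.symm
  have right : ∀ x, 0 ≤ x → x ≤ u →
      ‖C.W j u ω - C.W j (u - x) ω‖ₑ ≤ κ * Z * ENNReal.ofReal (modulus γ lam x) := by
    intro x hx hxu
    have h := enorm_sub_le_backwardEnergy (W := C.W j) (ω := ω)
      (s := fun _ => ((0 : ℝ) : WithTop ℝ)) hq hγ hγlam hlam hW rfl (u := u) (x := u) (r := u - x)
      (by linarith) (by linarith) le_rfl (by linarith)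
    rw [zero_add, zero_add, sub_sub_cancel] at h
    refine h.trans ?_
    rw [hZ]
    gcongr
    exact backwardEnergy_le_mixedEnergy (u := fun u => (u : ℝ)) hmem
  have left : ∀ x, 0 ≤ x →
      ‖C.W j 0 ω - C.W j (-x) ω‖ₑ ≤ κ * G * ENNReal.ofReal (modulus γ lam x) := by
    intro x hx
    have hc : Continuous fun u : ℝ≥0 => C.W j (-(u : ℝ)) ω := hW.comp (by fun_prop)
    have h := enorm_sub_le_of_windowEnergy hq hγ hγlam hlam (continuous_extendPath hc)
      (a := fun _ => 0) hx (fun n hn => ⟨le_rfl, by linarith⟩)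
    rw [enorm_sub_rev] at h
    simp only [extendPath, Real.coe_toNNReal x hx, Real.toNNReal_zero, NNReal.coe_zero, neg_zero,
      sub_zero] at h
    exact h
  change ‖C.W j u ω - C.W j (u - r) ω‖ₑ ≤ κ * (Z + G) * ENNReal.ofReal (modulus γ lam r)
  rw [mul_add, add_mul]
  rcases le_or_gt r u with h | h
  · exact (right r hr h).trans le_self_add
  · have h1 := right u hu0 le_rfl
    have h2 := left (r - u) (by linarith)
    rw [sub_self] at h1
    rw [neg_sub] at h2
    have hlam0 : 0 ≤ lam := hγ.le.trans hγlam
    have m1 : modulus γ lam u ≤ modulus γ lam r := modulus_mono hγ.le hlam0 hu0 h.le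
    have m2 : modulus γ lam (r - u) ≤ modulus γ lam r :=
      modulus_mono hγ.le hlam0 (by linarith) (by linarith)
    calc _ = ‖(C.W j u ω - C.W j 0 ω) + (C.W j 0 ω - C.W j (u - r) ω)‖ₑ := by congr 1; abel
      _ ≤ _ := enorm_add_le _ _
      _ ≤ _ := by
        gcongr
        · exact h1.trans (by gcongr)
        · exact h2.trans (by gcongr)

lemma enorm_sub_le_trialGrowth_succ (hp : p.Valid) (hς : 1 < ς)
    (ha : ∀ k, 1 ≤ k → p.a k = ς ^ k) (hq : q ≠ 0) (hγ : 0 < γ) (hγlam : γ ≤ lam)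
    (hlam : lam ≤ 1) {ω : Ω} (hW : Continuous fun t => C.W j t ω) {n : ℕ}
    (hω : ω ∈ C.fail (n + 1)) {r : ℝ} (hr : 0 ≤ r)
    (hrT : r ≤ C.time p (n + 1) ω - C.time p n ω) :
    ‖C.W j (C.time p (n + 1) ω) ω - C.W j (C.time p (n + 1) ω - r) ω‖ₑ ≤
      C.trialGrowth p q γ lam Ψ ρ₀ j (n + 1) ω * ENNReal.ofReal (modulus γ lam r) := by
  set ℓ := (C.ell (n + 1) ω).toNat with hℓ
  have hmem : ω ∈ C.failAt n ℓ :=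
    ⟨(mem_fail_succ.1 hω).1, (ENat.natCast_toNat (mem_fail_succ.1 hω).2).symm⟩
  set D := 1 + p.offset (ℓ + 1) with hD
  set L := p.step3 ℓ (n + 1) with hL
  have hD0 : 0 ≤ D := by have := hp.offset_nonneg (ℓ + 1); linarith
  have hDL : D ≤ L := hp.one_add_offset_le_step3 hς ha ℓ n
  have htime : C.time p (n + 1) ω = C.time p n ω + D + L := by
    have := time_succ_sub (C := C) (p := p) n ω
    rw [← hℓ] at this
    linarith
  have h := enorm_sub_le_of_forward_backward hγ.le (hγ.le.trans hγlam) (w := fun t => C.W j t ω)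
    (τ := C.time p n ω) hD0 hDL
    (fun x hx => enorm_sub_le_forwardEnergy hq hγ hγlam hlam hW
      (tau_of_mem (p := p) (mem_fail_succ.1 hω).1) hx)
    (Z := ENNReal.ofReal (chainConst γ lam) * mixedEnergy q γ lam (C.W j) (C.step3Time p n)
      (C.failAt n) (fun ℓ => p.step3 ℓ (n + 1)) ω ^ (1 / q : ℝ))
    (fun x hx hxL => by
      have h := enorm_sub_le_backwardEnergy hq hγ hγlam hlam hW (step3Time_of_mem (p := p) hω)
        (u := L) (x := L) (r := L - x) (by linarith) (by linarith) le_rfl (by linarith)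
      rw [step3Start_eq, ← hℓ, ← hD, sub_sub_cancel, ← add_sub_assoc] at h
      refine h.trans ?_
      gcongr
      exact backwardEnergy_le_mixedEnergy (u := fun ℓ => p.step3 ℓ (n + 1)) hmem)
    hr (by linarith)
  rw [htime]
  refine h.trans (le_of_eq ?_)
  rw [trialGrowth]
  ring

/-- On `{τ_n < ∞}`, the increments of the noise into the `u`-th unit interval after `τ_n`, from
arbitrarily far in the past, are controlled by `unitGrowth`. -/
lemma enorm_sub_le_unitGrowth (hp : p.Valid) (hς : 1 < ς)
    (ha : ∀ k, 1 ≤ k → p.a k = ς ^ k) (hq : q ≠ 0) (hγ : 0 < γ) (hγlam : γ ≤ lam)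
    (hlam : lam ≤ 1) (he : 0 ≤ e) {ω : Ω} (hW : Continuous fun t => C.W j t ω)
    (hτ : C.τ₀ ω = tauZero Ψ ρ₀ (C.X 0 0 ω) (C.X 1 0 ω)) {n : ℕ}
    (hω : ω ∈ C.fail n) {u : ℕ} (hu : 1 ≤ u) {s r : ℝ} (hs : C.time p n ω + u - 1 ≤ s)
    (hsu : s ≤ C.time p n ω + u) (hrs : r ≤ s) :
    ‖C.W j s ω - C.W j r ω‖ₑ ≤ C.unitGrowth p q γ lam e ς Ψ ρ₀ j n u ω *
      ENNReal.ofReal (modulus γ (lam + e) (s - r)) := by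
  have hu1 : (1 : ℝ) ≤ u := by exact_mod_cast hu
  have hlam0 : 0 ≤ lam + e := by linarith
  set τ := C.time p n ω with hτdef
  have past : ∀ x, 0 ≤ x → ‖C.W j τ ω - C.W j (τ - x) ω‖ₑ ≤
      C.pastGrowth p q γ lam e ς Ψ ρ₀ j n ω * ENNReal.ofReal (modulus γ (lam + e) x) :=
    fun x hx => enorm_sub_le_discounted_sum hγ hγlam he hς (w := fun t => C.W j t ω)
      (t := fun i => C.time p i ω) (y := fun i => C.trialGrowth p q γ lam Ψ ρ₀ j i ω)
      (fun r hr => enorm_sub_le_trialGrowth_zero hq hγ hγlam hlam hW hτ hr) n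
      (fun i _ => pow_le_time_succ_sub hp hς ha i ω)
      (fun i hi r hr hrT => enorm_sub_le_trialGrowth_succ hp hς ha hq hγ hγlam hlam hW
        (fail_anti (by omega : i + 1 ≤ n) hω) hr hrT) hx
  have future : ∀ x y : ℝ, 0 ≤ y → y ≤ x → x ≤ (u : ℝ) → (u : ℝ) ≤ x + 1 →
      ‖C.W j (τ + x) ω - C.W j (τ + y) ω‖ₑ ≤ 2 * ENNReal.ofReal (chainConst γ lam) *
        backwardEnergy q γ lam (C.W j) (C.tau p n) u ω ^ (1 / q : ℝ) *
          ENNReal.ofReal (modulus γ (lam + e) (x - y)) := by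
    intro x y hy hyx hxu hux
    refine (enorm_sub_le_backwardEnergy hq hγ hγlam hlam hW (tau_of_mem (p := p) hω) hy hyx hxu
      hux).trans ?_
    have := ENNReal.ofReal_le_ofReal (modulus_le_two_mul (lam' := lam + e) hγ hγlam
      (by linarith) (sub_nonneg.2 hyx))
    rw [ENNReal.ofReal_mul (by norm_num), ENNReal.ofReal_ofNat] at this
    calc _ ≤ ENNReal.ofReal (chainConst γ lam) *
          backwardEnergy q γ lam (C.W j) (C.tau p n) u ω ^ (1 / q : ℝ) *
          (2 * ENNReal.ofReal (modulus γ (lam + e) (x - y))) := by gcongr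
      _ = _ := by ring
  rw [unitGrowth, add_mul]
  rcases le_or_gt τ r with h | h
  · have := future (s - τ) (r - τ) (by linarith) (by linarith) (by linarith) (by linarith)
    rw [add_sub_cancel, add_sub_cancel, sub_sub_sub_cancel_right] at this
    exact this.trans le_self_add
  · have h1 := future (s - τ) 0 le_rfl (by linarith) (by linarith) (by linarith)
    have h2 := past (τ - r) (by linarith)
    rw [add_sub_cancel, add_zero, sub_zero] at h1
    rw [sub_sub_cancel] at h2
    have m1 : modulus γ (lam + e) (s - τ) ≤ modulus γ (lam + e) (s - r) :=
      modulus_mono hγ.le hlam0 (by linarith) (by linarith)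
    have m2 : modulus γ (lam + e) (τ - r) ≤ modulus γ (lam + e) (s - r) :=
      modulus_mono hγ.le hlam0 (by linarith) (by linarith)
    calc _ = ‖(C.W j s ω - C.W j τ ω) + (C.W j τ ω - C.W j r ω)‖ₑ := by congr 1; abel
      _ ≤ _ := enorm_add_le _ _
      _ ≤ _ := by
        gcongr
        · exact h1.trans (by gcongr)
        · exact h2.trans (by gcongr)

/-! ### Moments under the laws conditioned on failure -/

/-- Bound on the `L^q` norm of the growth over one trial. -/
def growthConst (d q : ℕ) (γ lam : ℝ) (δ : ℝ≥0∞) : ℝ≥0∞ :=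
  ENNReal.ofReal (chainConst γ lam) * (energyConst d q γ lam ^ (1 / q : ℝ) +
    2 * (δ⁻¹ ^ (1 / q : ℝ) * energyConst d q γ lam ^ (1 / q : ℝ)))

variable [IsProbabilityMeasure P] {δ : ℝ≥0∞}

lemma IsScheme.fail_ne_zero (hC : C.IsScheme p P H θ₀ K b σ Ψ ρ₀ μ) (hδ0 : δ ≠ 0)
    (hE : ∀ n, δ ≤ P[C.fail (n + 1)|C.fail n]) (n : ℕ) : P (C.fail n) ≠ 0 := by
  induction n with
  | zero => rw [fail_zero]; simp
  | succ n ih =>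
    intro h
    have := hE n
    rw [cond_apply (hC.measurableSet_fail n), measure_mono_null inter_subset_right h,
      mul_zero] at this
    exact hδ0 (le_antisymm this zero_le)

lemma IsScheme.cond_fail_succ_le (hC : C.IsScheme p P H θ₀ K b σ Ψ ρ₀ μ) (hδ0 : δ ≠ 0)
    (hδ : δ ≠ ⊤) (hE : ∀ n, δ ≤ P[C.fail (n + 1)|C.fail n]) (n : ℕ) :
    P[|C.fail (n + 1)] ≤ δ⁻¹ • P[|C.fail n] :=
  cond_le_smul_cond (hC.measurableSet_fail n) (hC.measurableSet_fail (n + 1))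
    (fail_anti (Nat.le_succ n)) hδ0 hδ (hE n)

lemma IsScheme.momentNorm_trialGrowth_zero_le (hC : C.IsScheme p P H θ₀ K b σ Ψ ρ₀ μ)
    (hΨ : Measurable Ψ) (hρ₀ : ρ₀ ∈ Ioo (0 : ℝ) 1) (hq : q ≠ 0) (hδ1 : δ ≤ 1) :
    AEMeasurable (C.trialGrowth p q γ lam Ψ ρ₀ j 0) P ∧
    momentNorm q P (C.trialGrowth p q γ lam Ψ ρ₀ j 0) ≤ growthConst d q γ lam δ := by
  have hq1 : (1 : ℝ) ≤ q := by exact_mod_cast Nat.one_le_iff_ne_zero.2 hq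
  have huniv : {ω : Ω | (fun _ : Ω => ((0 : ℝ) : WithTop ℝ)) ω ≠ ⊤} = univ := by
    ext ω; simp
  have hZ := lintegral_mixedEnergy_le (γ := γ) (lam := lam) (hC.fresh_zero j)
    (by rw [huniv]; simp) hq
    (A := fun u => {ω | tauZero Ψ ρ₀ (C.X 0 0 ω) (C.X 1 0 ω) = u})
    (fun i k hik => disjoint_left.2 fun ω hi hk => hik (hi.symm.trans hk))
    (fun hs u => by
      have hm : MeasurableSet[C.𝓕 0] {ω | tauZero Ψ ρ₀ (C.X 0 0 ω) (C.X 1 0 ω) = u} :=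
        measurable_tauZero (m := C.𝓕 0) hΨ hρ₀ (hC.adapted_X 0 0 le_rfl)
          (hC.adapted_X 1 0 le_rfl) (measurableSet_singleton u)
      refine (hs.measurableSet _).2 ⟨le_iSup (fun t => C.𝓕 t) 0 _ hm, fun t => ?_⟩
      rcases le_or_gt 0 t with ht | ht
      · exact @MeasurableSet.inter _ (C.𝓕 t) _ _ (C.𝓕.mono ht _ hm) (hs t)
      · have hempty : {ω : Ω | ((0 : ℝ) : WithTop ℝ) ≤ (t : WithTop ℝ)} = ∅ := by
          ext ω
          simp only [mem_ofPred_eq, WithTop.coe_le_coe, mem_empty_iff_false, iff_false, not_le]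
          exact ht
        rw [hempty, inter_empty]
        exact @MeasurableSet.empty _ (C.𝓕 t)) (fun u => (u : ℝ))
  rw [huniv, cond_univ] at hZ
  have hG := (hC.brownian j).left.aemeasurable_windowEnergy q γ lam (fun _ => 0)
  have hG' := (hC.brownian j).left.lintegral_windowEnergy_le hq γ lam (fun _ => 0)
  have a1 := hZ.1.pow_const (1 / q : ℝ)
  have a2 := hG.pow_const (1 / q : ℝ)
  refine ⟨(a1.add a2).const_mul _, ?_⟩
  change momentNorm q P (fun ω => _ * (_ + _)) ≤ _
  rw [momentNorm_const_mul (by linarith) ENNReal.ofReal_ne_top, growthConst]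
  gcongr
  refine (momentNorm_add_le hq1 a1 a2).trans ?_
  rw [momentNorm_rpow_inv (by linarith), momentNorm_rpow_inv (by linarith)]
  gcongr
  · exact hZ.2
  · calc _ ≤ energyConst d q γ lam ^ (1 / q : ℝ) := by gcongr
      _ = 1 * (1 * energyConst d q γ lam ^ (1 / q : ℝ)) := by ring
      _ ≤ _ := by
        gcongr
        · norm_num
        · exact ENNReal.one_le_rpow (ENNReal.one_le_inv.2 hδ1) (by positivity)

lemma IsScheme.momentNorm_trialGrowth_succ_le (hC : C.IsScheme p P H θ₀ K b σ Ψ ρ₀ μ)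
    (hq : q ≠ 0) (hδ0 : δ ≠ 0) (hδ : δ ≠ ⊤) (hE : ∀ n, δ ≤ P[C.fail (n + 1)|C.fail n]) (n : ℕ) :
    AEMeasurable (C.trialGrowth p q γ lam Ψ ρ₀ j (n + 1)) (P[|C.fail (n + 1)]) ∧
    momentNorm q (P[|C.fail (n + 1)]) (C.trialGrowth p q γ lam Ψ ρ₀ j (n + 1)) ≤
      growthConst d q γ lam δ := by
  have hq1 : (1 : ℝ) ≤ q := by exact_mod_cast Nat.one_le_iff_ne_zero.2 hq
  have hQ := hC.cond_fail_succ_le hδ0 hδ hE n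
  have hZ := lintegral_mixedEnergy_le (γ := γ) (lam := lam) (hC.fresh_step3 j n)
    (by rw [setOf_step3Time_ne_top]; exact hC.fail_ne_zero hδ0 hE (n + 1)) hq
    (pairwise_disjoint_failAt n) (fun hs ℓ => hC.measurableSet_failAt n ℓ hs)
    (fun ℓ => p.step3 ℓ (n + 1))
  rw [setOf_step3Time_ne_top] at hZ
  have hG := lintegral_forwardEnergy_le (γ := γ) (lam := lam) (hC.fresh_tau j n)
    (by rw [setOf_tau_ne_top]; exact hC.fail_ne_zero hδ0 hE n) hq
  rw [setOf_tau_ne_top] at hG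
  have hac : P[|C.fail (n + 1)] ≪ P[|C.fail n] :=
    (Measure.absolutelyContinuous_of_le hQ).trans Measure.smul_absolutelyContinuous
  have a1 := hZ.1.pow_const (1 / q : ℝ)
  have a2 := ((hG.1.mono_ac hac).pow_const (1 / q : ℝ)).const_mul 2
  refine ⟨(a1.add a2).const_mul _, ?_⟩
  change momentNorm q _ (fun ω => _ * (_ + _)) ≤ _
  rw [momentNorm_const_mul (by linarith) ENNReal.ofReal_ne_top, growthConst]
  gcongr
  refine (momentNorm_add_le hq1 a1 a2).trans ?_
  rw [momentNorm_rpow_inv (by linarith), momentNorm_const_mul (by linarith) (by simp)]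
  gcongr
  · exact hZ.2
  · refine (momentNorm_le_of_le_smul (by linarith) hQ _).trans ?_
    rw [momentNorm_rpow_inv (by linarith)]
    gcongr
    exact hG.2

lemma IsScheme.momentNorm_unitGrowth_le (hC : C.IsScheme p P H θ₀ K b σ Ψ ρ₀ μ)
    (hΨ : Measurable Ψ) (hρ₀ : ρ₀ ∈ Ioo (0 : ℝ) 1) (hq : q ≠ 0) (hδ0 : δ ≠ 0) (hδ1 : δ ≤ 1)
    (hE : ∀ n, δ ≤ P[C.fail (n + 1)|C.fail n]) (hς : 1 < ς) (he : 0 ≤ e) {η Y' : ℝ≥0∞}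
    (hη : δ⁻¹ ^ (1 / q : ℝ) * ENNReal.ofReal (ς ^ (-e)) ≤ η)
    (hY : growthConst d q γ lam δ ≤ Y') (hY' : η * Y' + growthConst d q γ lam δ ≤ Y')
    (n u : ℕ) :
    AEMeasurable (C.unitGrowth p q γ lam e ς Ψ ρ₀ j n u) (P[|C.fail n]) ∧
    momentNorm q (P[|C.fail n]) (C.unitGrowth p q γ lam e ς Ψ ρ₀ j n u) ≤ 6 * Y' := by
  have hq1 : (1 : ℝ) ≤ q := by exact_mod_cast Nat.one_le_iff_ne_zero.2 hq
  have hδ : δ ≠ ⊤ := (hδ1.trans_lt ENNReal.one_lt_top).ne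
  have hy : ∀ n, AEMeasurable (C.trialGrowth p q γ lam Ψ ρ₀ j n) (P[|C.fail n]) ∧
      momentNorm q (P[|C.fail n]) (C.trialGrowth p q γ lam Ψ ρ₀ j n) ≤
        growthConst d q γ lam δ := by
    rintro (_ | n)
    · rw [fail_zero, cond_univ]
      exact hC.momentNorm_trialGrowth_zero_le hΨ hρ₀ hq hδ1
    · exact hC.momentNorm_trialGrowth_succ_le hq hδ0 hδ hE n
  have hm : ENNReal.ofReal (ς ^ (-e)) ≤ 1 := by
    rw [← ENNReal.ofReal_one]
    exact ENNReal.ofReal_le_ofReal (Real.rpow_le_one_of_one_le_of_nonpos hς.le (by linarith))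
  obtain ⟨s1, s2⟩ := momentNorm_discounted_sum_le hq1 (hC.cond_fail_succ_le hδ0 hδ hE) hm hη hY hY'
    (fun n => (hy n).1) (fun n => (hy n).2) n
  have hB := lintegral_backwardEnergy_le (γ := γ) (lam := lam) (hC.fresh_tau j n)
    (by rw [setOf_tau_ne_top]; exact hC.fail_ne_zero hδ0 hE n) hq u
  rw [setOf_tau_ne_top] at hB
  have a1 := (hB.1.pow_const (1 / q : ℝ)).const_mul (2 * ENNReal.ofReal (chainConst γ lam))
  have a2 := ((hy n).1.add s1).const_mul 2
  refine ⟨a1.add a2, (momentNorm_add_le hq1 a1 a2).trans ?_⟩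
  rw [momentNorm_const_mul (by linarith) (ENNReal.mul_ne_top (by simp) ENNReal.ofReal_ne_top),
    momentNorm_rpow_inv (by linarith)]
  have b1 : 2 * ENNReal.ofReal (chainConst γ lam) *
      (∫⁻ ω, backwardEnergy q γ lam (C.W j) (C.tau p n) u ω ∂P[|C.fail n]) ^ (1 / (q : ℝ)) ≤
      2 * Y' := by
    rw [mul_assoc]
    gcongr
    refine le_trans ?_ hY
    rw [growthConst]
    gcongr
    refine le_trans ?_ le_self_add
    gcongr
    exact hB.2
  have b2 : momentNorm q (P[|C.fail n]) (fun ω => 2 * ((C.trialGrowth p q γ lam Ψ ρ₀ j n ω) +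
      ENNReal.ofReal (ς ^ (-e)) ^ n *
        ∑ i ∈ Finset.range (n + 1), C.trialGrowth p q γ lam Ψ ρ₀ j i ω)) ≤ 2 * (Y' + Y') := by
    rw [momentNorm_const_mul (by linarith) (by simp)]
    gcongr
    exact (momentNorm_add_le hq1 (hy n).1 s1).trans (add_le_add ((hy n).2.trans hY) s2)
  calc _ ≤ 2 * Y' + 2 * (Y' + Y') := add_le_add b1 b2
    _ = 6 * Y' := by ring

/-! ### The discounted norm -/

lemma sum_rpow_sub_le {ρ D : ℝ} (hρ : ρ ∈ Ioo (0 : ℝ) 1) (hD : 0 ≤ D) :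
    ∑ u ∈ Finset.Icc 1 ⌊D⌋₊, ENNReal.ofReal (ρ ^ (D - (u : ℝ))) ≤ ENNReal.ofReal (1 - ρ)⁻¹ := by
  have hρ0 := hρ.1
  rw [← ENNReal.ofReal_sum_of_nonneg fun _ _ => by positivity]
  apply ENNReal.ofReal_le_ofReal
  calc ∑ u ∈ Finset.Icc 1 ⌊D⌋₊, ρ ^ (D - (u : ℝ)) ≤ ∑ u ∈ Finset.Icc 1 ⌊D⌋₊, ρ ^ (⌊D⌋₊ - u) := by
        refine Finset.sum_le_sum fun u hu => ?_
        have hu' := (Finset.mem_Icc.1 hu).2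
        rw [← Real.rpow_natCast, Nat.cast_sub hu']
        refine Real.rpow_le_rpow_of_exponent_ge hρ0 hρ.2.le ?_
        have := Nat.floor_le hD
        linarith
    _ ≤ ∑ u ∈ Finset.range (⌊D⌋₊ + 1), ρ ^ (⌊D⌋₊ - u) := by
        refine Finset.sum_le_sum_of_subset_of_nonneg (fun u hu => ?_) fun _ _ _ => by positivity
        have := (Finset.mem_Icc.1 hu).2
        exact Finset.mem_range.2 (by omega)
    _ = ∑ u ∈ Finset.range (⌊D⌋₊ + 1), ρ ^ u := Finset.sum_flip fun u => ρ ^ u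
    _ ≤ ∑' u : ℕ, ρ ^ u := Summable.sum_le_tsum _ (fun _ _ => by positivity)
        (summable_geometric_of_lt_one hρ0.le hρ.2)
    _ = _ := tsum_geometric_of_lt_one hρ0.le hρ.2

/-- The bound for a given coupling.  Given `{τ_n < ∞}`, the failure index `ℓ` of trial `n + 1` has
probability at most `2 * 2 ^ (-α ℓ)`, and on this event the duration of the trial is
deterministic, so that the discounted sum is a sum with deterministic weights of variables
bounded in `L^q`. -/
theorem IsScheme.lintegral_discountedNorm_le (hC : C.IsScheme p P H θ₀ K b σ Ψ ρ₀ μ)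
    (hΨ : Measurable Ψ) (hρ₀ : ρ₀ ∈ Ioo (0 : ℝ) 1) (hς : 1 < ς)
    (ha : ∀ k, 1 ≤ k → p.a k = ς ^ k) (hδ0 : δ ≠ 0) (hδ1 : δ ≤ 1)
    (hE : ∀ n, δ ≤ P[C.fail (n + 1)|C.fail n]) (hq : 2 ≤ q) (hγ : 0 < γ) (hγlam : γ ≤ lam)
    (hlam : lam ≤ 1) (he : 0 ≤ e) {η Y' A : ℝ≥0∞}
    (hη : δ⁻¹ ^ (1 / q : ℝ) * ENNReal.ofReal (ς ^ (-e)) ≤ η)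
    (hY : growthConst d q γ lam δ ≤ Y') (hY' : η * Y' + growthConst d q γ lam δ ≤ Y')
    {θ ρ : ℝ} (hρ : ρ ∈ Ioo (0 : ℝ) 1)
    (hA : ∀ {w B : ℝ → E d} {a : ℝ} {N : ℝ≥0∞}, 0 ≤ a →
      (∀ s ∈ Icc a (a + 1), ∀ r ≤ s,
        ‖w s - w r‖ₑ ≤ N * ENNReal.ofReal (modulus γ (lam + e) (s - r))) →
      (∀ t, ∃ I, HasImproperRS
        (fun r => (max (t - r) 0) ^ (H - 1 / 2) - (max (-r) 0) ^ (H - 1 / 2)) w (max t 0) I ∧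
        B t = alphaH H • I) → holder θ B a (a + 1) ≤ A * N) (n : ℕ) :
    ∫⁻ ω, C.discountedNorm p ρ θ j n ω ∂(P[|C.fail (n + 1)]) ≤
      δ⁻¹ * (ENNReal.ofReal (1 - ρ)⁻¹ * A * (6 * Y') * 2 * geomSeries (-p.α / 2)) := by
  have hq0 : q ≠ 0 := by omega
  have hδ : δ ≠ ⊤ := (hδ1.trans_lt ENNReal.one_lt_top).ne
  have hpos := hC.fail_ne_zero hδ0 hE n
  have := cond_isProbabilityMeasure hpos
  have hAm : ∀ ℓ, MeasurableSet (C.failAt n ℓ) := fun ℓ => by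
    obtain ⟨hs, -⟩ := hC.fresh_step3 0 n
    exact hs.measurableSpace_le _ (hC.measurableSet_failAt n ℓ hs)
  have hN := hC.momentNorm_unitGrowth_le (j := j) hΨ hρ₀ hq0 hδ0 hδ1 hE hς he hη hY hY' n
  set N := C.unitGrowth p q γ lam e ς Ψ ρ₀ j n with hNdef
  have hpath : ∀ᵐ ω ∂P, ω ∈ C.fail n → ∀ u : ℕ, 1 ≤ u →
      holder θ (fun t => C.B j t ω) (C.time p n ω + u - 1) (C.time p n ω + u) ≤ A * N u ω := by
    filter_upwards [(hC.brownian j).continuous, hC.tau_zero, hC.fractional j]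
      with ω hW hτ hB hω u hu
    have hu1 : (1 : ℝ) ≤ u := by exact_mod_cast hu
    have ht := time_nonneg (C := C) hC.valid hς ha n ω
    have := hA (w := fun t => C.W j t ω) (B := fun t => C.B j t ω) (a := C.time p n ω + u - 1)
      (N := N u ω) (by linarith) (fun s hs r hr => enorm_sub_le_unitGrowth hC.valid hς ha hq0 hγ
        hγlam hlam he hW hτ hω hu hs.1 (by linarith [hs.2]) hr) hB
    rwa [sub_add_cancel] at this
  set D : ℕ → ℝ := fun ℓ => (1 + p.offset (ℓ + 1)) + p.step3 ℓ (n + 1) with hD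
  have hD0 : ∀ ℓ, 0 ≤ D ℓ := fun ℓ => by
    have h1 := hC.valid.offset_nonneg (ℓ + 1)
    have h2 := hC.valid.one_add_offset_le_step3 hς ha ℓ n
    simp only [hD]; linarith
  have hterm : ∀ ℓ, ∫⁻ ω in C.failAt n ℓ, C.discountedNorm p ρ θ j n ω ∂(P[|C.fail n]) ≤
      ENNReal.ofReal (1 - ρ)⁻¹ * A * (6 * Y') * 2 *
        ENNReal.ofReal (2 ^ (-p.α / 2 * (ℓ : ℝ))) := by
    intro ℓ
    have hprob : P[C.failAt n ℓ|C.fail n] ^ (1 / 2 : ℝ) ≤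
        2 * ENNReal.ofReal (2 ^ (-p.α / 2 * (ℓ : ℝ))) := by
      refine (ENNReal.rpow_le_rpow (hC.cond_failAt_le n ℓ hpos) (by norm_num)).trans ?_
      rw [ENNReal.ofReal_rpow_of_nonneg (by positivity) (by norm_num),
        Real.mul_rpow (by norm_num) (by positivity), ← Real.rpow_mul (by norm_num),
        ENNReal.ofReal_mul (by positivity),
        show -(p.α * (ℓ : ℝ)) * (1 / 2) = -p.α / 2 * ℓ by ring]
      gcongr
      rw [← ENNReal.ofReal_ofNat]
      apply ENNReal.ofReal_le_ofReal
      simpa using Real.rpow_le_rpow_of_exponent_le (x := (2 : ℝ)) (by norm_num)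
        (by norm_num : (1 / 2 : ℝ) ≤ 1)
    calc _ ≤ ∫⁻ ω in C.failAt n ℓ, ∑ u ∈ Finset.Icc 1 ⌊D ℓ⌋₊,
          ENNReal.ofReal (ρ ^ (D ℓ - (u : ℝ))) * A * N u ω ∂(P[|C.fail n]) := by
          refine setLIntegral_mono_ae' (hAm ℓ) ?_
          filter_upwards [cond_absolutelyContinuous.ae_le hpath] with ω hω hmem
          have htoNat : (C.ell (n + 1) ω).toNat = ℓ := by rw [hmem.2]; simp
          have hdur : C.time p (n + 1) ω - C.time p n ω = D ℓ := by
            rw [time_succ_sub, htoNat]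
          rw [discountedNorm, hdur]
          refine Finset.sum_le_sum fun u hu => ?_
          rw [mul_assoc]
          gcongr
          exact hω hmem.1 u (Finset.mem_Icc.1 hu).1
      _ = ∑ u ∈ Finset.Icc 1 ⌊D ℓ⌋₊, ∫⁻ ω in C.failAt n ℓ,
          ENNReal.ofReal (ρ ^ (D ℓ - (u : ℝ))) * A * N u ω ∂(P[|C.fail n]) :=
          lintegral_finsetSum' _ fun u _ => ((hN u).1.restrict).const_mul _
      _ ≤ ∑ u ∈ Finset.Icc 1 ⌊D ℓ⌋₊, ENNReal.ofReal (ρ ^ (D ℓ - (u : ℝ))) * A * (6 * Y' *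
          (2 * ENNReal.ofReal (2 ^ (-p.α / 2 * (ℓ : ℝ))))) := by
          refine Finset.sum_le_sum fun u _ => ?_
          rw [lintegral_const_mul'' _ (hN u).1.restrict]
          gcongr
          refine (setLIntegral_le_momentNorm (p := q) (by exact_mod_cast hq) (hN u).1
            (hAm ℓ)).trans ?_
          gcongr
          exact (hN u).2
      _ = (∑ u ∈ Finset.Icc 1 ⌊D ℓ⌋₊, ENNReal.ofReal (ρ ^ (D ℓ - (u : ℝ)))) * (A * (6 * Y' *
          (2 * ENNReal.ofReal (2 ^ (-p.α / 2 * (ℓ : ℝ)))))) := by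
          rw [Finset.sum_mul]
          exact Finset.sum_congr rfl fun _ _ => by ring
      _ ≤ ENNReal.ofReal (1 - ρ)⁻¹ * (A * (6 * Y' *
          (2 * ENNReal.ofReal (2 ^ (-p.α / 2 * (ℓ : ℝ)))))) := by
          gcongr
          exact sum_rpow_sub_le hρ (hD0 ℓ)
      _ = _ := by ring
  have hrestrict : (P[|C.fail (n + 1)]).restrict (⋃ ℓ, C.failAt n ℓ) = P[|C.fail (n + 1)] := by
    rw [← fail_succ_eq_iUnion, ProbabilityTheory.cond, Measure.restrict_smul,
      Measure.restrict_restrict (hC.measurableSet_fail (n + 1)), inter_self]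
  calc ∫⁻ ω, C.discountedNorm p ρ θ j n ω ∂(P[|C.fail (n + 1)])
      = ∑' ℓ, ∫⁻ ω in C.failAt n ℓ, C.discountedNorm p ρ θ j n ω ∂(P[|C.fail (n + 1)]) := by
        conv_lhs => rw [← hrestrict]
        exact lintegral_iUnion hAm (pairwise_disjoint_failAt n) _
    _ ≤ ∑' ℓ, δ⁻¹ * ∫⁻ ω in C.failAt n ℓ, C.discountedNorm p ρ θ j n ω ∂(P[|C.fail n]) := by
        refine ENNReal.tsum_le_tsum fun ℓ => ?_
        rw [← smul_eq_mul, ← lintegral_smul_measure, ← Measure.restrict_smul]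
        exact lintegral_mono' (Measure.restrict_mono_measure
          (hC.cond_fail_succ_le hδ0 hδ hE n) _) le_rfl
    _ ≤ ∑' ℓ : ℕ, δ⁻¹ * (ENNReal.ofReal (1 - ρ)⁻¹ * A * (6 * Y') * 2 *
          ENNReal.ofReal (2 ^ (-p.α / 2 * (ℓ : ℝ)))) := by
        gcongr with ℓ
        exact hterm ℓ
    _ = _ := by rw [ENNReal.tsum_mul_left, ENNReal.tsum_mul_left, geomSeries]

end Growth

end Coupling

/-! ### Choice of the exponents -/

/-- For large moments `q`, the chaining functionals of exponent `γ < 1 / 2` are integrable, and the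
price `δ⁻¹ ^ (1 / q)` of conditioning on one more failure is less than the gain `ς ^ e` due to the
growth of the trials. -/
lemma exists_moment {γ e ς δ : ℝ} (hγ : γ < 1 / 2) (he : 0 < e) (hς : 1 < ς) (hδ : 0 < δ) :
    ∃ q : ℕ, 2 ≤ q ∧ γ * q + 1 < q / 2 ∧
      (ENNReal.ofReal δ)⁻¹ ^ (1 / q : ℝ) * ENNReal.ofReal (ς ^ (-e)) ≤
        ENNReal.ofReal (ς ^ (-(e / 2))) := by
  have hς0 : 0 < ς := by linarith
  have h1 : Tendsto (fun q : ℕ => δ⁻¹ ^ (1 / q : ℝ)) atTop (𝓝 1) := by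
    have : Tendsto (fun q : ℕ => δ⁻¹ ^ (1 / q : ℝ)) atTop (𝓝 (δ⁻¹ ^ (0 : ℝ))) :=
      (tendsto_const_nhds (x := δ⁻¹)).rpow tendsto_one_div_atTop_nhds_zero_nat
        (Or.inl (inv_pos.2 hδ).ne')
    simpa using this
  have h2 := h1.eventually_le_const (Real.one_lt_rpow hς (half_pos he))
  have h3 : ∀ᶠ q : ℕ in atTop, 1 / (1 / 2 - γ) < (q : ℝ) :=
    tendsto_natCast_atTop_atTop.eventually_gt_atTop _
  obtain ⟨q, h2, h3, hq⟩ := (h2.and (h3.and (eventually_ge_atTop 2))).exists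
  refine ⟨q, hq, ?_, ?_⟩
  · rw [div_lt_iff₀ (by linarith)] at h3
    linarith
  · rw [← ENNReal.ofReal_inv_of_pos hδ, ENNReal.ofReal_rpow_of_pos (inv_pos.2 hδ),
      ← ENNReal.ofReal_mul (by positivity)]
    apply ENNReal.ofReal_le_ofReal
    calc _ ≤ ς ^ (e / 2) * ς ^ (-e) := by gcongr
      _ = ς ^ (-(e / 2)) := by rw [← Real.rpow_add hς0]; congr 1; ring

lemma exists_invariant_bound {η Y : ℝ≥0∞} (hη : η < 1) (hY : Y ≠ ⊤) :
    ∃ Y' : ℝ≥0∞, Y' ≠ ⊤ ∧ Y ≤ Y' ∧ η * Y' + Y ≤ Y' := by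
  have h0 : 1 - η ≠ 0 := (tsub_pos_of_lt hη).ne'
  have key : η * (Y * (1 - η)⁻¹) + Y = Y * (1 - η)⁻¹ := by
    calc η * (Y * (1 - η)⁻¹) + Y = η * (Y * (1 - η)⁻¹) + Y * ((1 - η) * (1 - η)⁻¹) := by
          rw [ENNReal.mul_inv_cancel h0 (ENNReal.sub_ne_top ENNReal.one_ne_top), mul_one]
      _ = (η + (1 - η)) * (Y * (1 - η)⁻¹) := by ring
      _ = _ := by rw [add_tsub_cancel_of_le hη.le, one_mul]
  exact ⟨Y * (1 - η)⁻¹, ENNReal.mul_ne_top hY (ENNReal.inv_ne_top.2 h0),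
    le_add_self.trans key.le, key.le⟩

lemma Coupling.growthConst_ne_top {d q : ℕ} (hq : q ≠ 0) {γ lam : ℝ} (hγ : γ * q + 1 < q / 2)
    (hlam : 1 / 2 < lam) {δ : ℝ≥0∞} (hδ : δ ≠ 0) :
    growthConst d q γ lam δ ≠ ⊤ := by
  have hE := energyConst_ne_top (d := d) hq hγ hlam
  have h1 : energyConst d q γ lam ^ (1 / q : ℝ) ≠ ⊤ :=
    ENNReal.rpow_ne_top_of_nonneg (by positivity) hE
  have h2 : δ⁻¹ ^ (1 / q : ℝ) ≠ ⊤ :=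
    ENNReal.rpow_ne_top_of_nonneg (by positivity) (ENNReal.inv_ne_top.2 hδ)
  exact ENNReal.mul_ne_top ENNReal.ofReal_ne_top (ENNReal.add_ne_top.2
    ⟨h1, ENNReal.mul_ne_top ENNReal.ofNat_ne_top (ENNReal.mul_ne_top h2 h1)⟩)

end FracCoupling

end

open FracCoupling in
theorem proposition4p9 {d : ℕ} {H θ₀ : ℝ} (hH : H ∈ Set.Ioo (1 / 2 : ℝ) 1)
    (hθ₀ : θ₀ ∈ Set.Ioo (1 / 2 : ℝ) H)
    (b : E d → E d) (hb : Continuous b) (σ : E d → E d →L[ℝ] E d) (hσ : Continuous σ)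
    (Ψ : E d → ℝ) (hΨm : Measurable Ψ) (hΨpos : ∀ x, 0 < Ψ x)
    (μ : Fin 2 → Measure (E d)) (hΨint : ∀ j, Integrable Ψ (μ j))
    {ρ₀ : ℝ} (hρ₀ : ρ₀ ∈ Set.Ioo (0 : ℝ) 1)
    {α β ς : ℝ} (hς : 1 < ς)
    {Ω : ℝ → Type*} [∀ K, MeasurableSpace (Ω K)]
    (P : ∀ K, Measure (Ω K)) [∀ K, IsProbabilityMeasure (P K)]
    (C : ∀ K, Coupling d (Ω K)) (p : ℝ → Params)
    (hα : ∀ K, (p K).α = α) (hβ : ∀ K, (p K).β = β)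
    (ha : ∀ K, ∀ k, 1 ≤ k → (p K).a k = ς ^ k)
    (hC : ∀ K, 0 < K → (C K).IsScheme (p K) (P K) H θ₀ K b σ Ψ ρ₀ μ)
    {δ₁ : ℝ} (hδ₁ : δ₁ ∈ Set.Ioo (0 : ℝ) 1)
    (hE : ∀ K, 0 < K → ∀ m, 1 ≤ m →
      ENNReal.ofReal δ₁ ≤ (P K)[(C K).fail m | (C K).fail (m - 1)]) :
    ∀ θ ∈ Set.Ioo (1 / 2 : ℝ) H, ∀ ρ ∈ Set.Ioo (0 : ℝ) 1, ∃ Cρ : ℝ, 0 < Cρ ∧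
      ∀ k, 1 ≤ k → ∀ K, 0 < K → ∀ j : Fin 2,
        ∫⁻ ω, (C K).discountedNorm (p K) ρ θ j (k - 1) ω ∂((P K)[|(C K).fail k])
          ≤ ENNReal.ofReal Cρ := by
  intro θ hθ ρ hρ
  obtain ⟨hH0, hH1⟩ := hH
  obtain ⟨hθ0, hθ1⟩ := hθ
  -- `γ + (H - 1 / 2)` lies halfway between `θ` and `H`, and `1 / 2 + 2 * e`, the growth exponent of
  -- the noise seen from any `τ_n`, is less than `1 - (H - 1 / 2)`.
  set γ : ℝ := 1 / 2 - (H - θ) / 2 with hγ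
  set e : ℝ := (1 - H) / 4 with he
  set e' : ℝ := min (γ + (H - 1 / 2) - θ) (1 - (1 / 2 + e + e) - (H - 1 / 2)) with he'
  have he0 : 0 < e := by linarith
  have hγ0 : 0 < γ := by linarith
  have hγlam : γ ≤ 1 / 2 + e := by linarith
  have he'0 : 0 < e' := lt_min (by linarith) (by linarith)
  have hδ0 : ENNReal.ofReal δ₁ ≠ 0 := (ENNReal.ofReal_pos.2 hδ₁.1).ne'
  have hδ1 : ENNReal.ofReal δ₁ ≤ 1 := ENNReal.ofReal_le_one.2 hδ₁.2.le
  obtain ⟨q, hq, hγq, hη⟩ := exists_moment (γ := γ) (by linarith) he0 hς hδ₁.1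
  have hη1 : ENNReal.ofReal (ς ^ (-(e / 2))) < 1 :=
    ENNReal.ofReal_lt_one.2 (Real.rpow_lt_one_of_one_lt_of_neg hς (by linarith))
  obtain ⟨Y', hY'top, hY, hY'⟩ := exists_invariant_bound hη1
    (Coupling.growthConst_ne_top (d := d) (by omega) hγq (by linarith : 1 / 2 < 1 / 2 + e) hδ0)
  set A := ENNReal.ofReal (|alphaH H| * (4 / e' * (Real.pi / 2) + 2) + 1) with hA
  set M := (ENNReal.ofReal δ₁)⁻¹ *
    (ENNReal.ofReal (1 - ρ)⁻¹ * A * (6 * Y') * 2 * geomSeries (-α / 2)) with hM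
  have hα0 : 0 < α := hα 1 ▸ (hC 1 one_pos).valid.alpha_pos
  have hMtop : M ≠ ⊤ := by
    have h1 := geomSeries_ne_top (x := -α / 2) (by linarith)
    have h2 := ENNReal.inv_ne_top.2 hδ0
    rw [hM, hA]
    finiteness
  refine ⟨M.toReal + 1, by positivity, fun k hk K hK j => ?_⟩
  obtain ⟨n, rfl⟩ : ∃ n, k = n + 1 := ⟨k - 1, by omega⟩
  have h := (hC K hK).lintegral_discountedNorm_le (j := j) hΨm hρ₀ hς (ha K) hδ0 hδ1
    (fun n => hE K hK (n + 1) n.succ_pos) hq hγ0 hγlam (by linarith) he0.le hη hY hY' hρ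
    (fun ha0 hw hB => holder_le_of_modulus ⟨hH0, hH1⟩ hγ0 (by linarith) he'0 (min_le_left _ _)
      (min_le_right _ _) (by linarith) (by linarith) ha0 hw hB) n
  rw [hα K] at h
  calc _ ≤ M := h
    _ = ENNReal.ofReal M.toReal := (ENNReal.ofReal_toReal hMtop).symm
    _ ≤ _ := ENNReal.ofReal_le_ofReal (by linarith)
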